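/- Let $(\beta^j_i(t))_{j\ge 1,\,1\le i\le j,\,t\ge 1}$ be independent fair coin tosses with values in $\{0,1\}$, and let $X^j(t)=(X^j_1(t),\dots,X^j_j(t))\in\mathbb{Z}^j$, $j\ge1$, $t=0,1,2,\dots$, be the particle process of the shuffling algorithm: $X^j_i(0)=i$ and, with $z=X^j_i(t-1)+\beta^j_i(t)$, $$X^j_i(t)=z-\mathbf 1\{i<j,\ z=X^{j-1}_i(t)+1\}+\mathbf 1\{i>1,\ z=X^{j-1}_{i-1}(t)\},\qquad t\ge 1 .$$ Fix $k\ge 1$, extend $X^k$ to real times by linear interpolation, and for $N\ge1$, $t\ge 0$ put $$\tilde X^{k,N}_i(t)=\frac{X^k_i(Nt)-\frac12 Nt}{\frac12\sqrt N},\qquad 1\le i\le k .$$ Let $h(x)=\prod_{i<j}(x_j-x_i)$ and $\varphi_t(u)=(2\pi t)^{-1/2}e^{-u^2/(2t)}$. Dyson Brownian motion of $k$ particles started at the origin is the process $Y=(Y(t))_{t\ge0}$ in $\mathbb{R}^k$ with a.s. continuous paths, $Y(0)=0$ a.s., whose joint law at times $0<t_1<\dots<t_m$ has density $$\mu_{t_1}(y^1)\prod_{l=2}^{m}p_{t_l-t_{l-1}}(y^{l-1},y^l)$$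 on $\{(y^1,\dots,y^m): y^l_1<\dots<y^l_k \text{ for all } l\}$ and $0$ elsewhere, where $$\mu_t(y)=\frac{t^{-k^2/2}}{(2\pi)^{k/2}\prod_{j<k}j!}\,e^{-\sum_i y_i^2/(2t)}\,h(y)^2,\qquad p_t(x,y)=\frac{h(y)}{h(x)}\det\big[\varphi_t(y_i-x_j)\big]_{i,j=1}^k .$$ Then, as $N\to\infty$, $\tilde X^{k,N}$ converges to this Dyson Brownian motion in the sense of finite-dimensional distributions. That is: for all $0<t_1<\dots<t_m$ the function above is the density of a probability measure, and $(\tilde X^{k,N}(t_1),\dots,\tilde X^{k,N}(t_m))$ converges in distribution to that measure; and for every Dyson Brownian motion $Y$ of $k$ particles started at the origin and all $t_1,\dots,t_m\ge0$, $(\tilde X^{k,N}(t_1),\dots,\tilde X^{k,N}(t_m))$ converges in distribution to $(Y(t_1),\dots,Y(t_m))$. -/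

import Mathlib

open MeasureTheory ProbabilityTheory Filter
open scoped NNReal ENNReal

/-! ### The particle process of the shuffling algorithm

Line `j` carries the `j` particles `X^j_1, …, X^j_j`, indexed here by `Fin j` from `0`.
The coin `b j i t` is the one used by particle `i` on line `j` in the step from
time `t` to time `t + 1`. -/

/-- Trajectory of line `j + 1`, given the trajectory `u` of line `j` and the coins `c` of
line `j + 1`. It starts at `1, …, j + 1`. A particle first moves to `z = old position + coin`; it
is then pushed down by one if `z` is one above the new position of its upper neighbour
(the particle of line `j` with the same number, if there is one), and pushed up by one if `z` is
the new position of its lower neighbour (the particle of line `j` with the previous number, if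
there is one). -/
def lineAbove {j : ℕ} (u : ℕ → Fin j → ℤ) (c : Fin (j + 1) → ℕ → ℤ) : ℕ → Fin (j + 1) → ℤ
  | 0 => fun i => (i : ℤ) + 1
  | t + 1 => fun i =>
      let z : ℤ := lineAbove u c t i + c i t
      z - (if ∃ l : Fin j, l.castSucc = i ∧ z = u (t + 1) l + 1 then 1 else 0)
        + (if ∃ l : Fin j, l.succ = i ∧ z = u (t + 1) l then 1 else 0)

/-- The particle process: `shufflingLine b j t i` is the position at time `t` of the particle `i`
on line `j`, as a function of the coins `b`. -/
def shufflingLine (b : (j : ℕ) → Fin j → ℕ → ℤ) : (j : ℕ) → ℕ → Fin j → ℤ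
  | 0 => fun _ => Fin.elim0
  | j + 1 => lineAbove (shufflingLine b j) (b (j + 1))

/-- Linear interpolation of a sequence to real times `s ≥ 0`. -/
noncomputable def linInterp (f : ℕ → ℝ) (s : ℝ) : ℝ :=
  f ⌊s⌋₊ + (s - ⌊s⌋₊) * (f (⌊s⌋₊ + 1) - f ⌊s⌋₊)

/-- The rescaled line `k`: `(X^k_i(N t) - N t / 2) / (√N / 2)`. -/
noncomputable def rescaledLine (b : (j : ℕ) → Fin j → ℕ → ℤ) (k N : ℕ) (t : ℝ≥0) :
    Fin k → ℝ := fun i =>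
  (linInterp (fun n => (shufflingLine b k n i : ℝ)) ((N : ℝ) * t) - (N : ℝ) * t / 2)
    / (Real.sqrt N / 2)

/-! ### Dyson Brownian motion started at the origin -/

/-- `h(x) = ∏_{i < j} (x_j - x_i)`. -/
noncomputable def vandermondeProd {k : ℕ} (x : Fin k → ℝ) : ℝ :=
  ∏ i, ∏ j ∈ Finset.Ioi i, (x j - x i)

/-- Transition density `(h(y) / h(x)) det [φ_t(y_i - x_j)]` of Dyson Brownian motion, where `φ_t`
is the centred Gaussian density of variance `t`, for `x`, `y` in the chamber
`x_1 < ⋯ < x_k`. -/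
noncomputable def dysonTransition {k : ℕ} (t : ℝ≥0) (x y : Fin k → ℝ) : ℝ :=
  vandermondeProd y / vandermondeProd x *
    (Matrix.of fun i j : Fin k => gaussianPDFReal 0 t (y i - x j)).det

/-- Density at time `t` (on the chamber) of Dyson Brownian motion started at the origin:
`Z⁻¹ t^{-k²/2} exp(-∑ y_i² / (2t)) h(y)²` with `Z = (2π)^{k/2} ∏_{j < k} j!`. -/
noncomputable def dysonEntrance {k : ℕ} (t : ℝ≥0) (y : Fin k → ℝ) : ℝ :=
  ((2 * Real.pi) ^ ((k : ℝ) / 2) * ∏ j ∈ Finset.range k, (j.factorial : ℝ))⁻¹ *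
    (t : ℝ) ^ (-((k : ℝ) ^ 2 / 2)) * Real.exp (-∑ i, y i ^ 2 / (2 * (t : ℝ))) *
    vandermondeProd y ^ 2

/-- Joint density (on the `m`-th power of the chamber) at the times `t 0 < ⋯ < t (m - 1)`. -/
noncomputable def dysonDensity (k : ℕ) :
    {m : ℕ} → (Fin m → ℝ≥0) → (Fin m → Fin k → ℝ) → ℝ
  | 0, _, _ => 1
  | n + 1, t, y => dysonEntrance (t 0) (y 0) *
      ∏ i : Fin n, dysonTransition (t i.succ - t i.castSucc) (y i.castSucc) (y i.succ)

/-- Law of Dyson Brownian motion of `k` particles started at the origin, at the times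
`0 < t 0 < ⋯ < t (m - 1)`. -/
noncomputable def dysonLaw (k : ℕ) {m : ℕ} (t : Fin m → ℝ≥0) : Measure (Fin m → Fin k → ℝ) :=
  ((volume : Measure (Fin m → Fin k → ℝ)).restrict {y | ∀ l, StrictMono (y l)}).withDensity
    fun y => ENNReal.ofReal (dysonDensity k t y)

/-- `Y` is a Dyson Brownian motion of `k` particles with all particles started at the origin:
the almost surely continuous process started at `0` with the above entrance law and transition
densities. -/
structure IsDysonBM {Ω : Type*} [MeasurableSpace Ω] (k : ℕ) (Y : ℝ≥0 → Ω → Fin k → ℝ)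
    (P : Measure Ω) : Prop where
  start : ∀ᵐ ω ∂P, Y 0 ω = 0
  hasLaw : ∀ (m : ℕ) (t : Fin m → ℝ≥0), StrictMono t → (∀ l, 0 < t l) →
    HasLaw (fun ω l => Y (t l) ω) (dysonLaw k t) P
  continuous : ∀ᵐ ω ∂P, Continuous fun t => Y t ω

/-!
Why line `k` of the particle process converges to Dyson Brownian motion.

*A single line is a Doob transform.* Although line `j + 1` is driven by line `j`, each line has, on
its own, the law of independent Bernoulli walkers conditioned never to collide: a collision-free
trajectory `y` of `k` particles up to time `T` has probability `2^(-k T) h(y_T) / h(y_0)`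
(`IsFairCoins.measure_path`). The proof is by induction on the line. In one step, a collision with
a particle of the lower line doubles the number of coin values leading to the new position and
halves the number of previous positions of that particle, so that the total number of possibilities
depends only on whether the step is allowed (`prod_coinCount_mul_prod_card_prevPositions`).
Consequently the lower line can be summed out one time after another
(`IsFairCoins.measure_line_and_future`). The position of the lower line at the final time then runs
over the configurations interlacing with `y_T`, and summing `h` over them gives a multiple of
`h(y_T)` (`sum_vandermondeProd_interlacing`).

*Expectations along a line.* Conditioning backwards in time, expectations of products of functions
of the positions at several times become averages over independent simple random walks: what is
averaged is antisymmetric in the particles, hence vanishes at collisions, so collisions need not be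
forbidden. The walks start from the packed configuration. By exchangeability of its increments, a
walk started away from the origin has a polynomial density with respect to a walk with more steps
started at the origin; antisymmetrising, the packed start is traded for `k - 1` additional steps
and a second factor `h` (`exists_stepAvg_simpleWalk_packed`). The result is that, up to a constant
not depending on `f_0, …, f_n`, the expectation of `f_0(X(T_0)) ⋯ f_n(X(T_n))` is the mean of
`h(S_0) f_0(S_0) ⋯ f_n(S_n) h(S_n)` for a walk `S` of independent particles, the functions `f_l`
being evaluated at the sorted positions (`exists_integral_prod_line_eq`, `weightedMean`). The
constant is eliminated by dividing by the value for `f_l = 1`.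

*The limit.* The central limit theorem for the walks, together with exponential moments that are
bounded uniformly, shows that the weighted means converge to the same expressions for Brownian
motions (`tendsto_weightedMean_simpleWalk`).

*Dyson Brownian motion.* Its expectations are given by the same weighted means of independent
Brownian motions (`integral_prod_dysonLaw`), because an antisymmetric function has the same average
under killed and under free Brownian motion (`integral_chamber_gaussianDet_mul`). The joint density
is nonnegative since the determinants are (`det_exp_mul_nonneg`), and has integral `1` since `h` is
harmonic (`stepAvg_vandermondeProd`) and `∫ h² = k! ∏_{j < k} j!` for the standard Gaussian measure,
by orthogonality of the Hermite polynomials (`integral_vandermondeProd_sq_standard`).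

*From test functions to laws.* Characters of the product space are products of characters, so
Lévy's theorem yields convergence in distribution along the time grid
(`tendstoInDistribution_gridLine_succ`). Interpolation and the initial positions change the rescaled
process by `O(1 / √N)` only (`tendstoInDistribution_of_norm_sub_le`), and arbitrary times, possibly
zero, repeated or unordered, reduce to increasing positive ones
(`tendstoInDistribution_rescaledCoinLine_dysonBM`).
-/

/-! ### The Vandermonde product -/

section Vandermonde

open Polynomial

variable {k : ℕ}

theorem vandermondeProd_eq_det (x : Fin k → ℝ) :
    vandermondeProd x = (Matrix.vandermonde x).det :=
  (Matrix.det_vandermonde x).symm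

theorem vandermondeProd_eq_det_eval (x : Fin k → ℝ) (p : Fin k → ℝ[X])
    (hdeg : ∀ i, (p i).natDegree = i) (hmonic : ∀ i, (p i).Monic) :
    vandermondeProd x = (Matrix.of fun i j => (p j).eval (x i)).det := by
  rw [vandermondeProd_eq_det, Matrix.det_eval_matrixOfPolynomials_eq_det_vandermonde x p hdeg hmonic]

/-- The determinant of any `k` polynomials of degree below `k`, evaluated at `k` points, is
a constant multiple of the Vandermonde product of the points. -/
theorem exists_det_eval_eq_mul_vandermondeProd (p : Fin k → ℝ[X])
    (hdeg : ∀ j, (p j).natDegree < k) :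
    ∃ c : ℝ, ∀ x : Fin k → ℝ,
      (Matrix.of fun i j => (p j).eval (x i)).det = c * vandermondeProd x := by
  refine ⟨(Matrix.of fun i j : Fin k => (p j).coeff i).det, fun x => ?_⟩
  have : (Matrix.of fun i j => (p j).eval (x i))
      = Matrix.vandermonde x * Matrix.of fun i j : Fin k => (p j).coeff i := by
    ext i j
    rw [Matrix.of_apply, Matrix.mul_apply, Polynomial.eval_eq_sum_range' (hdeg j),
      ← Fin.sum_univ_eq_sum_range (fun n => (p j).coeff n * x i ^ n)]
    simp [Matrix.vandermonde_apply, mul_comm]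
  rw [this, Matrix.det_mul, ← vandermondeProd_eq_det, mul_comm]

theorem vandermondeProd_comp_perm (x : Fin k → ℝ) (σ : Equiv.Perm (Fin k)) :
    vandermondeProd (x ∘ σ) = (Equiv.Perm.sign σ : ℤ) * vandermondeProd x := by
  rw [vandermondeProd_eq_det, vandermondeProd_eq_det, ← Matrix.det_permute]
  rfl

theorem vandermondeProd_pos {x : Fin k → ℝ} (hx : StrictMono x) : 0 < vandermondeProd x :=
  Finset.prod_pos fun _ _ => Finset.prod_pos fun _ hj => sub_pos.2 (hx (Finset.mem_Ioi.1 hj))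

theorem vandermondeProd_affine (a b : ℝ) (x : Fin k → ℝ) :
    vandermondeProd (fun i => a * x i + b)
      = a ^ (∑ i : Fin k, (Finset.Ioi i).card) * vandermondeProd x := by
  unfold vandermondeProd
  rw [← Finset.prod_pow_eq_pow_sum, ← Finset.prod_mul_distrib]
  refine Finset.prod_congr rfl fun i _ => ?_
  rw [← Finset.prod_const, ← Finset.prod_mul_distrib]
  exact Finset.prod_congr rfl fun j _ => by ring

theorem continuous_vandermondeProd : Continuous (vandermondeProd (k := k)) := by
  unfold vandermondeProd
  fun_prop

theorem measurable_vandermondeProd : Measurable (vandermondeProd (k := k)) :=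
  continuous_vandermondeProd.measurable

theorem descPochhammer_eval_add_one (j : ℕ) (a : ℝ) :
    (descPochhammer ℝ (j + 1)).eval (a + 1) - (descPochhammer ℝ (j + 1)).eval a
      = (j + 1) * (descPochhammer ℝ j).eval a := by
  rw [descPochhammer_succ_eval (S := ℝ) j a, descPochhammer_succ_left]
  simp
  ring

theorem sum_Ico_descPochhammer_eval (j : ℕ) {a b : ℤ} (hab : a ≤ b) :
    ∑ x ∈ Finset.Ico a b, ((j : ℝ) + 1) * (descPochhammer ℝ j).eval (x : ℝ)
      = (descPochhammer ℝ (j + 1)).eval (b : ℝ) - (descPochhammer ℝ (j + 1)).eval (a : ℝ) := by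
  induction b, hab using Int.leInduction with
  | base => simp
  | succ b hab ih =>
    have : Finset.Ico a (b + 1) = insert b (Finset.Ico a b) := by
      ext x; simp only [Finset.mem_Ico, Finset.mem_insert]; omega
    rw [this, Finset.sum_insert (by simp), ih, ← descPochhammer_eval_add_one]
    push_cast
    ring

/-- Summing the Vandermonde product over all integer configurations of `k` points interlacing
with `k + 1` given ones yields the Vandermonde product of the given points, divided by `k!`. -/
theorem sum_vandermondeProd_interlacing (y : Fin (k + 1) → ℤ) (hy : Monotone y) :
    (k.factorial : ℝ) * ∑ x ∈ Fintype.piFinset fun l : Fin k => Finset.Ico (y l.castSucc) (y l.succ),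
        vandermondeProd (fun l => (x l : ℝ))
      = vandermondeProd (fun i => (y i : ℝ)) := by
  -- Write `h(y)` as a determinant of falling factorials and subtract from each row its predecessor:
  -- the first column becomes `1, 0, …, 0`, and the other entries telescope over the gaps of `y`.
  have hdet : vandermondeProd (fun i => (y i : ℝ))
      = (Matrix.of fun (l j : Fin k) => ∑ x ∈ Finset.Ico (y l.castSucc) (y l.succ),
          ((j : ℕ) + 1 : ℝ) * (descPochhammer ℝ j).eval (x : ℝ)).det := by
    rw [vandermondeProd_eq_det_eval _ (fun i => descPochhammer ℝ i)
      (fun i => descPochhammer_natDegree ℝ _) (fun i => monic_descPochhammer ℝ _)]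
    rw [Matrix.det_eq_of_forall_row_eq_smul_add_pred
      (B := Matrix.of fun i j => Fin.cases ((descPochhammer ℝ j).eval (y 0 : ℝ))
        (fun l : Fin k => (descPochhammer ℝ j).eval (y l.succ : ℝ)
          - (descPochhammer ℝ j).eval (y l.castSucc : ℝ)) i) (fun _ => 1)
      (fun j => by simp) (fun i j => by simp)]
    rw [Matrix.det_succ_column_zero, Fin.sum_univ_succ]
    simp only [Matrix.of_apply, Fin.val_zero, pow_zero, Fin.cases_zero, Fin.cases_succ,
      descPochhammer_zero, eval_one, mul_one, one_mul, sub_self, mul_zero, zero_mul,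
      Finset.sum_const_zero, add_zero]
    congr 1
    ext l j
    rw [Matrix.of_apply, sum_Ico_descPochhammer_eval _ (hy (Fin.castSucc_lt_succ).le)]
    simp
  have hfac : (k.factorial : ℝ) = ∏ j : Fin k, (((j : ℕ) : ℝ) + 1) := by
    rw [Fin.prod_univ_eq_prod_range (fun j => (j : ℝ) + 1) k, ← Finset.prod_range_add_one_eq_factorial]
    push_cast
    rfl
  rw [hdet]
  -- The determinant is additive in each row, so the sums over the gaps can be taken out.
  have := (Matrix.detRowAlternating (n := Fin k) (R := ℝ)).toMultilinearMap.map_sum_finset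
    (fun (_ : Fin k) (x : ℤ) (j : Fin k) => ((j : ℕ) + 1 : ℝ) * (descPochhammer ℝ j).eval (x : ℝ))
    (fun l => Finset.Ico (y l.castSucc) (y l.succ))
  have e : (Matrix.of fun (l j : Fin k) => ∑ x ∈ Finset.Ico (y l.castSucc) (y l.succ),
          ((j : ℕ) + 1 : ℝ) * (descPochhammer ℝ j).eval (x : ℝ))
      = fun l => ∑ x ∈ Finset.Ico (y l.castSucc) (y l.succ),
          fun j : Fin k => ((j : ℕ) + 1 : ℝ) * (descPochhammer ℝ j).eval (x : ℝ) := by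
    ext l j
    simp [Finset.sum_apply]
  rw [e]
  refine Eq.trans ?_ this.symm
  rw [Finset.mul_sum]
  refine Finset.sum_congr rfl fun x _ => ?_
  rw [hfac, vandermondeProd_eq_det_eval _ (fun i => descPochhammer ℝ i)
      (fun i => descPochhammer_natDegree ℝ _) (fun i => monic_descPochhammer ℝ _),
      ← Matrix.det_mul_row]
  rfl

/-- The packed configuration of `k` points is the only one interlacing with the packed
configuration of `k + 1` points. -/
theorem vandermondeProd_first_positions_succ (k : ℕ) :
    vandermondeProd (fun i : Fin (k + 1) => ((i : ℕ) : ℝ) + 1)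
      = k.factorial * vandermondeProd (fun i : Fin k => ((i : ℕ) : ℝ) + 1) := by
  have h := sum_vandermondeProd_interlacing (fun i : Fin (k + 1) => ((i : ℕ) : ℤ) + 1)
    (fun a b hab => by simpa using hab)
  have hs : (Fintype.piFinset fun l : Fin k => Finset.Ico (((l.castSucc : ℕ) : ℤ) + 1)
      (((l.succ : ℕ) : ℤ) + 1)) = {fun l : Fin k => ((l : ℕ) : ℤ) + 1} := by
    ext x
    simp only [Fintype.mem_piFinset, Finset.mem_Ico, Finset.mem_singleton, funext_iff,
      Fin.val_castSucc, Fin.val_succ]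
    refine forall_congr' fun l => ?_
    push_cast
    omega
  rw [hs] at h
  simpa using h.symm

end Vandermonde

/-! ### One step of two consecutive lines -/

section OneStep

/-- Position of particle `i` after the pushes exerted by the line below, which is at `x`, when
its own coin has brought it to `z`. -/
def pushed {j : ℕ} (x : Fin j → ℤ) (i : Fin (j + 1)) (z : ℤ) : ℤ :=
  z - (if ∃ l : Fin j, l.castSucc = i ∧ z = x l + 1 then 1 else 0)
    + (if ∃ l : Fin j, l.succ = i ∧ z = x l then 1 else 0)

/-- The line `x` of `j` particles interlaces with the line `y` of `j + 1` particles: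
`y_1 ≤ x_1 < y_2 ≤ x_2 < ⋯ < y_{j+1}`. -/
def Interlaces {j : ℕ} (x : Fin j → ℤ) (y : Fin (j + 1) → ℤ) : Prop :=
  ∀ l : Fin j, y l.castSucc ≤ x l ∧ x l < y l.succ

/-- A step of non-colliding Bernoulli walkers: each coordinate grows by `0` or `1`, and the new
position is strictly increasing. -/
def IsStep {j : ℕ} (x x' : Fin j → ℤ) : Prop :=
  (∀ i, x' i = x i ∨ x' i = x i + 1) ∧ StrictMono x'

theorem Interlaces.strictMono {j : ℕ} {x : Fin j → ℤ} {y : Fin (j + 1) → ℤ}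
    (h : Interlaces x y) : StrictMono x := by
  cases j with
  | zero => exact fun a => a.elim0
  | succ j =>
    refine Fin.strictMono_iff_lt_succ.2 fun l => ?_
    exact (h l.castSucc).2.trans_le (by simpa using (h l.succ).1)

open Classical in
/-- The number of values of the coin that bring particle `i` from `a` to `b`, when the line
below is at `x`. -/
noncomputable def coinCount {j : ℕ} (x : Fin j → ℤ) (i : Fin (j + 1)) (a b : ℤ) : ℕ :=
  (if pushed x i a = b then 1 else 0) + (if pushed x i (a + 1) = b then 1 else 0)

open Classical in
/-- If a neighbour of particle `i` in the line below is at the old position `a`, the push makes both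
values of the coin lead to the same place; otherwise distinct values lead to distinct places. -/
theorem coinCount_eq {j : ℕ} {x : Fin j → ℤ} (hx : StrictMono x) (i : Fin (j + 1)) (a b : ℤ)
    (hlow : ∀ l : Fin j, l.castSucc = i → a ≤ x l) (hup : ∀ l : Fin j, l.succ = i → x l ≤ a) :
    coinCount x i a b
      = (if ∃ l : Fin j, l.castSucc = i ∧ x l = a then 2 else 1)
        * (if ∃ l : Fin j, l.succ = i ∧ x l = a then 2 else 1)
        * (if (b = a ∨ b = a + 1) ∧ (∀ l : Fin j, l.castSucc = i → b ≤ x l) ∧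
            (∀ l : Fin j, l.succ = i → x l < b) then 1 else 0) := by
  have key1 : ∀ (l : Fin j) (Q : Fin j → Prop), l.castSucc = i →
      ((∃ l' : Fin j, l'.castSucc = i ∧ Q l') ↔ Q l) := by
    rintro l Q rfl
    constructor
    · rintro ⟨l', h1, h2⟩
      rwa [← Fin.castSucc_injective _ h1]
    · exact fun h => ⟨l, rfl, h⟩
  have key1' : ∀ (l : Fin j) (Q : Fin j → Prop), l.castSucc = i →
      ((∀ l' : Fin j, l'.castSucc = i → Q l') ↔ Q l) := by
    rintro l Q rfl
    constructor
    · exact fun h => h l rfl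
    · intro h l' h'
      rwa [Fin.castSucc_injective _ h']
  have key2 : ∀ (l : Fin j) (Q : Fin j → Prop), l.succ = i →
      ((∃ l' : Fin j, l'.succ = i ∧ Q l') ↔ Q l) := by
    rintro l Q rfl
    constructor
    · rintro ⟨l', h1, h2⟩
      rwa [← Fin.succ_injective _ h1]
    · exact fun h => ⟨l, rfl, h⟩
  have key2' : ∀ (l : Fin j) (Q : Fin j → Prop), l.succ = i →
      ((∀ l' : Fin j, l'.succ = i → Q l') ↔ Q l) := by
    rintro l Q rfl
    constructor
    · exact fun h => h l rfl
    · intro h l' h'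
      rwa [Fin.succ_injective _ h']
  unfold coinCount pushed
  by_cases h1 : ∃ l : Fin j, l.castSucc = i
  · obtain ⟨l, hl⟩ := h1
    have hlow := hlow l hl
    simp only [key1 l _ hl, key1' l _ hl]
    by_cases h2 : ∃ m : Fin j, m.succ = i
    · obtain ⟨m, hm⟩ := h2
      have hup := hup m hm
      have hml : x m < x l := hx (by
        rw [Fin.lt_def]
        have := congrArg Fin.val (hl.trans hm.symm)
        simp at this
        omega)
      simp only [key2 m _ hm, key2' m _ hm]
      split_ifs <;> omega
    · have h2' : ∀ m : Fin j, m.succ ≠ i := fun m hm => h2 ⟨m, hm⟩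
      simp only [h2', false_and, exists_false, if_false, false_imp_iff, implies_true, and_true]
      split_ifs <;> omega
  · have h1' : ∀ m : Fin j, m.castSucc ≠ i := fun m hm => h1 ⟨m, hm⟩
    simp only [h1', false_and, exists_false, if_false, false_imp_iff, implies_true, true_and]
    by_cases h2 : ∃ m : Fin j, m.succ = i
    · obtain ⟨m, hm⟩ := h2
      have hup := hup m hm
      simp only [key2 m _ hm, key2' m _ hm]
      split_ifs <;> omega
    · have h2' : ∀ m : Fin j, m.succ ≠ i := fun m hm => h2 ⟨m, hm⟩
      simp only [h2', false_and, exists_false, if_false, false_imp_iff, implies_true, and_true]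
      split_ifs <;> omega

/-- The possible previous positions of a particle now at `b` that interlaced with `y` at `l`. -/
noncomputable def prevPositions {j : ℕ} (y : Fin (j + 1) → ℤ) (l : Fin j) (b : ℤ) : Finset ℤ :=
  (Finset.Ico (y l.castSucc) (y l.succ)).filter fun a => b = a ∨ b = a + 1

/-- A particle at `b` can have come from two positions, unless `b` is an end point of the interval
between its two neighbours in `y`, where one of them violates the interlacing. -/
theorem card_prevPositions_mul {j : ℕ} {y : Fin (j + 1) → ℤ} (hy : StrictMono y) (l : Fin j)
    {b : ℤ} (h1 : y l.castSucc ≤ b) (h2 : b ≤ y l.succ) :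
    (prevPositions y l b).card * ((if b = y l.castSucc then 2 else 1)
      * (if b = y l.succ then 2 else 1)) = 2 := by
  have hlt : y l.castSucc < y l.succ := hy Fin.castSucc_lt_succ
  have hsub : prevPositions y l b = ({b - 1, b} : Finset ℤ).filter
      fun a => y l.castSucc ≤ a ∧ a < y l.succ := by
    ext a
    simp only [prevPositions, Finset.mem_filter, Finset.mem_Ico, Finset.mem_insert,
      Finset.mem_singleton]
    omega
  rw [hsub, Finset.filter_insert, Finset.filter_singleton]
  have hne : b - 1 ≠ b := by omega
  split_ifs <;> first | omega | simp [hne]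

theorem prevPositions_eq_empty {j : ℕ} {y : Fin (j + 1) → ℤ} {l : Fin j}
    {b : ℤ} (h : ¬ (y l.castSucc ≤ b ∧ b ≤ y l.succ)) : prevPositions y l b = ∅ := by
  rw [prevPositions, Finset.filter_eq_empty_iff]
  intro a ha
  rw [Finset.mem_Ico] at ha
  omega

open Classical in
/-- The identity behind the Markov property of a single line. With the line below at `x` after the
step, each collision with a particle of that line doubles the number of coin values leading to
`y'` and halves the number of previous positions of the line below; hence the total number of
possibilities depends only on whether the step is allowed. -/
theorem prod_coinCount_mul_prod_card_prevPositions {j : ℕ} {x : Fin j → ℤ} (hx : StrictMono x)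
    {y : Fin (j + 1) → ℤ} (hy : StrictMono y) (y' : Fin (j + 1) → ℤ) :
    (∏ i, coinCount x i (y i) (y' i)) * ∏ l, (prevPositions y l (x l)).card
      = if (∀ i, y' i = y i ∨ y' i = y i + 1) ∧ Interlaces x y' then 2 ^ j else 0 := by
  by_cases hc : ∀ l : Fin j, y l.castSucc ≤ x l ∧ x l ≤ y l.succ
  · have h1 : ∀ i, coinCount x i (y i) (y' i)
      = (if ∃ l : Fin j, l.castSucc = i ∧ x l = y i then 2 else 1)
        * (if ∃ l : Fin j, l.succ = i ∧ x l = y i then 2 else 1)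
        * (if (y' i = y i ∨ y' i = y i + 1) ∧ (∀ l : Fin j, l.castSucc = i → y' i ≤ x l) ∧
            (∀ l : Fin j, l.succ = i → x l < y' i) then 1 else 0) := fun i =>
      coinCount_eq hx i _ _ (by rintro l rfl; exact (hc l).1) (by rintro l rfl; exact (hc l).2)
    have hA : (∏ i : Fin (j + 1), if ∃ l : Fin j, l.castSucc = i ∧ x l = y i then 2 else 1)
        = ∏ l : Fin j, if x l = y l.castSucc then 2 else 1 := by
      rw [Fin.prod_univ_castSucc]
      simp [Fin.castSucc_ne_last]
    have hB : (∏ i : Fin (j + 1), if ∃ l : Fin j, l.succ = i ∧ x l = y i then 2 else 1)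
        = ∏ l : Fin j, if x l = y l.succ then 2 else 1 := by
      rw [Fin.prod_univ_succ]
      simp [Fin.succ_ne_zero]
    have hV : (∏ i : Fin (j + 1), if (y' i = y i ∨ y' i = y i + 1) ∧
          (∀ l : Fin j, l.castSucc = i → y' i ≤ x l) ∧
            (∀ l : Fin j, l.succ = i → x l < y' i) then 1 else 0)
        = if (∀ i, y' i = y i ∨ y' i = y i + 1) ∧ Interlaces x y' then 1 else 0 := by
      rw [Finset.prod_ite_zero, Finset.prod_const_one]
      congr 1
      simp only [Finset.mem_univ, true_imp_iff, eq_iff_iff]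
      constructor
      · exact fun h => ⟨fun i => (h i).1, fun l => ⟨(h _).2.1 l rfl, (h _).2.2 l rfl⟩⟩
      · rintro ⟨h, h'⟩ i
        exact ⟨h i, by rintro l rfl; exact (h' l).1, by rintro l rfl; exact (h' l).2⟩
    have hC : (∏ l, (prevPositions y l (x l)).card)
        * ((∏ l : Fin j, if x l = y l.castSucc then 2 else 1)
          * ∏ l : Fin j, if x l = y l.succ then 2 else 1) = 2 ^ j := by
      rw [← Finset.prod_mul_distrib, ← Finset.prod_mul_distrib,
        Finset.prod_congr rfl fun l _ => card_prevPositions_mul hy l (hc l).1 (hc l).2]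
      simp
    simp only [h1, Finset.prod_mul_distrib, hA, hB, hV]
    rw [mul_right_comm, mul_comm _ (∏ l, (prevPositions y l (x l)).card), hC]
    simp
  · push Not at hc
    obtain ⟨l, hl⟩ := hc
    rw [Finset.prod_eq_zero (f := fun l => (prevPositions y l (x l)).card) (Finset.mem_univ l)
      (by rw [prevPositions_eq_empty (fun h => absurd h.2 (not_le.2 (hl h.1)))]; rfl), mul_zero,
      if_neg]
    rintro ⟨h, h'⟩
    have e1 := h l.castSucc
    have e2 := h l.succ
    have e3 := h' l
    have := fun h => hl h
    omega

end OneStep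

/-! ### The law of the trajectory of one line -/

section PathLaw

/-- Independent fair coins with values in `{0, 1}`. -/
structure IsFairCoins {Ω : Type*} [MeasurableSpace Ω] (P : Measure Ω)
    (β : (j : ℕ) → Fin j → ℕ → Ω → ℤ) : Prop where
  measurable : ∀ j i t, Measurable (β j i t)
  indep : iIndepFun (fun p : (Σ j : ℕ, Fin j × ℕ) => β p.1 p.2.1 p.2.2) P
  zero : ∀ j i t, P {ω | β j i t ω = 0} = 1 / 2
  one : ∀ j i t, P {ω | β j i t ω = 1} = 1 / 2

/-- Line `k` at time `t` as a random variable. -/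
def coinLine {Ω : Type*} (β : (j : ℕ) → Fin j → ℕ → Ω → ℤ) (k t : ℕ) (ω : Ω) : Fin k → ℤ :=
  shufflingLine (fun j i s => β j i s ω) k t

variable {Ω : Type*}

theorem coinLine_zero (β : (j : ℕ) → Fin j → ℕ → Ω → ℤ) (k : ℕ) (ω : Ω) (i : Fin k) :
    coinLine β k 0 ω i = (i : ℤ) + 1 := by
  cases k with
  | zero => exact i.elim0
  | succ k => rfl

theorem coinLine_succ (β : (j : ℕ) → Fin j → ℕ → Ω → ℤ) (k t : ℕ) (ω : Ω) (i : Fin (k + 1)) :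
    coinLine β (k + 1) (t + 1) ω i
      = pushed (coinLine β k (t + 1) ω) i (coinLine β (k + 1) t ω i + β (k + 1) i t ω) :=
  rfl

/-- A line is measurable for any σ-algebra that makes the coins of that line and of the lines
below it measurable. -/
theorem measurable_coinLine_of_le {m : MeasurableSpace Ω} {β : (j : ℕ) → Fin j → ℕ → Ω → ℤ}
    (k : ℕ) (h : ∀ j ≤ k, ∀ i t, Measurable (β j i t)) (t : ℕ) :
    Measurable (coinLine β k t) := by
  induction k generalizing t with
  | zero => exact measurable_of_subsingleton_codomain _
  | succ k ihk =>
    have ihk := ihk fun j hj => h j (by omega)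
    induction t with
    | zero =>
      refine measurable_pi_lambda _ fun i => ?_
      simp only [coinLine_zero]
      exact measurable_const
    | succ t iht =>
      refine measurable_pi_lambda _ fun i => ?_
      simp only [coinLine_succ]
      have h1 : Measurable fun ω => (coinLine β k (t + 1) ω,
          coinLine β (k + 1) t ω i + β (k + 1) i t ω) :=
        (ihk (t + 1)).prodMk (((measurable_pi_apply i).comp iht).add (h _ le_rfl i t))
      exact (measurable_of_countable fun q : (Fin k → ℤ) × ℤ => pushed q.1 i q.2).comp h1

/-- A trajectory up to time `T` that starts at `1, …, k` and consists of non-colliding steps. -/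
def IsPath {k : ℕ} (T : ℕ) (y : ℕ → Fin k → ℤ) : Prop :=
  (∀ i, y 0 i = (i : ℤ) + 1) ∧ ∀ s < T, IsStep (y s) (y (s + 1))

theorem IsPath.strictMono {k T : ℕ} {y : ℕ → Fin k → ℤ} (h : IsPath T y) : StrictMono (y T) := by
  cases T with
  | zero =>
    intro a b hab
    rw [h.1, h.1]
    have : (a : ℕ) < b := hab
    omega
  | succ T => exact (h.2 T (Nat.lt_succ_self T)).2

theorem isPath_succ {k T : ℕ} {y : ℕ → Fin k → ℤ} :
    IsPath (T + 1) y ↔ IsPath T y ∧ IsStep (y T) (y (T + 1)) := by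
  constructor
  · exact fun h => ⟨⟨h.1, fun s hs => h.2 s (by omega)⟩, h.2 T (by omega)⟩
  · rintro ⟨h, h'⟩
    refine ⟨h.1, fun s hs => ?_⟩
    rcases Nat.lt_succ_iff_lt_or_eq.1 hs with hs | rfl
    · exact h.2 s hs
    · exact h'

/-- The Vandermonde product of a configuration, relative to that of `1, …, k`. -/
noncomputable def relVandermonde {k : ℕ} (x : Fin k → ℤ) : ℝ :=
  vandermondeProd (fun i => (x i : ℝ)) / vandermondeProd (fun i : Fin k => ((i : ℕ) : ℝ) + 1)

theorem vandermondeProd_first_positions_pos (k : ℕ) :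
    0 < vandermondeProd (fun i : Fin k => ((i : ℕ) : ℝ) + 1) :=
  vandermondeProd_pos fun a b hab => by
    have : (a : ℕ) < b := hab
    simpa using this

theorem relVandermonde_nonneg {k : ℕ} {x : Fin k → ℤ} (hx : StrictMono x) :
    0 ≤ relVandermonde x :=
  div_nonneg (vandermondeProd_pos fun a b hab => by exact_mod_cast hx hab).le
    (vandermondeProd_first_positions_pos k).le

/-- With the normalisation at the packed configuration, the factorial disappears from the
interlacing sum. -/
theorem sum_relVandermonde_interlacing {k : ℕ} (y : Fin (k + 1) → ℤ) (hy : Monotone y) :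
    ∑ x ∈ Fintype.piFinset fun l : Fin k => Finset.Ico (y l.castSucc) (y l.succ), relVandermonde x
      = relVandermonde y := by
  unfold relVandermonde
  rw [← Finset.sum_div, vandermondeProd_first_positions_succ, ← sum_vandermondeProd_interlacing y hy]
  have := k.factorial_ne_zero
  have := (vandermondeProd_first_positions_pos k).ne'
  field_simp

open Classical in
/-- The probability that line `k` follows a given trajectory: that of Bernoulli walkers
conditioned, in the sense of Doob, never to collide. -/
noncomputable def pathProb {k : ℕ} (T : ℕ) (y : ℕ → Fin k → ℤ) : ℝ≥0∞ :=
  if IsPath T y then ENNReal.ofReal (relVandermonde (y T)) * 2⁻¹ ^ (k * T) else 0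

variable [MeasurableSpace Ω] {P : Measure Ω} [IsProbabilityMeasure P]
  {β : (j : ℕ) → Fin j → ℕ → Ω → ℤ}

theorem IsFairCoins.ae_eq_zero_or_one (hβ : IsFairCoins P β) (j : ℕ) (i : Fin j) (t : ℕ) :
    ∀ᵐ ω ∂P, β j i t ω = 0 ∨ β j i t ω = 1 := by
  have h0 : MeasurableSet {ω | β j i t ω = 0} := hβ.measurable j i t (measurableSet_singleton 0)
  have h1 : MeasurableSet {ω | β j i t ω = 1} := hβ.measurable j i t (measurableSet_singleton 1)
  have : P ({ω | β j i t ω = 0} ∪ {ω | β j i t ω = 1}) = 1 := by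
    rw [measure_union (Set.disjoint_left.2 fun ω h h' => zero_ne_one (h.symm.trans h')) h1,
      hβ.zero, hβ.one, ENNReal.add_halves]
  exact (prob_compl_eq_zero_iff (h0.union h1)).2 this

open Classical in
theorem IsFairCoins.measure_setOf (hβ : IsFairCoins P β) (j : ℕ) (i : Fin j) (t : ℕ)
    (Q : ℤ → Prop) :
    P {ω | Q (β j i t ω)} = (((if Q 0 then 1 else 0) + (if Q 1 then 1 else 0) : ℕ) : ℝ≥0∞) * 2⁻¹ := by
  have hae := hβ.ae_eq_zero_or_one j i t
  by_cases h0 : Q 0 <;> by_cases h1 : Q 1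
  · have : {ω | Q (β j i t ω)} =ᵐ[P] Set.univ := by
      filter_upwards [hae] with ω hω
      refine eq_true ?_
      change Q _
      rcases hω with h | h <;> rwa [h]
    rw [measure_congr this]
    simp [h0, h1, one_add_one_eq_two, ENNReal.mul_inv_cancel]
  · have : {ω | Q (β j i t ω)} =ᵐ[P] {ω | β j i t ω = 0} := by
      filter_upwards [hae] with ω hω
      refine propext ?_
      change Q _ ↔ β j i t ω = 0
      rcases hω with h | h <;> simp [h, h0, h1]
    rw [measure_congr this, hβ.zero]
    simp [h0, h1]
  · have : {ω | Q (β j i t ω)} =ᵐ[P] {ω | β j i t ω = 1} := by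
      filter_upwards [hae] with ω hω
      refine propext ?_
      change Q _ ↔ β j i t ω = 1
      rcases hω with h | h <;> simp [h, h0, h1]
    rw [measure_congr this, hβ.one]
    simp [h0, h1]
  · have : {ω | Q (β j i t ω)} =ᵐ[P] (∅ : Set Ω) := by
      filter_upwards [hae] with ω hω
      refine eq_false ?_
      change ¬ Q _
      rcases hω with h | h <;> rwa [h]
    rw [measure_congr this]
    simp [h0, h1]

omit [IsProbabilityMeasure P] in
theorem IsFairCoins.measurable_coinLine (hβ : IsFairCoins P β) (k t : ℕ) :
    Measurable (coinLine β k t) :=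
  measurable_coinLine_of_le k (fun j _ => hβ.measurable j) t

omit [MeasurableSpace Ω] in
theorem measurableSet_forall_le_coinLine {m : MeasurableSpace Ω} {β : (j : ℕ) → Fin j → ℕ → Ω → ℤ}
    {k : ℕ} (h : ∀ t, Measurable (coinLine β k t)) (p : ℕ → Prop)
    (x : ℕ → Fin k → ℤ) : MeasurableSet {ω | ∀ s, p s → coinLine β k s ω = x s} := by
  simp only [Set.ofPred_forall]
  exact MeasurableSet.iInter fun s => MeasurableSet.iInter fun _ =>
    h s (measurableSet_singleton (x s))

/-- Given the trajectory of line `j`, the trajectory of line `j + 1` is determined by independent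
coins. -/
theorem IsFairCoins.measure_two_lines (hβ : IsFairCoins P β) (j T : ℕ) (x : ℕ → Fin j → ℤ)
    (y : ℕ → Fin (j + 1) → ℤ) (hy : ∀ i, y 0 i = (i : ℤ) + 1) :
    P {ω | (∀ s, s ≤ T → coinLine β j s ω = x s) ∧ (∀ s, s ≤ T → coinLine β (j + 1) s ω = y s)}
      = P {ω | ∀ s, s ≤ T → coinLine β j s ω = x s}
        * ∏ s ∈ Finset.range T, ∏ i, ((coinCount (x (s + 1)) i (y s i) (y (s + 1) i) : ℝ≥0∞) * 2⁻¹) := by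
  set A := {ω | ∀ s, s ≤ T → coinLine β j s ω = x s} with hA
  set B := {ω | ∀ s, s < T → ∀ i,
    pushed (x (s + 1)) i (y s i + β (j + 1) i s ω) = y (s + 1) i} with hB
  have hset : {ω | (∀ s, s ≤ T → coinLine β j s ω = x s) ∧
      (∀ s, s ≤ T → coinLine β (j + 1) s ω = y s)} = A ∩ B := by
    ext ω
    simp only [hA, hB, Set.mem_inter_iff, Set.mem_ofPred_eq]
    refine and_congr_right fun hx => ⟨fun h s hs i => ?_, fun h s hs => ?_⟩
    · rw [← h (s + 1) (by omega), ← h s (by omega), ← hx (s + 1) (by omega), coinLine_succ]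
    · induction s with
      | zero => exact funext fun i => by rw [coinLine_zero, hy]
      | succ s ih =>
        funext i
        rw [coinLine_succ, hx (s + 1) hs, ih (by omega), h s (by omega)]
  -- `A` depends only on the coins of the lines up to `j`, and `B` only on those of line `j + 1`.
  let F : (Σ j : ℕ, Fin j × ℕ) → MeasurableSpace Ω :=
    fun p => MeasurableSpace.comap (β p.1 p.2.1 p.2.2) inferInstance
  have hle : ∀ p, F p ≤ ‹MeasurableSpace Ω› := fun p => (hβ.measurable _ _ _).comap_le
  have hind : Indep (⨆ p ∈ {p : (Σ j : ℕ, Fin j × ℕ) | p.1 ≤ j}, F p)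
      (⨆ p ∈ {p : (Σ j : ℕ, Fin j × ℕ) | p.1 = j + 1}, F p) P :=
    indep_iSup_of_disjoint hle hβ.indep.iIndep
      (Set.disjoint_left.2 fun p h h' => absurd (h'.symm.le.trans h) (by simp))
  have hmeas : ∀ (S : Set (Σ j : ℕ, Fin j × ℕ)) (j : ℕ) (i : Fin j) (t : ℕ), (⟨j, i, t⟩ : Σ j : ℕ, Fin j × ℕ) ∈ S →
      Measurable[⨆ p ∈ S, F p] (β j i t) := by
    intro S j i t hp
    have h1 : F ⟨j, i, t⟩ ≤ ⨆ p ∈ S, F p := le_iSup₂ (f := fun p _ => F p) _ hp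
    exact Measurable.mono (comap_measurable (β j i t)) h1 le_rfl
  have hAm : MeasurableSet[⨆ p ∈ {p : (Σ j : ℕ, Fin j × ℕ) | p.1 ≤ j}, F p] A :=
    measurableSet_forall_le_coinLine
      (fun t => measurable_coinLine_of_le j (fun j' hj' i t => hmeas _ j' i t hj') t) _ x
  have hBm : MeasurableSet[⨆ p ∈ {p : (Σ j : ℕ, Fin j × ℕ) | p.1 = j + 1}, F p] B := by
    simp only [hB, Set.ofPred_forall]
    refine MeasurableSet.iInter fun s => MeasurableSet.iInter fun _ => MeasurableSet.iInter fun i => ?_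
    exact hmeas {p | p.1 = j + 1} (j + 1) i s (Eq.refl (j + 1)) (MeasurableSet.of_discrete
      (s := {b : ℤ | pushed (x (s + 1)) i (y s i + b) = y (s + 1) i}))
  have hPB : P B = ∏ s ∈ Finset.range T,
      ∏ i, ((coinCount (x (s + 1)) i (y s i) (y (s + 1) i) : ℝ≥0∞) * 2⁻¹) := by
    have hinj : Function.Injective fun q : ℕ × Fin (j + 1) =>
        (⟨j + 1, q.2, q.1⟩ : Σ j : ℕ, Fin j × ℕ) := by
      rintro ⟨a, b⟩ ⟨c, d⟩ h
      simp only [Sigma.mk.injEq, heq_eq_eq, Prod.mk.injEq, true_and] at h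
      exact Prod.ext h.2 h.1
    have h2 := (hβ.indep.precomp hinj).measure_inter_preimage_eq_mul
      (Finset.range T ×ˢ (Finset.univ : Finset (Fin (j + 1))))
      (sets := fun q => {b : ℤ | pushed (x (q.1 + 1)) q.2 (y q.1 q.2 + b) = y (q.1 + 1) q.2})
      (fun _ _ => MeasurableSet.of_discrete)
    rw [← Finset.prod_product']
    refine Eq.trans ?_ (h2.trans ?_)
    · congr 1
      ext ω
      simp [hB]
      exact ⟨fun h a b hb => h a hb b, fun h a ha b => h a b ha⟩
    · refine Finset.prod_congr rfl fun q _ => ?_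
      refine (hβ.measure_setOf (j + 1) q.2 q.1
        (fun b => pushed (x (q.1 + 1)) q.2 (y q.1 q.2 + b) = y (q.1 + 1) q.2)).trans ?_
      simp [coinCount]
  rw [hset, (Indep_iff _ _ P).1 hind A B hAm hBm, hPB]

end PathLaw

section PathLaw

variable {Ω : Type*} [MeasurableSpace Ω] {P : Measure Ω} [IsProbabilityMeasure P]
  {β : (j : ℕ) → Fin j → ℕ → Ω → ℤ}

omit [IsProbabilityMeasure P] in
theorem measure_eq_tsum_inter_fiber {α : Type*} [Countable α] [MeasurableSpace α]
    [MeasurableSingletonClass α] {A : Set Ω} (hA : MeasurableSet A) {f : Ω → α}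
    (hf : Measurable f) : P A = ∑' a, P (A ∩ {ω | f ω = a}) := by
  rw [← measure_iUnion]
  · congr 1
    ext ω
    simp
  · intro a b hab
    exact Set.disjoint_left.2 fun ω h h' => hab (h.2.symm.trans h'.2)
  · exact fun a => hA.inter (hf (measurableSet_singleton a))

open Classical in
/-- Summing over the previous positions of the lower line the probability that the upper line steps
from `y` to `y'`, while the lower line steps to `x`. -/
theorem tsum_interlaces_isStep {j : ℕ} {y y' : Fin (j + 1) → ℤ} (hy : StrictMono y)
    (x : Fin j → ℤ) :
    (∑' ξ : Fin j → ℤ, if Interlaces ξ y ∧ IsStep ξ x then (1 : ℝ≥0∞) else 0)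
        * ∏ i, ((coinCount x i (y i) (y' i) : ℝ≥0∞) * 2⁻¹)
      = if IsStep y y' ∧ Interlaces x y' then 2⁻¹ else 0 := by
  by_cases hx : StrictMono x
  · have h1 : (∑' ξ : Fin j → ℤ, if Interlaces ξ y ∧ IsStep ξ x then (1 : ℝ≥0∞) else 0)
        = ((∏ l, (prevPositions y l (x l)).card : ℕ) : ℝ≥0∞) := by
      have hmem : ∀ ξ : Fin j → ℤ, ξ ∈ Fintype.piFinset (fun l => prevPositions y l (x l)) ↔
          Interlaces ξ y ∧ IsStep ξ x := by
        intro ξ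
        simp only [Fintype.mem_piFinset, prevPositions, Finset.mem_filter, Finset.mem_Ico,
          forall_and, Interlaces, IsStep, hx, and_true]
      rw [tsum_eq_sum (s := Fintype.piFinset fun l => prevPositions y l (x l))
        fun ξ hξ => if_neg fun h => hξ ((hmem ξ).2 h),
        Finset.sum_congr rfl fun ξ hξ => if_pos ((hmem ξ).1 hξ), ← Fintype.card_piFinset]
      simp
    have h2 := prod_coinCount_mul_prod_card_prevPositions hx hy y'
    rw [h1, Finset.prod_mul_distrib, ← mul_assoc, ← Nat.cast_prod, ← Nat.cast_mul, mul_comm (∏ l, _),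
      h2]
    have h3 : IsStep y y' ∧ Interlaces x y' ↔ (∀ i, y' i = y i ∨ y' i = y i + 1) ∧ Interlaces x y' := by
      refine ⟨fun h => ⟨h.1.1, h.2⟩, fun h => ⟨⟨h.1, ?_⟩, h.2⟩⟩
      refine Fin.strictMono_iff_lt_succ.2 fun l => ?_
      exact (h.2 l).1.trans_lt (h.2 l).2
    by_cases h4 : (∀ i, y' i = y i ∨ y' i = y i + 1) ∧ Interlaces x y'
    · rw [if_pos h4, if_pos (h3.2 h4)]
      simp only [Finset.prod_const, Finset.card_univ, Fintype.card_fin, pow_succ]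
      push_cast
      rw [← mul_assoc, ← mul_pow, ENNReal.mul_inv_cancel two_ne_zero ENNReal.ofNat_ne_top, one_pow,
        one_mul]
    · rw [if_neg h4, if_neg (fun h => h4 (h3.1 h))]
      simp
  · rw [if_neg fun h => hx h.2.strictMono]
    simp [IsStep, hx]

open Classical in
/-- The law of the trajectory of line `j + 1` together with the trajectory of line `j` after
time `r`. The factor `2⁻¹ ^ r` reflects that, as long as line `j` is not observed, only the
interlacing of the two lines at time `r` matters. -/
theorem IsFairCoins.measure_line_and_future (hβ : IsFairCoins P β) {j : ℕ}
    (hj : ∀ (T : ℕ) (x : ℕ → Fin j → ℤ),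
      P {ω | ∀ s, s ≤ T → coinLine β j s ω = x s} = pathProb T x)
    (T : ℕ) (y : ℕ → Fin (j + 1) → ℤ) (r : ℕ) (hr : r ≤ T) (x : ℕ → Fin j → ℤ) :
    P {ω | (∀ s, r ≤ s ∧ s ≤ T → coinLine β j s ω = x s) ∧
        (∀ s, s ≤ T → coinLine β (j + 1) s ω = y s)}
      = if IsPath r y ∧ Interlaces (x r) (y r) ∧ (∀ s, r ≤ s → s < T → IsStep (x s) (x (s + 1)))
        then ENNReal.ofReal (relVandermonde (x T)) * 2⁻¹ ^ (j * T) * (2⁻¹ ^ r *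
          ∏ s ∈ Finset.Ico r T,
            ∏ i, ((coinCount (x (s + 1)) i (y s i) (y (s + 1) i) : ℝ≥0∞) * 2⁻¹))
        else 0 := by
  induction r generalizing x with
  | zero =>
    simp only [zero_le, true_and, true_imp_iff, pow_zero, one_mul]
    by_cases hy : ∀ i, y 0 i = (i : ℤ) + 1
    · rw [hβ.measure_two_lines j T x y hy, hj, pathProb, Nat.Ico_zero_eq_range]
      have h0 : IsPath 0 y := ⟨hy, fun s hs => absurd hs (Nat.not_lt_zero s)⟩
      have h1 : Interlaces (x 0) (y 0) ↔ ∀ i, x 0 i = (i : ℤ) + 1 := by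
        unfold Interlaces
        refine forall_congr' fun l => ?_
        rw [hy, hy, Fin.val_castSucc, Fin.val_succ]
        push_cast
        omega
      have h2 : (IsPath 0 y ∧ Interlaces (x 0) (y 0) ∧ ∀ s, s < T → IsStep (x s) (x (s + 1)))
          ↔ IsPath T x := by
        rw [h1]
        exact ⟨fun h => h.2, fun h => ⟨h0, h⟩⟩
      rw [if_congr h2 rfl rfl, ite_mul, zero_mul]
    · rw [if_neg fun h => hy h.1.1]
      convert measure_empty (μ := P)
      ext ω
      simp only [Set.mem_ofPred_eq, Set.mem_empty_iff_false, iff_false]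
      rintro ⟨-, h⟩
      exact hy fun i => by rw [← h 0 (Nat.zero_le T), coinLine_zero]
  | succ r ih =>
    have hA : MeasurableSet {ω | (∀ s, r + 1 ≤ s ∧ s ≤ T → coinLine β j s ω = x s) ∧
        (∀ s, s ≤ T → coinLine β (j + 1) s ω = y s)} :=
      (measurableSet_forall_le_coinLine (hβ.measurable_coinLine j) _ x).inter
        (measurableSet_forall_le_coinLine (hβ.measurable_coinLine (j + 1)) _ y)
    -- Sum over the position `ξ` of line `j` at time `r`, which is no longer observed.
    rw [measure_eq_tsum_inter_fiber hA (hβ.measurable_coinLine j r)]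
    have hset : ∀ ξ, {ω | (∀ s, r + 1 ≤ s ∧ s ≤ T → coinLine β j s ω = x s) ∧
        (∀ s, s ≤ T → coinLine β (j + 1) s ω = y s)} ∩ {ω | coinLine β j r ω = ξ}
        = {ω | (∀ s, r ≤ s ∧ s ≤ T → coinLine β j s ω = Function.update x r ξ s) ∧
        (∀ s, s ≤ T → coinLine β (j + 1) s ω = y s)} := by
      intro ξ
      ext ω
      simp only [Set.mem_inter_iff, Set.mem_ofPred_eq]
      constructor
      · rintro ⟨⟨h1, h2⟩, h3⟩
        refine ⟨fun s hs => ?_, h2⟩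
        by_cases h : s = r
        · subst h; rw [Function.update_self, h3]
        · rw [Function.update_of_ne h, h1 s ⟨by omega, hs.2⟩]
      · rintro ⟨h1, h2⟩
        refine ⟨⟨fun s hs => ?_, h2⟩, ?_⟩
        · rw [h1 s ⟨by omega, hs.2⟩, Function.update_of_ne (by omega)]
        · rw [h1 r ⟨le_rfl, by omega⟩, Function.update_self]
    have hprod : ∀ ξ, ∏ s ∈ Finset.Ico r T, ∏ i,
          ((coinCount (Function.update x r ξ (s + 1)) i (y s i) (y (s + 1) i) : ℝ≥0∞) * 2⁻¹)
        = (∏ i, ((coinCount (x (r + 1)) i (y r i) (y (r + 1) i) : ℝ≥0∞) * 2⁻¹)) *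
          ∏ s ∈ Finset.Ico (r + 1) T, ∏ i,
            ((coinCount (x (s + 1)) i (y s i) (y (s + 1) i) : ℝ≥0∞) * 2⁻¹) := by
      intro ξ
      rw [Finset.prod_eq_prod_Ico_succ_bot (by omega), Function.update_of_ne (by omega)]
      congr 1
      refine Finset.prod_congr rfl fun s hs => ?_
      rw [Finset.mem_Ico] at hs
      rw [Function.update_of_ne (by omega)]
    have hcond : ∀ ξ, (IsPath r y ∧ Interlaces (Function.update x r ξ r) (y r) ∧
        ∀ s, r ≤ s → s < T → IsStep (Function.update x r ξ s) (Function.update x r ξ (s + 1)))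
        ↔ (IsPath r y ∧ ∀ s, r + 1 ≤ s → s < T → IsStep (x s) (x (s + 1))) ∧
          Interlaces ξ (y r) ∧ IsStep ξ (x (r + 1)) := by
      intro ξ
      rw [Function.update_self]
      constructor
      · rintro ⟨h1, h2, h3⟩
        refine ⟨⟨h1, fun s hs hs' => ?_⟩, h2, ?_⟩
        · have := h3 s (by omega) hs'
          rwa [Function.update_of_ne (by omega), Function.update_of_ne (by omega)] at this
        · have := h3 r le_rfl (by omega)
          rwa [Function.update_self, Function.update_of_ne (by omega)] at this
      · rintro ⟨⟨h1, h2⟩, h3, h4⟩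
        refine ⟨h1, h3, fun s hs hs' => ?_⟩
        rw [Function.update_of_ne (by omega : s + 1 ≠ r)]
        by_cases h : s = r
        · subst h; rwa [Function.update_self]
        · rw [Function.update_of_ne h]; exact h2 s (by omega) hs'
    simp only [hset, ih (by omega), hprod, if_congr (hcond _) rfl rfl,
      Function.update_of_ne (by omega : T ≠ r)]
    by_cases hc : IsPath r y ∧ ∀ s, r + 1 ≤ s → s < T → IsStep (x s) (x (s + 1))
    · simp only [eq_true hc, true_and]
      have hstep := tsum_interlaces_isStep (y' := y (r + 1)) hc.1.strictMono (x (r + 1))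
      set D := ∏ i, ((coinCount (x (r + 1)) i (y r i) (y (r + 1) i) : ℝ≥0∞) * 2⁻¹)
      set R := ∏ s ∈ Finset.Ico (r + 1) T, ∏ i,
            ((coinCount (x (s + 1)) i (y s i) (y (s + 1) i) : ℝ≥0∞) * 2⁻¹)
      set H := ENNReal.ofReal (relVandermonde (x T)) * 2⁻¹ ^ (j * T)
      have e1 : ∀ ξ : Fin j → ℤ, (if Interlaces ξ (y r) ∧ IsStep ξ (x (r + 1))
          then H * (2⁻¹ ^ r * (D * R)) else 0)
          = (H * (2⁻¹ ^ r * (D * R))) * (if Interlaces ξ (y r) ∧ IsStep ξ (x (r + 1)) then 1 else 0) :=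
        fun ξ => by rw [mul_ite, mul_one, mul_zero]
      rw [tsum_congr e1, ENNReal.tsum_mul_left]
      have e2 : ∀ S : ℝ≥0∞, H * (2⁻¹ ^ r * (D * R)) * S = H * (2⁻¹ ^ r * ((S * D) * R)) :=
        fun S => by ring
      rw [e2, hstep, isPath_succ]
      simp only [hc.1, true_and]
      by_cases h : IsStep (y r) (y (r + 1)) ∧ Interlaces (x (r + 1)) (y (r + 1))
      · rw [if_pos h, if_pos ⟨h.1, h.2, hc.2⟩]
        ring
      · rw [if_neg h, if_neg fun h' => h ⟨h'.1, h'.2.1⟩]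
        simp
    · rw [if_neg (fun h => hc ⟨(isPath_succ.1 h.1).1, h.2.2⟩)]
      simp only [hc, false_and, if_false, tsum_zero]

/-- Each line of the particle process is, on its own, a Doob transform of independent Bernoulli
walkers killed upon collision. -/
theorem IsFairCoins.measure_path (hβ : IsFairCoins P β) (k T : ℕ) (y : ℕ → Fin k → ℤ) :
    P {ω | ∀ s, s ≤ T → coinLine β k s ω = y s} = pathProb T y := by
  classical
  induction k generalizing T with
  | zero =>
    have h1 : {ω | ∀ s, s ≤ T → coinLine β 0 s ω = y s} = Set.univ := by
      ext ω
      simp only [Set.mem_ofPred_eq, Set.mem_univ, iff_true]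
      exact fun s _ => Subsingleton.elim _ _
    have h2 : IsPath T y := ⟨fun i => i.elim0, fun s _ => ⟨fun i => i.elim0, fun a => a.elim0⟩⟩
    rw [h1, pathProb, if_pos h2]
    simp [relVandermonde, vandermondeProd]
  | succ j ih =>
    have hA : MeasurableSet {ω | ∀ s, s ≤ T → coinLine β (j + 1) s ω = y s} :=
      measurableSet_forall_le_coinLine (hβ.measurable_coinLine (j + 1)) _ y
    -- Sum over the position `ξ` of the lower line at the final time.
    rw [measure_eq_tsum_inter_fiber hA (hβ.measurable_coinLine j T)]
    have hset : ∀ ξ, {ω | ∀ s, s ≤ T → coinLine β (j + 1) s ω = y s} ∩ {ω | coinLine β j T ω = ξ}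
        = {ω | (∀ s, T ≤ s ∧ s ≤ T → coinLine β j s ω = (fun _ => ξ) s) ∧
        (∀ s, s ≤ T → coinLine β (j + 1) s ω = y s)} := by
      intro ξ
      ext ω
      simp only [Set.mem_inter_iff, Set.mem_ofPred_eq]
      refine ⟨fun h => ⟨fun s hs => ?_, h.1⟩, fun h => ⟨h.2, h.1 T ⟨le_rfl, le_rfl⟩⟩⟩
      rw [le_antisymm hs.2 hs.1]
      exact h.2
    have hcond : ∀ ξ : Fin j → ℤ, (IsPath T y ∧ Interlaces ξ (y T) ∧ ∀ s, T ≤ s → s < T → IsStep ξ ξ)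
        ↔ (IsPath T y ∧ Interlaces ξ (y T)) := fun ξ =>
      ⟨fun h => ⟨h.1, h.2.1⟩, fun h => ⟨h.1, h.2, fun s hs hs' => absurd hs (not_le.2 hs')⟩⟩
    simp only [hset, hβ.measure_line_and_future ih T y T le_rfl, if_congr (hcond _) rfl rfl,
      Finset.Ico_self, Finset.prod_empty, mul_one]
    rw [pathProb]
    by_cases hy : IsPath T y
    · simp only [hy, true_and, if_true]
      have hmem : ∀ ξ : Fin j → ℤ, ξ ∈ Fintype.piFinset (fun l : Fin j =>
          Finset.Ico (y T l.castSucc) (y T l.succ)) ↔ Interlaces ξ (y T) := by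
        intro ξ
        simp only [Fintype.mem_piFinset, Finset.mem_Ico, Interlaces]
      rw [tsum_eq_sum (s := Fintype.piFinset fun l : Fin j =>
          Finset.Ico (y T l.castSucc) (y T l.succ)) fun ξ hξ => if_neg fun h => hξ ((hmem ξ).2 h),
        Finset.sum_congr rfl fun ξ hξ => if_pos ((hmem ξ).1 hξ), ← Finset.sum_mul, ← Finset.sum_mul,
        ← ENNReal.ofReal_sum_of_nonneg fun ξ hξ => relVandermonde_nonneg ((hmem ξ).1 hξ).strictMono,
        sum_relVandermonde_interlacing _ hy.strictMono.monotone, mul_assoc, ← pow_add]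
      congr 2
      ring
    · simp only [hy, false_and, if_false, tsum_zero]

theorem IsFairCoins.ae_isStep (hβ : IsFairCoins P β) (k t : ℕ) :
    ∀ᵐ ω ∂P, IsStep (coinLine β k t ω) (coinLine β k (t + 1) ω) := by
  have h : ∀ y : Fin (t + 2) → Fin k → ℤ, ¬ IsStep (y ⟨t, by omega⟩) (y ⟨t + 1, by omega⟩) →
      P {ω | ∀ s : Fin (t + 2), coinLine β k s ω = y s} = 0 := by
    intro y hy
    have h1 := hβ.measure_path k (t + 1) fun s => if h : s < t + 2 then y ⟨s, h⟩ else 0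
    rw [pathProb, if_neg] at h1
    · rw [← h1]
      congr 1
      ext ω
      simp only [Set.mem_ofPred_eq]
      refine ⟨fun h s hs => ?_, fun h s => ?_⟩
      · rw [dif_pos (by omega)]; exact h ⟨s, by omega⟩
      · rw [h s (by omega), dif_pos s.2]
    · intro h2
      have := (isPath_succ.1 h2).2
      rw [dif_pos (by omega), dif_pos (by omega)] at this
      exact hy this
  have h2 : ∀ᵐ ω ∂P, ∀ y : Fin (t + 2) → Fin k → ℤ,
      ¬ IsStep (y ⟨t, by omega⟩) (y ⟨t + 1, by omega⟩) →
      ¬ ∀ s : Fin (t + 2), coinLine β k s ω = y s := by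
    refine ae_all_iff.2 fun y => ?_
    by_cases hy : IsStep (y ⟨t, by omega⟩) (y ⟨t + 1, by omega⟩)
    · exact ae_of_all _ fun ω h => absurd hy h
    · have := measure_eq_zero_iff_ae_notMem.1 (h y hy)
      filter_upwards [this] with ω hω _
      exact hω
  filter_upwards [h2] with ω hω
  by_contra hc
  exact hω (fun s => coinLine β k s ω) hc fun s => rfl

end PathLaw

/-! ### Sorting the coordinates of a vector -/

section Sorting

variable {k : ℕ}

/-- The vector with the same coordinates in increasing order. -/
noncomputable def sortVec (x : Fin k → ℝ) : Fin k → ℝ := x ∘ Tuple.sort x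

theorem sortVec_of_monotone_comp {x : Fin k → ℝ} {σ : Equiv.Perm (Fin k)}
    (h : Monotone (x ∘ σ)) : sortVec x = x ∘ σ :=
  (Tuple.comp_sort_eq_comp_iff_monotone.2 h).symm

theorem sortVec_of_strictMono {x : Fin k → ℝ} (h : StrictMono x) : sortVec x = x :=
  sortVec_of_monotone_comp (σ := 1) h.monotone

theorem sortVec_comp_perm (x : Fin k → ℝ) (σ : Equiv.Perm (Fin k)) :
    sortVec (x ∘ σ) = sortVec x := by
  have h : Monotone ((x ∘ σ) ∘ (Tuple.sort x).trans σ.symm) := by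
    have : (x ∘ σ) ∘ (Tuple.sort x).trans σ.symm = x ∘ Tuple.sort x := by
      funext i
      simp
    rw [this]
    exact Tuple.monotone_sort x
  rw [sortVec_of_monotone_comp h]
  funext i
  simp [sortVec]

/-- On each of the finitely many closed sets on which the order of the coordinates is prescribed,
sorting is a fixed permutation of the coordinates. -/
theorem continuous_sortVec : Continuous (sortVec (k := k)) := by
  refine LocallyFinite.continuous (f := fun σ : Equiv.Perm (Fin k) => {x : Fin k → ℝ | Monotone (x ∘ σ)})
    (locallyFinite_of_finite _) ?_ ?_ ?_
  · refine Set.eq_univ_of_forall fun x => Set.mem_iUnion.2 ⟨Tuple.sort x, Tuple.monotone_sort x⟩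
  · intro σ
    have : {x : Fin k → ℝ | Monotone (x ∘ σ)}
        = ⋂ (a : Fin k) (b : Fin k) (_ : a ≤ b), {x | x (σ a) ≤ x (σ b)} := by
      ext x
      simp [Monotone]
    rw [this]
    exact isClosed_iInter fun a => isClosed_iInter fun b => isClosed_iInter fun _ =>
      isClosed_le (continuous_apply _) (continuous_apply _)
  · intro σ
    refine ContinuousOn.congr (f := fun x => x ∘ σ) ?_ fun x hx => sortVec_of_monotone_comp hx
    exact (continuous_pi fun i => continuous_apply (σ i)).continuousOn

end Sorting

/-! ### Product measures -/

section ProductMeasures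

theorem measurable_finCons {E : Type*} [MeasurableSpace E] {n : ℕ} :
    Measurable fun p : E × (Fin n → E) => (Fin.cons p.1 p.2 : Fin (n + 1) → E) := by
  refine measurable_pi_lambda _ fun i => ?_
  induction i using Fin.cases with
  | zero => simpa using measurable_fst
  | succ i => simpa [Function.comp_def] using (measurable_pi_apply i).comp (measurable_snd (α := E) (β := Fin n → E))

theorem measurableEmbedding_finCons {E : Type*} [MeasurableSpace E] {n : ℕ} :
    MeasurableEmbedding fun p : E × (Fin n → E) => (Fin.cons p.1 p.2 : Fin (n + 1) → E) := by
  let e : E × (Fin n → E) ≃ᵐ (Fin (n + 1) → E) :=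
    { toFun := fun p => (Fin.cons p.1 p.2 : Fin (n + 1) → E)
      invFun := fun x => (x 0, Fin.tail x)
      left_inv := fun p => rfl
      right_inv := fun x => Fin.cons_self_tail x
      measurable_toFun := measurable_finCons
      measurable_invFun := (measurable_pi_apply 0).prodMk
        (measurable_pi_lambda _ fun i => measurable_pi_apply i.succ) }
  exact e.measurableEmbedding

theorem measurePreserving_finCons {E : Type*} [MeasurableSpace E] {n : ℕ}
    (μ : Fin (n + 1) → Measure E) [∀ i, SigmaFinite (μ i)] :
    MeasurePreserving (fun p : E × (Fin n → E) => (Fin.cons p.1 p.2 : Fin (n + 1) → E))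
      ((μ 0).prod (Measure.pi fun i => μ i.succ)) (Measure.pi μ) := by
  refine ⟨measurable_finCons, (Measure.pi_eq fun s hs => ?_).symm⟩
  rw [Measure.map_apply measurable_finCons (MeasurableSet.univ_pi hs)]
  have : (fun p : E × (Fin n → E) => (Fin.cons p.1 p.2 : Fin (n + 1) → E)) ⁻¹' Set.univ.pi s
      = s 0 ×ˢ Set.univ.pi fun i => s i.succ := by
    ext p
    simp [Set.mem_pi, Fin.forall_fin_succ]
  rw [this, Measure.prod_prod, Measure.pi_pi, Fin.prod_univ_succ]

theorem lintegral_pi_fin_prod {n : ℕ} {E : Type*} [MeasurableSpace E]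
    (μ : Fin n → Measure E) [∀ i, SigmaFinite (μ i)] {f : Fin n → E → ℝ≥0∞}
    (hf : ∀ i, Measurable (f i)) :
    ∫⁻ x, ∏ i, f i (x i) ∂Measure.pi μ = ∏ i, ∫⁻ x, f i x ∂μ i := by
  induction n with
  | zero => simp
  | succ n ih =>
    rw [← (measurePreserving_finCons μ).lintegral_comp_emb measurableEmbedding_finCons]
    simp only [Fin.prod_univ_succ, Fin.cons_zero, Fin.cons_succ]
    rw [lintegral_prod_mul (f := f 0) (g := fun x : Fin n → E => ∏ i : Fin n, f i.succ (x i)) (hf 0).aemeasurable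
      (Finset.measurable_prod _ fun i _ => (hf i.succ).comp (measurable_pi_apply i)).aemeasurable,
      ih (fun i => μ i.succ) fun i => hf i.succ]

theorem pi_withDensity {n : ℕ} {E : Type*} [MeasurableSpace E]
    (μ : Fin n → Measure E) [∀ i, SigmaFinite (μ i)] {f : Fin n → E → ℝ≥0∞}
    (hf : ∀ i, Measurable (f i)) [∀ i, SigmaFinite ((μ i).withDensity (f i))] :
    Measure.pi (fun i => (μ i).withDensity (f i))
      = (Measure.pi μ).withDensity fun x => ∏ i, f i (x i) := by
  refine Measure.pi_eq fun s hs => ?_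
  rw [withDensity_apply _ (MeasurableSet.univ_pi hs), ← lintegral_indicator (MeasurableSet.univ_pi hs)]
  have : ((Set.univ.pi s).indicator fun x => ∏ i, f i (x i))
      = fun x => ∏ i, (s i).indicator (f i) (x i) := by
    classical
    ext x
    by_cases hx : x ∈ Set.univ.pi s
    · rw [Set.indicator_of_mem hx]
      exact Finset.prod_congr rfl fun i _ => (Set.indicator_of_mem (hx i trivial) _).symm
    · rw [Set.indicator_of_notMem hx]
      have : ∃ i, x i ∉ s i := by simpa [Set.mem_pi] using hx
      obtain ⟨i, hi⟩ := this
      exact (Finset.prod_eq_zero (Finset.mem_univ i) (Set.indicator_of_notMem hi _)).symm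
  rw [this, lintegral_pi_fin_prod μ fun i => (hf i).indicator (hs i)]
  exact Finset.prod_congr rfl fun i _ => by
    rw [lintegral_indicator (hs i), withDensity_apply _ (hs i)]

theorem measurePreserving_comp_perm {k : ℕ} {E : Type*} [MeasurableSpace E] (ν : Measure E)
    [SigmaFinite ν] (σ : Equiv.Perm (Fin k)) :
    MeasurePreserving (fun x : Fin k → E => x ∘ σ) (Measure.pi fun _ => ν)
      (Measure.pi fun _ => ν) := by
  have hm : Measurable fun x : Fin k → E => x ∘ σ :=
    measurable_pi_lambda _ fun i => measurable_pi_apply (σ i)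
  refine ⟨hm, (Measure.pi_eq fun s hs => ?_).symm⟩
  rw [Measure.map_apply hm (MeasurableSet.univ_pi hs)]
  have : (fun x : Fin k → E => x ∘ σ) ⁻¹' Set.univ.pi s = Set.univ.pi fun i => s (σ.symm i) := by
    ext x
    simp only [Set.mem_preimage, Set.mem_pi, Set.mem_univ, true_imp_iff, Function.comp_apply]
    exact ⟨fun h i => by simpa using h (σ.symm i), fun h i => by simpa using h (σ i)⟩
  rw [this, Measure.pi_pi, σ.symm.prod_comp (fun i => ν (s i))]

theorem measurableEmbedding_comp_perm {k : ℕ} {E : Type*} [MeasurableSpace E]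
    (σ : Equiv.Perm (Fin k)) : MeasurableEmbedding (fun x : Fin k → E => x ∘ σ) := by
  have h : ∀ τ : Equiv.Perm (Fin k), Measurable (fun x : Fin k → E => x ∘ τ) := fun τ =>
    measurable_pi_lambda _ fun i => measurable_pi_apply (τ i)
  exact MeasurableEquiv.measurableEmbedding
    { toFun := fun x => x ∘ σ
      invFun := fun x => x ∘ σ.symm
      left_inv := fun x => by funext i; simp
      right_inv := fun x => by funext i; simp
      measurable_toFun := h σ
      measurable_invFun := h σ.symm }

end ProductMeasures

/-! ### Averages of functions of exponential growth -/

section Averages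

variable {k : ℕ}

/-- The `ℓ¹` norm. -/
def l1Norm (x : Fin k → ℝ) : ℝ := ∑ i, |x i|

/-- Measurable functions bounded by `C exp(a ∑ |x_i|)`. -/
structure ExpGrowth (u : (Fin k → ℝ) → ℂ) : Prop where
  measurable : Measurable u
  bound : ∃ C a : ℝ, 0 ≤ C ∧ 0 ≤ a ∧ ∀ x, ‖u x‖ ≤ C * Real.exp (a * l1Norm x)

/-- The measure has all exponential moments. -/
def ExpMoments (ν : Measure ℝ) : Prop :=
  ∀ a : ℝ, Integrable (fun x => Real.exp (a * |x|)) ν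

/-- Functions that change sign under transpositions of the coordinates. -/
def Antisymmetric (u : (Fin k → ℝ) → ℂ) : Prop :=
  ∀ (x : Fin k → ℝ) (σ : Equiv.Perm (Fin k)), u (x ∘ σ) = ((Equiv.Perm.sign σ : ℤ) : ℂ) * u x

/-- Average of `u` over a step of `k` independent walkers with step distribution `ν`. -/
noncomputable def stepAvg (ν : Measure ℝ) (u : (Fin k → ℝ) → ℂ) (x : Fin k → ℝ) : ℂ :=
  ∫ z, u (x + z) ∂Measure.pi fun _ : Fin k => ν

theorem l1Norm_nonneg (x : Fin k → ℝ) : 0 ≤ l1Norm x :=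
  Finset.sum_nonneg fun _ _ => abs_nonneg _

theorem l1Norm_add_le (x y : Fin k → ℝ) : l1Norm (x + y) ≤ l1Norm x + l1Norm y := by
  unfold l1Norm
  rw [← Finset.sum_add_distrib]
  exact Finset.sum_le_sum fun i _ => abs_add_le _ _

theorem abs_le_l1Norm (x : Fin k → ℝ) (i : Fin k) : |x i| ≤ l1Norm x :=
  Finset.single_le_sum (f := fun i => |x i|) (fun _ _ => abs_nonneg _) (Finset.mem_univ i)

theorem exp_mul_l1Norm (a : ℝ) (x : Fin k → ℝ) :
    Real.exp (a * l1Norm x) = ∏ i, Real.exp (a * |x i|) := by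
  rw [l1Norm, Finset.mul_sum, Real.exp_sum]

theorem ExpMoments.integrable_exp_l1Norm {ν : Measure ℝ} [SigmaFinite ν] (hν : ExpMoments ν)
    (a : ℝ) : Integrable (fun z : Fin k → ℝ => Real.exp (a * l1Norm z))
      (Measure.pi fun _ => ν) := by
  simp_rw [exp_mul_l1Norm]
  exact Integrable.fintype_prod (f := fun _ x => Real.exp (a * |x|)) fun _ => hν a

theorem ExpGrowth.mul {u v : (Fin k → ℝ) → ℂ} (hu : ExpGrowth u) (hv : ExpGrowth v) :
    ExpGrowth fun x => u x * v x := by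
  obtain ⟨C, a, hC, ha, h⟩ := hu.bound
  obtain ⟨D, b, hD, hb, h'⟩ := hv.bound
  refine ⟨hu.measurable.mul hv.measurable, C * D, a + b, by positivity, by positivity, fun x => ?_⟩
  rw [norm_mul, add_mul, Real.exp_add]
  calc ‖u x‖ * ‖v x‖ ≤ (C * Real.exp (a * l1Norm x)) * (D * Real.exp (b * l1Norm x)) :=
        mul_le_mul (h x) (h' x) (norm_nonneg _) (by positivity)
    _ = _ := by ring

theorem expGrowth_of_norm_le_one {f : (Fin k → ℝ) → ℂ} (hf : Measurable f) (h : ∀ x, ‖f x‖ ≤ 1) :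
    ExpGrowth f :=
  ⟨hf, 1, 0, zero_le_one, le_rfl, fun x => by simpa using h x⟩

theorem abs_vandermondeProd_le (x : Fin k → ℝ) :
    |vandermondeProd x| ≤ Real.exp ((∑ i : Fin k, (Finset.Ioi i).card : ℕ) * (2 * l1Norm x)) := by
  unfold vandermondeProd
  have h : ∀ i j : Fin k, |x j - x i| ≤ Real.exp (2 * l1Norm x) := by
    intro i j
    calc |x j - x i| ≤ |x j| + |x i| := abs_sub _ _
      _ ≤ 2 * l1Norm x := by linarith [abs_le_l1Norm x i, abs_le_l1Norm x j]
      _ ≤ 2 * l1Norm x + 1 := by linarith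
      _ ≤ _ := Real.add_one_le_exp _
  rw [Finset.abs_prod, Real.exp_nat_mul, ← Finset.prod_pow_eq_pow_sum]
  refine Finset.prod_le_prod (fun _ _ => abs_nonneg _) fun i _ => ?_
  rw [Finset.abs_prod, ← Finset.prod_const]
  exact Finset.prod_le_prod (fun _ _ => abs_nonneg _) fun j _ => h i j

theorem expGrowth_vandermondeProd :
    ExpGrowth fun x : Fin k → ℝ => (vandermondeProd x : ℂ) := by
  refine ⟨Complex.measurable_ofReal.comp measurable_vandermondeProd, 1,
    (∑ i : Fin k, (Finset.Ioi i).card : ℕ) * 2, zero_le_one, by positivity, fun x => ?_⟩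
  rw [Complex.norm_real, Real.norm_eq_abs, one_mul, mul_assoc]
  exact abs_vandermondeProd_le x

theorem antisymmetric_vandermondeProd :
    Antisymmetric fun x : Fin k → ℝ => (vandermondeProd x : ℂ) := fun x σ => by
  simp only [vandermondeProd_comp_perm]
  push_cast
  rfl

theorem Antisymmetric.eq_zero {u : (Fin k → ℝ) → ℂ} (hu : Antisymmetric u) {x : Fin k → ℝ}
    {i j : Fin k} (hij : i ≠ j) (h : x i = x j) : u x = 0 := by
  have h1 := hu x (Equiv.swap i j)
  have h2 : x ∘ Equiv.swap i j = x := by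
    funext l
    simp only [Function.comp_apply, Equiv.swap_apply_def]
    split_ifs with ha hb
    · rw [ha, h]
    · rw [hb, h]
    · rfl
  rw [h2, Equiv.Perm.sign_swap hij] at h1
  push_cast at h1
  linear_combination h1 / 2

theorem Antisymmetric.mul_symm {u f : (Fin k → ℝ) → ℂ} (hu : Antisymmetric u)
    (hf : ∀ (x : Fin k → ℝ) (σ : Equiv.Perm (Fin k)), f (x ∘ σ) = f x) :
    Antisymmetric fun x => f x * u x := fun x σ => by
  simp only [hf, hu x σ]
  ring

/-- In the integral of an antisymmetric function against a determinant, all terms of the Leibniz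
expansion contribute equally. -/
theorem integral_det_mul_antisymmetric (ν : Measure ℝ) [SigmaFinite ν] (g : Fin k → ℝ → ℝ)
    {u : (Fin k → ℝ) → ℂ} (hu : Antisymmetric u)
    (hi : Integrable (fun z => ((∏ i, g i (z i) : ℝ) : ℂ) * u z) (Measure.pi fun _ => ν)) :
    ∫ z, (((Matrix.of fun i j => g j (z i)).det : ℝ) : ℂ) * u z ∂Measure.pi (fun _ => ν)
      = k.factorial * ∫ z, ((∏ i, g i (z i) : ℝ) : ℂ) * u z ∂Measure.pi fun _ => ν := by
  have hσ : ∀ σ : Equiv.Perm (Fin k),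
      Integrable (fun z => (((Equiv.Perm.sign σ : ℤ) * ∏ i, g i (z (σ i)) : ℝ) : ℂ) * u z)
        (Measure.pi fun _ : Fin k => ν) ∧
      ∫ z, (((Equiv.Perm.sign σ : ℤ) * ∏ i, g i (z (σ i)) : ℝ) : ℂ) * u z
          ∂Measure.pi (fun _ : Fin k => ν)
        = ∫ z, ((∏ i, g i (z i) : ℝ) : ℂ) * u z ∂Measure.pi fun _ => ν := by
    intro σ
    have hmp := measurePreserving_comp_perm ν σ
    have e : (fun z => (((Equiv.Perm.sign σ : ℤ) * ∏ i, g i (z (σ i)) : ℝ) : ℂ) * u z)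
        = (fun z => ((∏ i, g i (z i) : ℝ) : ℂ) * u z) ∘ fun z : Fin k → ℝ => z ∘ σ := by
      funext z
      simp only [Function.comp_apply]
      rw [hu z σ]
      push_cast
      ring
    rw [e]
    exact ⟨(hmp.integrable_comp_emb (measurableEmbedding_comp_perm σ)).2 hi,
      hmp.integral_comp (measurableEmbedding_comp_perm σ)
        (fun z => ((∏ i, g i (z i) : ℝ) : ℂ) * u z)⟩
  have h1 : ∑ σ : Equiv.Perm (Fin k), ∫ z, ((∏ i, g i (z i) : ℝ) : ℂ) * u z ∂Measure.pi (fun _ => ν)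
      = k.factorial * ∫ z, ((∏ i, g i (z i) : ℝ) : ℂ) * u z ∂Measure.pi fun _ => ν := by
    simp [Finset.card_univ, Fintype.card_perm]
  rw [← h1, ← Finset.sum_congr rfl fun σ _ => (hσ σ).2, ← integral_finsetSum _ fun σ _ => (hσ σ).1]
  refine integral_congr_ae (ae_of_all _ fun z => ?_)
  simp only
  rw [← Finset.sum_mul, ← Complex.ofReal_sum, Matrix.det_apply']
  rfl

section

variable {ν : Measure ℝ} [IsProbabilityMeasure ν] (hν : ExpMoments ν) {u : (Fin k → ℝ) → ℂ}
include hν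

theorem ExpGrowth.integrable_add (hu : ExpGrowth u) (x : Fin k → ℝ) :
    Integrable (fun z => u (x + z)) (Measure.pi fun _ : Fin k => ν) := by
  obtain ⟨C, a, hC, ha, h⟩ := hu.bound
  refine Integrable.mono' ((hν.integrable_exp_l1Norm a).const_mul (C * Real.exp (a * l1Norm x)))
    (hu.measurable.comp (measurable_const_add x)).aestronglyMeasurable (ae_of_all _ fun z => ?_)
  rw [mul_assoc, ← Real.exp_add, ← mul_add]
  refine (h (x + z)).trans ?_
  gcongr
  exact l1Norm_add_le x z

theorem ExpGrowth.stepAvg (hu : ExpGrowth u) : ExpGrowth (stepAvg ν u) := by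
  obtain ⟨C, a, hC, ha, h⟩ := hu.bound
  refine ⟨?_, C * ∫ z : Fin k → ℝ, Real.exp (a * l1Norm z) ∂Measure.pi fun _ => ν, a,
    mul_nonneg hC (integral_nonneg fun _ => (Real.exp_pos _).le), ha, fun x => ?_⟩
  · have : StronglyMeasurable (Function.uncurry fun x z : Fin k → ℝ => u (x + z)) :=
      (hu.measurable.comp measurable_add).stronglyMeasurable
    exact (this.integral_prod_right (ν := Measure.pi fun _ : Fin k => ν)).measurable
  · calc ‖_root_.stepAvg ν u x‖ ≤ ∫ z : Fin k → ℝ, C * Real.exp (a * l1Norm x) * Real.exp (a * l1Norm z)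
          ∂Measure.pi fun _ => ν := by
          refine norm_integral_le_of_norm_le ((hν.integrable_exp_l1Norm a).const_mul _)
            (ae_of_all _ fun z => ?_)
          rw [mul_assoc, ← Real.exp_add, ← mul_add]
          refine (h (x + z)).trans ?_
          gcongr
          exact l1Norm_add_le x z
      _ = _ := by rw [integral_const_mul]; ring

omit hν in
theorem Antisymmetric.stepAvg (hu : Antisymmetric u) : Antisymmetric (stepAvg ν u) := by
  intro x σ
  unfold _root_.stepAvg
  rw [← (measurePreserving_comp_perm ν σ).integral_comp (measurableEmbedding_comp_perm σ),
    ← integral_const_mul]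
  exact integral_congr_ae (ae_of_all _ fun z => hu (x + z) σ)

theorem stepAvg_conv {μ : Measure ℝ} [IsProbabilityMeasure μ] (hμ : ExpMoments μ)
    (hu : ExpGrowth u) (x : Fin k → ℝ) :
    stepAvg (μ ∗ ν) u x = stepAvg μ (stepAvg ν u) x := by
  have h1 : (Measure.pi fun _ : Fin k => μ ∗ ν)
      = ((Measure.pi fun _ : Fin k => μ).prod (Measure.pi fun _ : Fin k => ν)).map
        fun p => p.1 + p.2 := by
    have h2 : (Measure.pi fun _ : Fin k => μ ∗ ν)
        = (Measure.pi fun _ : Fin k => μ.prod ν).map fun x i => (x i).1 + (x i).2 := by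
      rw [Measure.pi_map_pi (X := fun _ => ℝ × ℝ) (Y := fun _ => ℝ) (f := fun _ p => p.1 + p.2)
        fun _ => measurable_add.aemeasurable]
      rfl
    rw [h2, ← (measurePreserving_arrowProdEquivProdArrow ℝ ℝ (Fin k) (fun _ => μ) (fun _ => ν)).map_eq,
      Measure.map_map measurable_add (MeasurableEquiv.measurable _)]
    rfl
  have hx : Measurable fun z => u (x + z) := hu.measurable.comp (measurable_const_add x)
  unfold stepAvg
  rw [h1, integral_map measurable_add.aemeasurable hx.aestronglyMeasurable, integral_prod]
  · simp_rw [add_assoc]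
  · obtain ⟨C, a, hC, ha, h⟩ := hu.bound
    refine Integrable.mono' (((hμ.integrable_exp_l1Norm a).mul_prod
      (hν.integrable_exp_l1Norm a)).const_mul (C * Real.exp (a * l1Norm x)))
      (hx.comp measurable_add).aestronglyMeasurable (ae_of_all _ fun z => ?_)
    rw [← Real.exp_add, mul_assoc, ← Real.exp_add, ← mul_add, ← mul_add]
    refine (h (x + (z.1 + z.2))).trans ?_
    gcongr
    exact (l1Norm_add_le _ _).trans (by gcongr; exact l1Norm_add_le _ _)

end

/-- `E[f_1(x + S_1) ⋯ f_n(x + S_n) h(x + S_n)]` for a walk `S` of `k` independent particles, whose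
increments have the distributions `ν_1, …, ν_n`. -/
noncomputable def walkFun : (n : ℕ) → (Fin n → Measure ℝ) → (Fin n → (Fin k → ℝ) → ℂ) →
    (Fin k → ℝ) → ℂ
  | 0, _, _ => fun x => (vandermondeProd x : ℂ)
  | n + 1, ν, f => stepAvg (ν 0) fun x => f 0 x * walkFun n (Fin.tail ν) (Fin.tail f) x

theorem expGrowth_walkFun {n : ℕ} {ν : Fin n → Measure ℝ} [∀ l, IsProbabilityMeasure (ν l)]
    (hν : ∀ l, ExpMoments (ν l)) {f : Fin n → (Fin k → ℝ) → ℂ} (hf : ∀ l, ExpGrowth (f l)) :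
    ExpGrowth (walkFun n ν f) := by
  induction n with
  | zero => exact expGrowth_vandermondeProd
  | succ n ih =>
    have : ∀ l, IsProbabilityMeasure (Fin.tail ν l) := fun l => inferInstanceAs (IsProbabilityMeasure (ν l.succ))
    exact ((hf 0).mul (ih (fun l => hν l.succ) fun l => hf l.succ)).stepAvg (hν 0)

theorem antisymmetric_walkFun {n : ℕ} {ν : Fin n → Measure ℝ} [∀ l, IsProbabilityMeasure (ν l)]
    {f : Fin n → (Fin k → ℝ) → ℂ}
    (hf : ∀ l (x : Fin k → ℝ) (σ : Equiv.Perm (Fin k)), f l (x ∘ σ) = f l x) :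
    Antisymmetric (walkFun n ν f) := by
  induction n with
  | zero => exact antisymmetric_vandermondeProd
  | succ n ih =>
    have : ∀ l, IsProbabilityMeasure (Fin.tail ν l) := fun l => inferInstanceAs (IsProbabilityMeasure (ν l.succ))
    exact ((ih fun l => hf l.succ).mul_symm (hf 0)).stepAvg

end Averages

/-! ### The simple random walk -/

section SimpleWalk

/-- The law of `±s` with equal probabilities. -/
noncomputable def signStep (s : ℝ) : Measure ℝ :=
  (2⁻¹ : ℝ≥0∞) • Measure.dirac (-s) + (2⁻¹ : ℝ≥0∞) • Measure.dirac s

/-- The law at time `d` of the simple random walk with steps `±s` started at `0`. -/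
noncomputable def simpleWalk (s : ℝ) : ℕ → Measure ℝ
  | 0 => Measure.dirac 0
  | d + 1 => signStep s ∗ simpleWalk s d

instance (s : ℝ) : IsProbabilityMeasure (signStep s) :=
  ⟨by simp [signStep, ENNReal.inv_two_add_inv_two]⟩

instance (s : ℝ) (d : ℕ) : IsProbabilityMeasure (simpleWalk s d) := by
  induction d with
  | zero => exact inferInstanceAs (IsProbabilityMeasure (Measure.dirac 0))
  | succ d ih => exact inferInstanceAs (IsProbabilityMeasure (signStep s ∗ simpleWalk s d))

theorem simpleWalk_succ (s : ℝ) (d : ℕ) :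
    simpleWalk s (d + 1) = (2⁻¹ : ℝ≥0∞) • (simpleWalk s d).map (fun x => x - s)
      + (2⁻¹ : ℝ≥0∞) • (simpleWalk s d).map (fun x => x + s) := by
  have h1 : (fun x : ℝ => x - s) = fun x => -s + x := by funext x; ring
  have h2 : (fun x : ℝ => x + s) = fun x => s + x := by funext x; ring
  rw [simpleWalk, signStep, Measure.add_conv, Measure.conv_smul_left, Measure.conv_smul_left,
    Measure.dirac_conv, Measure.dirac_conv, h1, h2]

theorem integrable_simpleWalk (s : ℝ) (d : ℕ) {g : ℝ → ℝ} (hg : Measurable g) :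
    Integrable g (simpleWalk s d) := by
  induction d generalizing g with
  | zero => exact integrable_dirac (by simp)
  | succ d ih =>
    rw [simpleWalk_succ]
    refine Integrable.add_measure (Integrable.smul_measure ?_ (by simp))
      (Integrable.smul_measure ?_ (by simp))
    · exact (integrable_map_measure hg.aestronglyMeasurable (by fun_prop)).2
        (ih (hg.comp (by fun_prop)))
    · exact (integrable_map_measure hg.aestronglyMeasurable (by fun_prop)).2
        (ih (hg.comp (by fun_prop)))

theorem integral_simpleWalk_succ (s : ℝ) (d : ℕ) {g : ℝ → ℝ} (hg : Measurable g) :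
    ∫ x, g x ∂simpleWalk s (d + 1)
      = (∫ x, g (x - s) ∂simpleWalk s d + ∫ x, g (x + s) ∂simpleWalk s d) / 2 := by
  have h1 : Integrable g ((simpleWalk s d).map fun x => x - s) :=
    (integrable_map_measure hg.aestronglyMeasurable (by fun_prop)).2
      (integrable_simpleWalk s d (hg.comp (by fun_prop)))
  have h2 : Integrable g ((simpleWalk s d).map fun x => x + s) :=
    (integrable_map_measure hg.aestronglyMeasurable (by fun_prop)).2
      (integrable_simpleWalk s d (hg.comp (by fun_prop)))
  rw [simpleWalk_succ, integral_add_measure (h1.smul_measure (by simp)) (h2.smul_measure (by simp)),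
    integral_smul_measure, integral_smul_measure, integral_map (by fun_prop) hg.aestronglyMeasurable,
    integral_map (by fun_prop) hg.aestronglyMeasurable]
  simp
  ring

theorem integral_exp_simpleWalk (s a : ℝ) (d : ℕ) :
    ∫ x, Real.exp (a * x) ∂simpleWalk s d = Real.cosh (a * s) ^ d := by
  induction d with
  | zero => simp [simpleWalk]
  | succ d ih =>
    rw [integral_simpleWalk_succ s d (by fun_prop)]
    simp_rw [mul_sub, mul_add, Real.exp_sub, Real.exp_add]
    rw [integral_div, integral_mul_const, ih, Real.cosh_eq, pow_succ, Real.exp_neg]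
    ring

theorem expMoments_simpleWalk (s : ℝ) (d : ℕ) : ExpMoments (simpleWalk s d) :=
  fun a => integrable_simpleWalk s d (by fun_prop)

theorem expMoments_signStep (s : ℝ) : ExpMoments (signStep s) := fun a =>
  Integrable.add_measure ((integrable_dirac (by simp)).smul_measure (by simp))
    ((integrable_dirac (by simp)).smul_measure (by simp))

theorem ae_abs_le_simpleWalk {s : ℝ} (hs : 0 ≤ s) (d : ℕ) :
    ∀ᵐ x ∂simpleWalk s d, |x| ≤ s * d := by
  induction d with
  | zero => simp [simpleWalk, ae_dirac_eq]
  | succ d ih =>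
    have hm : MeasurableSet {x : ℝ | |x| ≤ s * ((d + 1 : ℕ) : ℝ)} :=
      measurableSet_le (by fun_prop) (by fun_prop)
    rw [simpleWalk_succ]
    refine ae_add_measure_iff.2 ⟨Measure.ae_smul_measure ?_ _, Measure.ae_smul_measure ?_ _⟩
    · refine (ae_map_iff (by fun_prop) hm).2 ?_
      filter_upwards [ih] with x hx
      push_cast
      rw [abs_le] at hx ⊢
      constructor <;> linarith
    · refine (ae_map_iff (by fun_prop) hm).2 ?_
      filter_upwards [ih] with x hx
      push_cast
      rw [abs_le] at hx ⊢
      constructor <;> linarith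

/-- By exchangeability of the increments, the endpoint is `d` times the last step on average. -/
theorem integral_mul_simpleWalk_succ (s : ℝ) (d : ℕ) {g : ℝ → ℝ} (hg : Measurable g) :
    ∫ x, g x * x ∂simpleWalk s (d + 1)
      = s * (d + 1) / 2 * (∫ x, g (x + s) ∂simpleWalk s d - ∫ x, g (x - s) ∂simpleWalk s d) := by
  induction d generalizing g with
  | zero =>
    rw [integral_simpleWalk_succ s 0 (g := fun x => g x * x) (by fun_prop)]
    simp [simpleWalk]
    ring
  | succ d ih =>
    have hm : Measurable fun x => g (x - s) := hg.comp (by fun_prop)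
    have hp : Measurable fun x => g (x + s) := hg.comp (by fun_prop)
    rw [integral_simpleWalk_succ s (d + 1) (g := fun x => g x * x) (by fun_prop)]
    have e1 : ∫ x, g (x - s) * (x - s) ∂simpleWalk s (d + 1)
        = ∫ x, g (x - s) * x ∂simpleWalk s (d + 1) - (∫ x, g (x - s) ∂simpleWalk s (d + 1)) * s := by
      rw [← integral_mul_const, ← integral_sub (integrable_simpleWalk _ _
          (g := fun x => g (x - s) * x) (by fun_prop)) (integrable_simpleWalk _ _ (hm.mul_const s))]
      exact integral_congr_ae (ae_of_all _ fun x => by ring)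
    have e2 : ∫ x, g (x + s) * (x + s) ∂simpleWalk s (d + 1)
        = ∫ x, g (x + s) * x ∂simpleWalk s (d + 1) + (∫ x, g (x + s) ∂simpleWalk s (d + 1)) * s := by
      rw [← integral_mul_const, ← integral_add (integrable_simpleWalk _ _
          (g := fun x => g (x + s) * x) (by fun_prop)) (integrable_simpleWalk _ _ (hp.mul_const s))]
      exact integral_congr_ae (ae_of_all _ fun x => by ring)
    rw [e1, e2, ih hm, ih hp, integral_simpleWalk_succ s d hm, integral_simpleWalk_succ s d hp]
    simp only [add_sub_cancel_right, sub_add_cancel]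
    push_cast
    ring

/-- Prescribing the last of `d + 1` steps changes the law of the walk by a density that is affine
in the end point. -/
theorem map_simpleWalk_add {s : ℝ} (hs : 0 < s) (d : ℕ) {e : ℝ} (he : e = 1 ∨ e = -1) :
    (simpleWalk s d).map (fun x => x + e * s)
      = (simpleWalk s (d + 1)).withDensity fun x => ENNReal.ofReal (1 + e * x / (s * (d + 1))) := by
  ext A hA
  have hmg : Measurable (A.indicator (1 : ℝ → ℝ)) := measurable_one.indicator hA
  have key : ∫ x, A.indicator (1 : ℝ → ℝ) (x + e * s) ∂simpleWalk s d
      = ∫ x, A.indicator (1 : ℝ → ℝ) x * (1 + e * x / (s * (d + 1))) ∂simpleWalk s (d + 1) := by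
    have h1 : ∫ x, A.indicator (1 : ℝ → ℝ) x * (1 + e * x / (s * (d + 1))) ∂simpleWalk s (d + 1)
        = ∫ x, A.indicator (1 : ℝ → ℝ) x ∂simpleWalk s (d + 1)
          + e / (s * (d + 1)) * ∫ x, A.indicator (1 : ℝ → ℝ) x * x ∂simpleWalk s (d + 1) := by
      rw [← integral_const_mul, ← integral_add (integrable_simpleWalk _ _ hmg)
        (integrable_simpleWalk _ _
          (g := fun x => e / (s * (d + 1)) * (A.indicator (1 : ℝ → ℝ) x * x)) (by fun_prop))]
      exact integral_congr_ae (ae_of_all _ fun x => by ring)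
    rw [h1, integral_simpleWalk_succ s d hmg, integral_mul_simpleWalk_succ s d hmg]
    have : (d : ℝ) + 1 ≠ 0 := by positivity
    rcases he with rfl | rfl
    · simp only [one_mul]
      field_simp
      ring
    · simp only [neg_mul, one_mul, ← sub_eq_add_neg]
      field_simp
      ring
  have hae := ae_abs_le_simpleWalk hs.le (d + 1)
  have hm : Measurable fun x : ℝ => 1 + e * x / (s * (d + 1)) := by fun_prop
  rw [withDensity_apply _ hA, ← lintegral_indicator hA, Measure.map_apply (by fun_prop) hA]
  have h2 : ∫⁻ x, A.indicator (fun x => ENNReal.ofReal (1 + e * x / (s * (d + 1)))) x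
        ∂simpleWalk s (d + 1)
      = ENNReal.ofReal (∫ x, A.indicator (1 : ℝ → ℝ) x * (1 + e * x / (s * (d + 1)))
        ∂simpleWalk s (d + 1)) := by
    rw [ofReal_integral_eq_lintegral_ofReal (integrable_simpleWalk _ _
      (g := fun x => A.indicator (1 : ℝ → ℝ) x * (1 + e * x / (s * (d + 1)))) (by fun_prop))]
    · refine lintegral_congr fun x => ?_
      by_cases hx : x ∈ A <;> simp [hx]
    · filter_upwards [hae] with x hx
      refine mul_nonneg (Set.indicator_nonneg (fun _ _ => zero_le_one) _) ?_
      have hpos : 0 < s * ((d : ℝ) + 1) := by positivity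
      push_cast at hx
      have : |e * x / (s * (d + 1))| ≤ 1 := by
        rw [abs_div, abs_of_pos hpos, div_le_one hpos, abs_mul]
        rcases he with rfl | rfl <;> simpa using hx
      linarith [neg_le_of_abs_le this]
  rw [h2, ← key]
  have h3 : ∫ x, A.indicator (1 : ℝ → ℝ) (x + e * s) ∂simpleWalk s d
      = (simpleWalk s d).real ((fun x => x + e * s) ⁻¹' A) := by
    rw [← integral_indicator_one (hA.preimage (by fun_prop))]
    rfl
  rw [h3, ofReal_measureReal]

theorem map_withDensity_comp {α γ : Type*} [MeasurableSpace α] [MeasurableSpace γ] {μ : Measure α}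
    {φ : α → γ} (hφ : Measurable φ) {g : γ → ℝ≥0∞} (hg : Measurable g) :
    (μ.withDensity fun x => g (φ x)).map φ = (μ.map φ).withDensity g := by
  ext A hA
  rw [Measure.map_apply hφ hA, withDensity_apply _ (hφ hA), withDensity_apply _ hA,
    setLIntegral_map hA hg hφ]

open Polynomial in
/-- The law of a walk of `n` steps, shifted by the effect of `j` steps up and `d - j` steps down,
has a polynomial density of degree `d` with respect to the law of a walk of `n + d` steps. -/
theorem exists_polynomial_map_simpleWalk {s : ℝ} (hs : 0 < s) (n d j : ℕ) (hj : j ≤ d) :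
    ∃ p : ℝ[X], p.natDegree ≤ d ∧ (∀ᵐ x ∂simpleWalk s (n + d), 0 ≤ p.eval x) ∧
      (simpleWalk s n).map (fun x => x + (2 * j - d) * s)
        = (simpleWalk s (n + d)).withDensity fun x => ENNReal.ofReal (p.eval x) := by
  induction d generalizing j with
  | zero =>
    obtain rfl : j = 0 := by omega
    refine ⟨1, by simp, by simp, ?_⟩
    simp
  | succ d ih =>
    have key : ∀ (j' : ℕ) (e : ℝ), j' ≤ d → (e = 1 ∨ e = -1) → (2 * (j' : ℝ) - d) + e = 2 * j - (d + 1) →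
        ∃ p : ℝ[X], p.natDegree ≤ d + 1 ∧ (∀ᵐ x ∂simpleWalk s (n + (d + 1)), 0 ≤ p.eval x) ∧
        (simpleWalk s n).map (fun x => x + (2 * j - (d + 1)) * s)
          = (simpleWalk s (n + (d + 1))).withDensity fun x => ENNReal.ofReal (p.eval x) := by
      intro j' e hj' he hje
      obtain ⟨p, hp1, hp2, hp3⟩ := ih j' hj'
      set q : ℝ[X] := 1 + C (e / (s * ((n + d : ℕ) + 1))) * X with hq
      set p' : ℝ[X] := p.comp (X - C (e * s)) with hp'
      have hstep := map_simpleWalk_add hs (n + d) he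
      have hqe : ∀ x : ℝ, 1 + e * x / (s * ((n + d : ℕ) + 1)) = q.eval x := by
        intro x
        simp [hq]
        ring
      have hpe : ∀ x : ℝ, p'.eval (x + e * s) = p.eval x := by
        intro x
        simp [hp']
      have hqm : Measurable fun x : ℝ => ENNReal.ofReal (q.eval x) :=
        q.continuous.measurable.ennreal_ofReal
      have hpm : Measurable fun x : ℝ => ENNReal.ofReal (p'.eval x) :=
        p'.continuous.measurable.ennreal_ofReal
      simp_rw [hqe] at hstep
      have hq0 : ∀ᵐ x ∂simpleWalk s (n + d + 1), 0 ≤ q.eval x := by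
        filter_upwards [ae_abs_le_simpleWalk hs.le (n + d + 1)] with x hx
        rw [← hqe]
        have hpos : 0 < s * (((n + d : ℕ) : ℝ) + 1) := by positivity
        rw [Nat.cast_succ] at hx
        have : |e * x / (s * (((n + d : ℕ) : ℝ) + 1))| ≤ 1 := by
          rw [abs_div, abs_of_pos hpos, div_le_one hpos, abs_mul]
          rcases he with rfl | rfl <;> simpa using hx
        linarith [neg_le_of_abs_le this]
      have hp0 : ∀ᵐ x ∂simpleWalk s (n + d + 1), q.eval x ≠ 0 → 0 ≤ q.eval x → 0 ≤ p'.eval x := by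
        have h1 : ∀ᵐ x ∂(simpleWalk s (n + d)).map (fun x => x + e * s), 0 ≤ p'.eval x := by
          refine (ae_map_iff (by fun_prop)
            (measurableSet_le measurable_const p'.continuous.measurable)).2 ?_
          filter_upwards [hp2] with x hx
          rwa [hpe]
        rw [hstep, ae_withDensity_iff hqm] at h1
        filter_upwards [h1] with x hx h2 h3
        exact hx (by simpa using lt_of_le_of_ne h3 h2.symm)
      refine ⟨q * p', ?_, ?_, ?_⟩
      · refine natDegree_mul_le.trans ?_
        have h1 : q.natDegree ≤ 1 := by
          refine (natDegree_add_le _ _).trans (max_le (by simp) ?_)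
          exact (natDegree_C_mul_le _ _).trans natDegree_X_le
        have h2 : p'.natDegree ≤ d := by
          rw [hp', natDegree_comp, natDegree_X_sub_C, mul_one]
          exact hp1
        omega
      · change ∀ᵐ x ∂simpleWalk s (n + d + 1), _
        filter_upwards [hq0, hp0] with x h1 h2
        rw [eval_mul]
        by_cases h : q.eval x = 0
        · simp [h]
        · exact mul_nonneg h1 (h2 h h1)
      · have e1 : (fun x : ℝ => x + (2 * j - (d + 1)) * s)
            = (fun x => x + e * s) ∘ fun x => x + (2 * j' - d) * s := by
          funext x
          simp only [Function.comp_apply]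
          linear_combination (-s) * hje
        have e2 : (fun x => ENNReal.ofReal (p.eval x))
            = fun x => (fun y => ENNReal.ofReal (p'.eval y)) (x + e * s) := by
          funext x
          simp only [hpe]
        rw [e1, ← Measure.map_map (by fun_prop) (by fun_prop), hp3, e2,
          map_withDensity_comp (by fun_prop) hpm, hstep, ← withDensity_mul _ hqm hpm]
        refine withDensity_congr_ae ?_
        change ∀ᵐ x ∂simpleWalk s (n + d + 1), _
        filter_upwards [hq0] with x h1
        rw [Pi.mul_apply, eval_mul, ENNReal.ofReal_mul h1]
    push_cast
    rcases Nat.lt_or_ge d j with h | h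
    · obtain rfl : j = d + 1 := by omega
      exact key d 1 le_rfl (Or.inl rfl) (by push_cast; ring)
    · exact key j (-1) h (Or.inr rfl) (by ring)

variable {k : ℕ}

/-- Independent walkers started from the densely packed configuration of `k` particles: on
antisymmetric functions, their law has a density proportional to the Vandermonde product with
respect to walkers that are started from the origin and make `k - 1` additional steps. -/
theorem exists_stepAvg_simpleWalk_packed {s : ℝ} (hs : 0 < s) (n : ℕ) :
    ∃ c : ℂ, ∀ u : (Fin k → ℝ) → ℂ, Antisymmetric u → ExpGrowth u →
      stepAvg (simpleWalk s n) u (fun i => (2 * (i : ℕ) - (k - 1 : ℕ)) * s)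
        = c * ∫ z, (vandermondeProd z : ℂ) * u z
            ∂Measure.pi fun _ : Fin k => simpleWalk s (n + (k - 1)) := by
  choose p hp1 hp2 hp3 using fun i : Fin k =>
    exists_polynomial_map_simpleWalk hs n (k - 1) i (by omega)
  obtain ⟨c, hc⟩ := exists_det_eval_eq_mul_vandermondeProd p
    fun i => lt_of_le_of_lt (hp1 i) (by have := i.2; omega)
  refine ⟨c / (k.factorial : ℂ), fun u hu hg => ?_⟩
  set x₀ : Fin k → ℝ := fun i => (2 * (i : ℕ) - (k - 1 : ℕ)) * s with hx₀
  set ν := simpleWalk s (n + (k - 1)) with hν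
  set D : (Fin k → ℝ) → ℝ≥0∞ := fun z => ∏ i, ENNReal.ofReal ((p i).eval (z i)) with hD
  have hpm : ∀ i, Measurable fun x : ℝ => ENNReal.ofReal ((p i).eval x) := fun i =>
    (p i).continuous.measurable.ennreal_ofReal
  have hDm : Measurable D := Finset.measurable_prod _ fun i _ => (hpm i).comp (measurable_pi_apply i)
  have hfin : ∀ i, IsProbabilityMeasure (ν.withDensity fun x => ENNReal.ofReal ((p i).eval x)) := by
    intro i
    rw [← hp3 i]
    exact Measure.isProbabilityMeasure_map (by fun_prop)
  -- The law of the walkers started at `x₀` has the product of the polynomials `p i` as density.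
  have hmap : (Measure.pi fun _ : Fin k => simpleWalk s n).map (fun z => x₀ + z)
      = (Measure.pi fun _ : Fin k => ν).withDensity D := by
    rw [hD, ← pi_withDensity (fun _ : Fin k => ν) hpm]
    have h1 : (fun z : Fin k → ℝ => x₀ + z) = fun z i => z i + x₀ i := by
      funext z i
      exact add_comm _ _
    have hpr : ∀ i, IsProbabilityMeasure ((simpleWalk s n).map fun x => x + x₀ i) := fun i =>
      Measure.isProbabilityMeasure_map (by fun_prop)
    rw [h1, Measure.pi_map_pi (X := fun _ => ℝ) (Y := fun _ => ℝ) (f := fun i x => x + x₀ i)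
      fun _ => by fun_prop]
    congr 1
    funext i
    exact hp3 i
  have hDlt : ∀ᵐ z ∂Measure.pi fun _ : Fin k => ν, D z < ⊤ :=
    ae_of_all _ fun z => ENNReal.prod_lt_top fun i _ => ENNReal.ofReal_lt_top
  have hDr : ∀ᵐ z ∂Measure.pi fun _ : Fin k => ν, (D z).toReal = ∏ i, (p i).eval (z i) := by
    have : ∀ᵐ z ∂Measure.pi fun _ : Fin k => ν, ∀ i, 0 ≤ (p i).eval (z i) :=
      ae_all_iff.2 fun i => (measurePreserving_eval (fun _ : Fin k => ν) i).quasiMeasurePreserving.ae (hp2 i)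
    filter_upwards [this] with z hz
    rw [hD, ENNReal.toReal_prod]
    exact Finset.prod_congr rfl fun i _ => ENNReal.toReal_ofReal (hz i)
  have hint : Integrable (fun z => ((∏ i, (p i).eval (z i) : ℝ) : ℂ) * u z)
      (Measure.pi fun _ : Fin k => ν) := by
    have h1 : Integrable u ((Measure.pi fun _ : Fin k => ν).withDensity D) := by
      rw [← hmap]
      exact (integrable_map_measure hg.measurable.aestronglyMeasurable (by fun_prop)).2
        (hg.integrable_add (expMoments_simpleWalk s n) x₀)
    refine ((integrable_withDensity_iff_integrable_smul' hDm hDlt).1 h1).congr ?_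
    filter_upwards [hDr] with z hz
    rw [hz, Complex.real_smul]
  have hI : stepAvg (simpleWalk s n) u x₀
      = ∫ z, ((∏ i, (p i).eval (z i) : ℝ) : ℂ) * u z ∂Measure.pi fun _ : Fin k => ν := by
    have h1 : stepAvg (simpleWalk s n) u x₀ = ∫ z, u z ∂(Measure.pi fun _ : Fin k => ν).withDensity D := by
      rw [← hmap, integral_map (by fun_prop) hg.measurable.aestronglyMeasurable]
      rfl
    rw [h1, integral_withDensity_eq_integral_toReal_smul hDm hDlt]
    refine integral_congr_ae ?_
    filter_upwards [hDr] with z hz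
    rw [hz, Complex.real_smul]
  -- Antisymmetrising this product gives a determinant, which is a multiple of `h`.
  have hsum := integral_det_mul_antisymmetric ν (fun i x => (p i).eval x) hu hint
  simp_rw [hc, Complex.ofReal_mul, mul_assoc] at hsum
  rw [← hI, integral_const_mul] at hsum
  have hf : (k.factorial : ℂ) ≠ 0 := by exact_mod_cast k.factorial_ne_zero
  rw [div_mul_eq_mul_div, eq_div_iff hf, mul_comm, hsum]

end SimpleWalk

/-! ### Expectations along one line -/

section LineExpectation

variable {k : ℕ}

/-- The configuration `y` at time `r`, centred and scaled so that steps become `±s`. -/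
noncomputable def gridPos (s : ℝ) (r : ℕ) (y : Fin k → ℤ) : Fin k → ℝ :=
  fun i => s * (2 * (y i : ℝ) - r - (k + 1))

theorem strictMono_gridPos_iff {s : ℝ} (hs : 0 < s) (r : ℕ) (y : Fin k → ℤ) :
    StrictMono (gridPos s r y) ↔ StrictMono y := by
  have h : ∀ a b : Fin k, gridPos s r y a < gridPos s r y b ↔ y a < y b := by
    intro a b
    unfold gridPos
    rw [mul_lt_mul_iff_right₀ hs, sub_lt_sub_iff_right, sub_lt_sub_iff_right,
      mul_lt_mul_iff_right₀ two_pos, Int.cast_lt]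
  exact ⟨fun hm a b hab => (h a b).1 (hm hab), fun hm a b hab => (h a b).2 (hm hab)⟩

/-- The Vandermonde product is homogeneous and translation invariant, so its normalised version is
not affected by centring and scaling. -/
theorem relVandermonde_eq_gridPos {s : ℝ} (hs : s ≠ 0) (r : ℕ) (y : Fin k → ℤ) :
    relVandermonde y = vandermondeProd (gridPos s r y)
      / vandermondeProd (gridPos s 0 fun i : Fin k => (i : ℤ) + 1) := by
  have e : ∀ (r : ℕ) (y : Fin k → ℤ), vandermondeProd (gridPos s r y)
      = (2 * s) ^ (∑ i : Fin k, (Finset.Ioi i).card) * vandermondeProd fun i => (y i : ℝ) := by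
    intro r y
    rw [← vandermondeProd_affine (2 * s) (s * (-r - (k + 1)))]
    congr 1
    funext i
    unfold gridPos
    ring
  have h : (2 * s) ^ (∑ i : Fin k, (Finset.Ioi i).card) ≠ 0 :=
    pow_ne_zero _ (mul_ne_zero two_ne_zero hs)
  rw [e, e, mul_div_mul_left _ _ h, relVandermonde]
  push_cast
  rfl

theorem stepAvg_signStep (s : ℝ) (w : (Fin k → ℝ) → ℂ) (hw : Measurable w) (x : Fin k → ℝ) :
    stepAvg (signStep s) w x
      = ∑ ε : Fin k → Bool, (2⁻¹ : ℂ) ^ k * w (x + fun i => if ε i then s else -s) := by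
  have h1 : signStep s = ((2⁻¹ : ℝ≥0∞) • Measure.count : Measure Bool).map
      fun b => if b then s else -s := by
    rw [Measure.count, Measure.map_smul, Measure.sum_bool, Measure.map_add _ _ Measurable.of_discrete,
      Measure.map_dirac' Measurable.of_discrete, Measure.map_dirac' Measurable.of_discrete, smul_add, signStep]
    simp [add_comm]
  have : IsFiniteMeasure ((2⁻¹ : ℝ≥0∞) • Measure.count : Measure Bool) :=
    ⟨by rw [Measure.smul_apply, Measure.count_apply_finite _ Set.finite_univ]
        exact ENNReal.mul_lt_top (by simp) (by simp)⟩
  have h2 : (Measure.pi fun _ : Fin k => signStep s)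
      = (Measure.pi fun _ : Fin k => ((2⁻¹ : ℝ≥0∞) • Measure.count : Measure Bool)).map
        fun ε i => if ε i then s else -s := by
    rw [Measure.pi_map_pi (X := fun _ => Bool) (Y := fun _ => ℝ) (f := fun _ b => if b then s else -s)
      fun _ => Measurable.of_discrete.aemeasurable, ← h1]
  have hm : Measurable fun (ε : Fin k → Bool) (i : Fin k) => if ε i then s else -s :=
    measurable_of_countable _
  unfold stepAvg
  rw [h2, integral_map (f := fun z => w (x + z)) hm.aemeasurable
      (hw.comp (measurable_const_add x)).aestronglyMeasurable,
    integral_fintype .of_finite]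
  refine Finset.sum_congr rfl fun ε _ => ?_
  rw [measureReal_def, Measure.pi_singleton]
  simp

theorem stepAvg_simpleWalk_zero (s : ℝ) (w : (Fin k → ℝ) → ℂ) :
    stepAvg (simpleWalk s 0) w = w := by
  have h : (Measure.pi fun _ : Fin k => Measure.dirac (0 : ℝ)) = Measure.dirac 0 := by
    refine Measure.pi_eq fun t ht => ?_
    rw [Measure.dirac_apply' _ (MeasurableSet.univ_pi ht)]
    simp_rw [Measure.dirac_apply' _ (ht _)]
    by_cases h0 : (0 : Fin k → ℝ) ∈ Set.univ.pi t
    · rw [Set.indicator_of_mem h0]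
      exact (Finset.prod_eq_one fun i _ => by rw [Set.indicator_of_mem (show (0 : ℝ) ∈ t i from h0 i trivial)]; rfl).symm
    · rw [Set.indicator_of_notMem h0]
      have : ∃ i, (0 : ℝ) ∉ t i := by simpa [Set.mem_pi] using h0
      obtain ⟨i, hi⟩ := this
      exact (Finset.prod_eq_zero (Finset.mem_univ i) (Set.indicator_of_notMem hi _)).symm
  funext x
  unfold stepAvg simpleWalk
  rw [h, integral_dirac, add_zero]

variable {Ω : Type*} [MeasurableSpace Ω]

open Classical in
/-- Given the trajectory of line `k` up to time `r`, the conditional expectation of `Ψ` is the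
ratio of `w` and the Vandermonde product at the current position. -/
structure IsFutureMean (P : Measure Ω) (β : (j : ℕ) → Fin j → ℕ → Ω → ℤ) (s : ℝ) (r : ℕ)
    (Ψ : Ω → ℂ) (w : (Fin k → ℝ) → ℂ) : Prop where
  integrable : Integrable Ψ P
  setIntegral_eq : ∀ y : ℕ → Fin k → ℤ,
    ∫ ω in {ω | ∀ t, t ≤ r → coinLine β k t ω = y t}, Ψ ω ∂P
      = if IsPath r y then (2⁻¹ : ℂ) ^ (k * r)
          / vandermondeProd (gridPos s 0 fun i : Fin k => (i : ℤ) + 1) * w (gridPos s r (y r)) else 0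

variable {P : Measure Ω} [IsProbabilityMeasure P] {β : (j : ℕ) → Fin j → ℕ → Ω → ℤ}
  {s : ℝ} {r : ℕ} {Ψ : Ω → ℂ} {w : (Fin k → ℝ) → ℂ}

theorem isFutureMean_one (hβ : IsFairCoins P β) (hs : 0 < s) (r : ℕ) :
    IsFutureMean (k := k) P β s r (fun _ => 1) fun x => (vandermondeProd x : ℂ) := by
  refine ⟨integrable_const _, fun y => ?_⟩
  rw [setIntegral_const, measureReal_def, hβ.measure_path, pathProb]
  split_ifs with h
  · rw [ENNReal.toReal_mul, ENNReal.toReal_ofReal (relVandermonde_nonneg h.strictMono),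
      relVandermonde_eq_gridPos hs.ne' r]
    simp
    ring
  · simp

omit [IsProbabilityMeasure P] in
theorem IsFutureMean.integral_eq (h : IsFutureMean P β s 0 Ψ w) :
    ∫ ω, Ψ ω ∂P = w (gridPos s 0 fun i : Fin k => (i : ℤ) + 1)
      / vandermondeProd (gridPos s 0 fun i : Fin k => (i : ℤ) + 1) := by
  have h1 := h.setIntegral_eq fun _ i => ((i : ℕ) : ℤ) + 1
  have h2 : {ω | ∀ t, t ≤ 0 → coinLine β k t ω = fun i : Fin k => ((i : ℕ) : ℤ) + 1} = Set.univ := by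
    ext ω
    simp only [Set.mem_ofPred_eq, Set.mem_univ, iff_true, Nat.le_zero]
    rintro t rfl
    exact funext fun i => coinLine_zero β k ω i
  rw [h2, setIntegral_univ, if_pos ⟨fun _ => rfl, fun s hs => absurd hs (Nat.not_lt_zero s)⟩] at h1
  rw [h1]
  simp
  ring

omit [IsProbabilityMeasure P] in
/-- A function of the present position can be taken out. Sorting does not change the position, whose
coordinates increase; it makes the factor a symmetric function on the whole space. -/
theorem IsFutureMean.mul (hβ : IsFairCoins P β) (hs : 0 < s) (h : IsFutureMean P β s r Ψ w)
    {f : (Fin k → ℝ) → ℂ} (hf : Measurable f) (hf1 : ∀ x, ‖f x‖ ≤ 1) :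
    IsFutureMean P β s r (fun ω => f (gridPos s r (coinLine β k r ω)) * Ψ ω)
      fun x => f (sortVec x) * w x := by
  have hm : Measurable fun ω => f (gridPos s r (coinLine β k r ω)) :=
    hf.comp ((measurable_of_countable (gridPos s r)).comp (hβ.measurable_coinLine k r))
  refine ⟨h.integrable.bdd_mul hm.aestronglyMeasurable (ae_of_all _ fun ω => hf1 _), fun y => ?_⟩
  have hA : MeasurableSet {ω | ∀ t, t ≤ r → coinLine β k t ω = y t} :=
    measurableSet_forall_le_coinLine (hβ.measurable_coinLine k) _ y
  have h1 : ∫ ω in {ω | ∀ t, t ≤ r → coinLine β k t ω = y t},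
        f (gridPos s r (coinLine β k r ω)) * Ψ ω ∂P
      = ∫ ω in {ω | ∀ t, t ≤ r → coinLine β k t ω = y t}, f (gridPos s r (y r)) * Ψ ω ∂P :=
    setIntegral_congr_fun hA fun ω hω => by
      simp only [hω r le_rfl]
  rw [h1, integral_const_mul, h.setIntegral_eq]
  split_ifs with hy
  · rw [sortVec_of_strictMono ((strictMono_gridPos_iff hs r _).2 hy.strictMono)]
    ring
  · simp

/-- One step of the line can be averaged out as if the particles were independent: steps leading to
a collision have probability zero for the line, and contribute nothing to the average because `w`,
being antisymmetric, vanishes there. -/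
theorem IsFutureMean.signStep (hβ : IsFairCoins P β)
    (h : IsFutureMean P β s (r + 1) Ψ w) (hw : Measurable w) (hw' : Antisymmetric w) :
    IsFutureMean P β s r Ψ (stepAvg (signStep s) w) := by
  classical
  refine ⟨h.integrable, fun y => ?_⟩
  set inc : (Fin k → Bool) → Fin k → ℤ := fun ε i => if ε i then 1 else 0 with hinc
  set ext : (Fin k → Bool) → ℕ → Fin k → ℤ := fun ε => Function.update y (r + 1) (y r + inc ε)
    with hext
  have hext_self : ∀ ε, ext ε (r + 1) = y r + inc ε := fun ε => Function.update_self _ _ _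
  have hext_le : ∀ ε t, t ≤ r → ext ε t = y t := fun ε t ht =>
    Function.update_of_ne (by omega) _ _
  have hinj : Function.Injective inc := by
    intro ε ε' he
    funext i
    have := congrFun he i
    simp only [hinc] at this
    cases h1 : ε i <;> cases h2 : ε' i <;> simp_all
  have hset : ({ω | ∀ t, t ≤ r → coinLine β k t ω = y t} : Set Ω) =ᵐ[P]
      (⋃ ε, {ω | ∀ t, t ≤ r + 1 → coinLine β k t ω = ext ε t} : Set Ω) := by
    filter_upwards [hβ.ae_isStep k r] with ω hω
    refine propext ?_
    change (∀ t, t ≤ r → coinLine β k t ω = y t) ↔ ω ∈ ⋃ ε, _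
    simp only [Set.mem_iUnion, Set.mem_ofPred_eq]
    constructor
    · intro hy
      refine ⟨fun i => decide (coinLine β k (r + 1) ω i = coinLine β k r ω i + 1), fun t ht => ?_⟩
      rcases Nat.le_succ_iff.1 ht with ht | rfl
      · rw [hext_le _ _ ht, hy t ht]
      · rw [hext_self]
        funext i
        simp only [hinc, Pi.add_apply, ← hy r le_rfl, decide_eq_true_eq]
        rcases hω.1 i with h1 | h1
        · rw [if_neg (by omega), h1, add_zero]
        · rw [if_pos h1, h1]
    · rintro ⟨ε, hε⟩ t ht
      rw [hε t (by omega), hext_le _ _ ht]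
  have hA : ∀ ε, MeasurableSet {ω | ∀ t, t ≤ r + 1 → coinLine β k t ω = ext ε t} := fun ε =>
    measurableSet_forall_le_coinLine (hβ.measurable_coinLine k) _ _
  have hdisj : Pairwise (Function.onFun Disjoint
      fun ε => {ω | ∀ t, t ≤ r + 1 → coinLine β k t ω = ext ε t}) := by
    intro ε ε' hne
    refine Set.disjoint_left.2 fun ω h1 h2 => hne (hinj ?_)
    have h3 := (h1 (r + 1) le_rfl).symm.trans (h2 (r + 1) le_rfl)
    rw [hext_self, hext_self] at h3
    exact add_left_cancel h3
  rw [setIntegral_congr_set hset, integral_iUnion_fintype hA hdisj fun ε => h.integrable.integrableOn,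
    stepAvg_signStep s w hw]
  have hterm : ∀ ε, ∫ ω in {ω | ∀ t, t ≤ r + 1 → coinLine β k t ω = ext ε t}, Ψ ω ∂P
      = if IsPath r y then (2⁻¹ : ℂ) ^ (k * r)
          / vandermondeProd (gridPos s 0 fun i : Fin k => (i : ℤ) + 1)
          * ((2⁻¹ : ℂ) ^ k * w (gridPos s r (y r) + fun i => if ε i then s else -s)) else 0 := by
    intro ε
    have hpath : IsPath r (ext ε) ↔ IsPath r y := by
      unfold IsPath
      rw [hext_le ε 0 (Nat.zero_le r)]
      refine and_congr_right fun _ => forall₂_congr fun t ht => ?_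
      rw [hext_le ε t (by omega), hext_le ε (t + 1) (by omega)]
    have hpos : gridPos s (r + 1) (y r + inc ε)
        = gridPos s r (y r) + fun i => if ε i then s else -s := by
      funext i
      simp only [gridPos, hinc, Pi.add_apply]
      split_ifs <;> push_cast <;> ring
    rw [h.setIntegral_eq, isPath_succ, hpath, hext_self, hext_le ε r le_rfl, hpos]
    by_cases hy : IsPath r y
    · have hmono := hy.strictMono
      by_cases hst : StrictMono (y r + inc ε)
      · have hstep : IsStep (y r) (y r + inc ε) := by
          refine ⟨fun i => ?_, hst⟩
          simp only [hinc, Pi.add_apply]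
          split_ifs <;> simp
        rw [if_pos ⟨hy, hstep⟩, if_pos hy]
        ring
      · rw [if_neg fun h' => hst h'.2.2, if_pos hy]
        have hcoll : ∃ i j : Fin k, i < j ∧ y r i + inc ε i = y r j + inc ε j := by
          by_contra! hne
          refine hst fun i j hij => lt_of_le_of_ne ?_ (hne i j hij)
          have h1 := hmono hij
          have h2 : inc ε i ≤ 1 := by simp only [hinc]; split_ifs <;> simp
          have h3 : 0 ≤ inc ε j := by simp only [hinc]; split_ifs <;> simp
          simp only [Pi.add_apply]
          omega
        obtain ⟨i, j, hij, he⟩ := hcoll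
        rw [← hpos, hw'.eq_zero hij.ne, mul_zero, mul_zero]
        have : (y r + inc ε) i = (y r + inc ε) j := he
        unfold gridPos
        rw [this]
    · rw [if_neg fun h' => hy h'.1, if_neg hy]
  rw [Finset.sum_congr rfl fun ε _ => hterm ε]
  split_ifs with hy
  · rw [← Finset.mul_sum]
  · simp

theorem IsFutureMean.simpleWalk (hβ : IsFairCoins P β) {d : ℕ}
    (h : IsFutureMean P β s (r + d) Ψ w) (hw : ExpGrowth w) (hw' : Antisymmetric w) :
    IsFutureMean P β s r Ψ (stepAvg (simpleWalk s d) w) := by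
  induction d generalizing r with
  | zero => rwa [stepAvg_simpleWalk_zero s w]
  | succ d ih =>
    have h1 : IsFutureMean P β s (r + 1) Ψ (stepAvg (_root_.simpleWalk s d) w) :=
      ih (by rwa [add_assoc, add_comm 1 d])
    have h2 : stepAvg (_root_.simpleWalk s (d + 1)) w
        = stepAvg (_root_.signStep s) (stepAvg (_root_.simpleWalk s d) w) := by
      funext x
      exact stepAvg_conv (expMoments_simpleWalk s d) (expMoments_signStep s) hw x
    rw [h2]
    exact h1.signStep hβ (hw.stepAvg (expMoments_simpleWalk s d)).measurable hw'.stepAvg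

/-- Conditional expectations of products of functions of the future positions are given by
independent walks. -/
theorem isFutureMean_walkFun (hβ : IsFairCoins P β) (hs : 0 < s) {n : ℕ} (T : Fin (n + 1) → ℕ)
    (hT : Monotone T) {f : Fin n → (Fin k → ℝ) → ℂ} (hf : ∀ l, Measurable (f l))
    (hf1 : ∀ l x, ‖f l x‖ ≤ 1) :
    IsFutureMean P β s (T 0)
      (fun ω => ∏ l, f l (gridPos s (T l.succ) (coinLine β k (T l.succ) ω)))
      (walkFun n (fun l => _root_.simpleWalk s (T l.succ - T l.castSucc)) fun l x => f l (sortVec x)) := by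
  induction n with
  | zero =>
    simp only [Finset.univ_eq_empty, Finset.prod_empty]
    exact isFutureMean_one hβ hs (T 0)
  | succ n ih =>
    have h1 := ih (Fin.tail T) (fun a b hab => hT (Fin.succ_le_succ_iff.2 hab))
      (f := Fin.tail f) (fun l => hf l.succ) fun l => hf1 l.succ
    have h2 := h1.mul hβ hs (hf 0) (hf1 0)
    have h3 : Fin.tail T 0 = T 0 + (T 1 - T 0) := by
      have : T 0 ≤ T 1 := hT (Fin.zero_le 1)
      change T 1 = _
      omega
    rw [h3] at h2
    have hg : ∀ l, ExpGrowth fun x : Fin k → ℝ => Fin.tail f l (sortVec x) := fun l =>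
      expGrowth_of_norm_le_one ((hf l.succ).comp continuous_sortVec.measurable) fun x => hf1 l.succ _
    have hw := expGrowth_walkFun (ν := fun l => _root_.simpleWalk s (Fin.tail T l.succ - Fin.tail T l.castSucc))
      (fun l => expMoments_simpleWalk s _) hg
    have ha := antisymmetric_walkFun
      (ν := fun l => _root_.simpleWalk s (Fin.tail T l.succ - Fin.tail T l.castSucc))
      (f := fun l (x : Fin k → ℝ) => Fin.tail f l (sortVec x))
      fun l x σ => by rw [sortVec_comp_perm]
    have h4 := h2.simpleWalk hβ
      ((expGrowth_of_norm_le_one ((hf 0).comp continuous_sortVec.measurable) fun x => hf1 0 _).mul hw)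
      (ha.mul_symm (f := fun x => f 0 (sortVec x)) fun x σ => by rw [sortVec_comp_perm])
    rw [← h3] at h4
    simp only [Fin.prod_univ_succ]
    exact h4

/-- `E[h(S_0) f_0(S_0) ⋯ f_n(S_n) h(S_n)]` for a walk `S` of `k` independent particles, where `S_0`
and the increments of `S` have the distributions `ν_0, …, ν_n`. -/
noncomputable def weightedMean {n : ℕ} (ν : Fin (n + 1) → Measure ℝ)
    (f : Fin (n + 1) → (Fin k → ℝ) → ℂ) : ℂ :=
  ∫ z, (vandermondeProd z : ℂ) * (f 0 z * walkFun n (Fin.tail ν) (Fin.tail f) z)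
    ∂Measure.pi fun _ : Fin k => ν 0

/-- The number of steps of the walks behind the positions at times `T 0 ≤ ⋯ ≤ T n`: the first one
makes `k - 1` additional steps, in exchange for being started at the origin. -/
def walkSteps (k : ℕ) {n : ℕ} (T : Fin (n + 1) → ℕ) : Fin (n + 1) → ℕ :=
  Fin.cons (T 0 + (k - 1)) fun l => T l.succ - T l.castSucc

/-- Expectations along line `k` are proportional to weighted means of independent walks. The factor
is left unspecified; it is determined by the case of constant functions. -/
theorem exists_integral_prod_line_eq (hβ : IsFairCoins P β) (hk : 1 ≤ k) (hs : 0 < s) {n : ℕ}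
    (T : Fin (n + 1) → ℕ) (hT : Monotone T) :
    ∃ c : ℂ, ∀ f : Fin (n + 1) → (Fin k → ℝ) → ℂ, (∀ l, Measurable (f l)) → (∀ l x, ‖f l x‖ ≤ 1) →
      ∫ ω, ∏ l, f l (gridPos s (T l) (coinLine β k (T l) ω)) ∂P
        = c * weightedMean (fun l => _root_.simpleWalk s (walkSteps k T l)) fun l x => f l (sortVec x) := by
  obtain ⟨c, hc⟩ := exists_stepAvg_simpleWalk_packed (k := k) hs (T 0)
  refine ⟨c / vandermondeProd (gridPos s 0 fun i : Fin k => (i : ℤ) + 1), fun f hf hf1 => ?_⟩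
  have h1 := (isFutureMean_walkFun hβ hs T hT (f := Fin.tail f) (fun l => hf l.succ)
    fun l => hf1 l.succ).mul hβ hs (hf 0) (hf1 0)
  have hg : ∀ l, ExpGrowth fun x : Fin k → ℝ => Fin.tail f l (sortVec x) := fun l =>
      expGrowth_of_norm_le_one ((hf l.succ).comp continuous_sortVec.measurable) fun x => hf1 l.succ _
  have hw := (expGrowth_of_norm_le_one ((hf 0).comp continuous_sortVec.measurable) fun x => hf1 0 _).mul
    (expGrowth_walkFun (ν := fun l : Fin n => _root_.simpleWalk s (T l.succ - T l.castSucc))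
      (fun l => expMoments_simpleWalk s _) hg)
  have ha := (antisymmetric_walkFun
      (ν := fun l : Fin n => _root_.simpleWalk s (T l.succ - T l.castSucc))
      (f := fun l (x : Fin k → ℝ) => Fin.tail f l (sortVec x))
      fun l x σ => by rw [sortVec_comp_perm]).mul_symm (f := fun x => f 0 (sortVec x))
      fun x σ => by rw [sortVec_comp_perm]
  have h2 : IsFutureMean P β s (0 + T 0)
      (fun ω => f 0 (gridPos s (T 0) (coinLine β k (T 0) ω))
        * ∏ l, Fin.tail f l (gridPos s (T l.succ) (coinLine β k (T l.succ) ω)))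
      (fun x => f 0 (sortVec x) * walkFun n (fun l : Fin n => _root_.simpleWalk s (T l.succ - T l.castSucc))
        (fun l x => Fin.tail f l (sortVec x)) x) := by
    rw [Nat.zero_add]
    exact h1
  have h3 := (h2.simpleWalk hβ hw ha).integral_eq
  have hpos : (gridPos s 0 fun i : Fin k => (i : ℤ) + 1)
      = fun i : Fin k => (2 * (i : ℕ) - (k - 1 : ℕ)) * s := by
    funext i
    unfold gridPos
    push_cast [hk]
    ring
  simp only [Fin.prod_univ_succ]
  refine h3.trans ?_
  have h4 := hc _ ha hw
  rw [← hpos] at h4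
  refine (congrArg (· / _) h4).trans ?_
  unfold weightedMean
  simp only [walkSteps, Fin.cons_zero]
  rw [mul_div_right_comm]
  rfl

end LineExpectation

/-! ### Weak convergence of the walks -/

section WeakConvergence

open Topology

/-- The truncation of `g` at norm `R` differs from `g` by at most `‖g‖² / R`. -/
theorem norm_sub_truncation_le {R : ℝ} (hR : 0 < R) (z : ℂ) :
    ‖z - ((R / max R ‖z‖ : ℝ) : ℂ) * z‖ ≤ ‖z‖ ^ 2 / R := by
  rcases le_total ‖z‖ R with h | h
  · rw [max_eq_left h, div_self hR.ne', Complex.ofReal_one, one_mul, sub_self, norm_zero]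
    positivity
  · rw [max_eq_right h]
    have hz : 0 < ‖z‖ := hR.trans_le h
    have h1 : z - ((R / ‖z‖ : ℝ) : ℂ) * z = ((1 - R / ‖z‖ : ℝ) : ℂ) * z := by push_cast; ring
    rw [h1, norm_mul, Complex.norm_real, Real.norm_eq_abs,
      abs_of_nonneg (sub_nonneg.2 ((div_le_one hz).2 h)), le_div_iff₀ hR]
    have h2 : (1 - R / ‖z‖) * ‖z‖ = ‖z‖ - R := by field_simp
    rw [h2]
    nlinarith

/-- Weak convergence implies convergence of the integrals of a continuous function with bounded
second moments. -/
theorem tendsto_integral_of_bounded_sq {X : Type*} [TopologicalSpace X] [MeasurableSpace X]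
    [OpensMeasurableSpace X] {μ : ℕ → ProbabilityMeasure X} {μ' : ProbabilityMeasure X}
    (h : Tendsto μ atTop (𝓝 μ')) {g : X → ℂ} (hg : Continuous g) {B : ℝ}
    (hi : ∀ N, Integrable (fun x => ‖g x‖ ^ 2) (μ N : Measure X))
    (hi' : Integrable (fun x => ‖g x‖ ^ 2) (μ' : Measure X))
    (hB : ∀ N, ∫ x, ‖g x‖ ^ 2 ∂(μ N : Measure X) ≤ B)
    (hB' : ∫ x, ‖g x‖ ^ 2 ∂(μ' : Measure X) ≤ B) :
    Tendsto (fun N => ∫ x, g x ∂(μ N : Measure X)) atTop (𝓝 (∫ x, g x ∂(μ' : Measure X))) := by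
  rw [ProbabilityMeasure.tendsto_iff_forall_integral_rclike_tendsto ℂ] at h
  have hB0 : 0 ≤ B := (integral_nonneg fun _ => by positivity).trans hB'
  rw [Metric.tendsto_atTop]
  intro ε hε
  -- At this level truncation changes every integral by at most `B / R < ε / 3`.
  set R : ℝ := 3 * (B + 1) / ε with hR
  have hR0 : 0 < R := by positivity
  have hmax : ∀ x, 0 < max R ‖g x‖ := fun x => lt_max_of_lt_left hR0
  set gR : X → ℂ := fun x => ((R / max R ‖g x‖ : ℝ) : ℂ) * g x with hgR
  have hgRc : Continuous gR := by
    refine (Complex.continuous_ofReal.comp ?_).mul hg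
    exact continuous_const.div (continuous_const.max hg.norm) fun x => (hmax x).ne'
  have hgRb : ∀ x, ‖gR x‖ ≤ R := by
    intro x
    rw [hgR, norm_mul, Complex.norm_real, Real.norm_eq_abs, abs_of_nonneg (by positivity),
      div_mul_eq_mul_div, div_le_iff₀ (hmax x)]
    exact mul_le_mul_of_nonneg_left (le_max_right _ _) hR0.le
  have happ : ∀ ν : ProbabilityMeasure X, Integrable (fun x => ‖g x‖ ^ 2) (ν : Measure X) →
      ∫ x, ‖g x‖ ^ 2 ∂(ν : Measure X) ≤ B →
      ‖∫ x, g x ∂(ν : Measure X) - ∫ x, gR x ∂(ν : Measure X)‖ < ε / 3 := by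
    intro ν hν hνB
    have h1 : Integrable g (ν : Measure X) := by
      refine Integrable.mono' (hν.add (integrable_const 1)) hg.aestronglyMeasurable
        (ae_of_all _ fun x => ?_)
      simp only [Pi.add_apply]
      nlinarith [sq_nonneg (‖g x‖ - 1), norm_nonneg (g x)]
    have h2 : Integrable gR (ν : Measure X) :=
      Integrable.mono' (integrable_const R) hgRc.aestronglyMeasurable (ae_of_all _ hgRb)
    rw [← integral_sub h1 h2]
    calc ‖∫ x, g x - gR x ∂(ν : Measure X)‖ ≤ ∫ x, ‖g x‖ ^ 2 / R ∂(ν : Measure X) :=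
          norm_integral_le_of_norm_le (hν.div_const R)
            (ae_of_all _ fun x => norm_sub_truncation_le hR0 (g x))
      _ = (∫ x, ‖g x‖ ^ 2 ∂(ν : Measure X)) / R := integral_div _ _
      _ < ε / 3 := by
          rw [div_lt_iff₀ hR0, hR]
          have : ε / 3 * (3 * (B + 1) / ε) = B + 1 := by field_simp
          rw [this]
          linarith
  obtain ⟨N₀, hN₀⟩ := (Metric.tendsto_atTop.1
    (h (BoundedContinuousFunction.ofNormedAddCommGroup gR hgRc R hgRb))) (ε / 3) (by positivity)
  refine ⟨N₀, fun N hN => ?_⟩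
  have h1 := happ (μ N) (hi N) (hB N)
  have h2 := happ μ' hi' hB'
  have h3 := hN₀ N hN
  rw [dist_eq_norm] at h3 ⊢
  simp only [BoundedContinuousFunction.coe_ofNormedAddCommGroup] at h3
  have h4 : ∫ x, g x ∂(μ N : Measure X) - ∫ x, g x ∂(μ' : Measure X)
      = (∫ x, g x ∂(μ N : Measure X) - ∫ x, gR x ∂(μ N : Measure X))
        + (∫ x, gR x ∂(μ N : Measure X) - ∫ x, gR x ∂(μ' : Measure X))
        - (∫ x, g x ∂(μ' : Measure X) - ∫ x, gR x ∂(μ' : Measure X)) := by ring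
  rw [h4]
  refine (norm_sub_le _ _).trans_lt ?_
  linarith [norm_add_le (∫ x, g x ∂(μ N : Measure X) - ∫ x, gR x ∂(μ N : Measure X))
    (∫ x, gR x ∂(μ N : Measure X) - ∫ x, gR x ∂(μ' : Measure X))]

theorem charFun_simpleWalk (s : ℝ) (d : ℕ) (ξ : ℝ) :
    charFun (simpleWalk s d) ξ = ((Real.cos (ξ * s) ^ d : ℝ) : ℂ) := by
  induction d with
  | zero => simp [simpleWalk]
  | succ d ih =>
    have h1 : charFun (signStep s) ξ = ((Real.cos (ξ * s) : ℝ) : ℂ) := by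
      have hi : ∀ a : ℝ, Integrable (fun x : ℝ => Complex.exp (ξ * x * Complex.I)) ((2⁻¹ : ℝ≥0∞) • Measure.dirac a) :=
        fun a => (integrable_dirac (by simp)).smul_measure (by simp)
      rw [charFun_apply_real, signStep, integral_add_measure (hi _) (hi _), integral_smul_measure,
        integral_smul_measure, integral_dirac, integral_dirac, Complex.ofReal_cos, Complex.cos]
      simp [Complex.real_smul]
      ring_nf
    rw [simpleWalk, charFun_conv, ih, h1]
    push_cast
    ring

theorem tendsto_cos_div_sqrt_pow (ξ : ℝ) :
    Tendsto (fun N : ℕ => Real.cos (ξ * (1 / √N)) ^ N) atTop (𝓝 (Real.exp (-(ξ ^ 2 / 2)))) := by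
  have h : Tendsto (fun N : ℕ => (N : ℝ) * (Real.cos (ξ * (1 / √N)) - 1)) atTop (𝓝 (-(ξ ^ 2 / 2))) := by
    rw [tendsto_iff_norm_sub_tendsto_zero]
    have h0 : Tendsto (fun N : ℕ => |ξ| ^ 4 * (5 / 96) * (1 / (N : ℝ))) atTop (𝓝 0) := by
      have := (tendsto_one_div_atTop_nhds_zero_nat (𝕜 := ℝ)).const_mul (|ξ| ^ 4 * (5 / 96))
      rwa [mul_zero] at this
    refine squeeze_zero' (Eventually.of_forall fun _ => norm_nonneg _) ?_ h0
    filter_upwards [eventually_ge_atTop 1, eventually_ge_atTop ⌈ξ ^ 2⌉₊] with N hN hN2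
    have hNpos : (0 : ℝ) < N := by exact_mod_cast hN
    have hsq : √(N : ℝ) ^ 2 = N := Real.sq_sqrt hNpos.le
    have hs : 0 < √(N : ℝ) := Real.sqrt_pos.2 hNpos
    have hle : |ξ * (1 / √N)| ≤ 1 := by
      rw [mul_one_div, abs_div, abs_of_pos hs, div_le_one hs]
      exact Real.abs_le_sqrt (Nat.ceil_le.1 hN2)
    have hb := Real.cos_bound hle
    have e1 : (ξ * (1 / √(N : ℝ))) ^ 2 = ξ ^ 2 / N := by
      rw [mul_one_div, div_pow, hsq]
    have e2 : |ξ * (1 / √(N : ℝ))| ^ 4 = |ξ| ^ 4 / N ^ 2 := by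
      rw [mul_one_div, abs_div, abs_of_pos hs, div_pow, show 4 = 2 * 2 from rfl, pow_mul (√(N : ℝ)), hsq]
    rw [e1, e2] at hb
    have e3 : (N : ℝ) * (Real.cos (ξ * (1 / √N)) - 1) - -(ξ ^ 2 / 2)
        = N * (Real.cos (ξ * (1 / √N)) - (1 - ξ ^ 2 / N / 2)) := by
      field_simp
      ring
    rw [e3, Real.norm_eq_abs, abs_mul, abs_of_pos hNpos]
    refine (mul_le_mul_of_nonneg_left hb hNpos.le).trans (le_of_eq ?_)
    field_simp
  have := Real.tendsto_one_add_pow_exp_of_tendsto h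
  simpa using this

/-- As the cosine is eventually positive, its `d N`-th power is the real power, with exponent
`d N / N`, of its `N`-th power. -/
theorem tendsto_cos_div_sqrt_pow_mul (ξ : ℝ) {d : ℕ → ℕ} {v : ℝ}
    (hd : Tendsto (fun N : ℕ => (d N : ℝ) / N) atTop (𝓝 v)) :
    Tendsto (fun N : ℕ => Real.cos (ξ * (1 / √N)) ^ d N) atTop (𝓝 (Real.exp (-(v * ξ ^ 2 / 2)))) := by
  have h1 := (tendsto_cos_div_sqrt_pow ξ).rpow hd (Or.inl (Real.exp_pos _).ne')
  rw [← Real.exp_mul] at h1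
  have h2 : -(ξ ^ 2 / 2) * v = -(v * ξ ^ 2 / 2) := by ring
  rw [h2] at h1
  refine h1.congr' ?_
  have h0 : Tendsto (fun N : ℕ => Real.cos (ξ * (1 / √N))) atTop (𝓝 1) := by
    have : Tendsto (fun N : ℕ => ξ * (1 / √(N : ℝ))) atTop (𝓝 0) := by
      have := (Real.tendsto_sqrt_atTop.comp tendsto_natCast_atTop_atTop).inv_tendsto_atTop.const_mul ξ
      simpa [Function.comp_def] using this
    have h3 := (Real.continuous_cos.tendsto 0).comp this
    rwa [Real.cos_zero] at h3
  filter_upwards [h0.eventually (lt_mem_nhds zero_lt_one), eventually_ge_atTop 1] with N hN hN1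
  have hN0 : (N : ℝ) ≠ 0 := by exact_mod_cast (by omega : N ≠ 0)
  rw [← Real.rpow_natCast, ← Real.rpow_natCast, ← Real.rpow_mul hN.le, mul_div_cancel₀ _ hN0]

/-- Central limit theorem for the simple random walk. -/
theorem tendsto_simpleWalk {d : ℕ → ℕ} {v : ℝ≥0}
    (hd : Tendsto (fun N : ℕ => (d N : ℝ) / N) atTop (𝓝 v)) :
    Tendsto (β := ProbabilityMeasure ℝ) (fun N : ℕ => ⟨simpleWalk (1 / √N) (d N), inferInstance⟩) atTop
      (𝓝 ⟨gaussianReal 0 v, inferInstance⟩) := by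
  refine ProbabilityMeasure.tendsto_of_tendsto_charFun fun ξ => ?_
  have h1 : charFun (gaussianReal 0 v) ξ = ((Real.exp (-((v : ℝ) * ξ ^ 2 / 2)) : ℝ) : ℂ) := by
    rw [charFun_gaussianReal]
    push_cast
    congr 1
    ring
  change Tendsto (fun N : ℕ => charFun (simpleWalk (1 / √N) (d N)) ξ) atTop (𝓝 (charFun (gaussianReal 0 v) ξ))
  rw [h1]
  simp_rw [charFun_simpleWalk]
  exact (Complex.continuous_ofReal.tendsto _).comp (tendsto_cos_div_sqrt_pow_mul ξ hd)

theorem integral_exp_abs_simpleWalk_le (s a : ℝ) (d : ℕ) :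
    ∫ x, Real.exp (a * |x|) ∂simpleWalk s d ≤ 2 * Real.exp (a ^ 2 * (s ^ 2 * d) / 2) := by
  have h1 : ∀ b : ℝ, Integrable (fun x => Real.exp (b * x)) (simpleWalk s d) := fun b =>
    integrable_simpleWalk s d (by fun_prop)
  calc ∫ x, Real.exp (a * |x|) ∂simpleWalk s d
      ≤ ∫ x, Real.exp (a * x) + Real.exp (-a * x) ∂simpleWalk s d := by
        refine integral_mono (expMoments_simpleWalk s d a) ((h1 a).add (h1 (-a))) fun x => ?_
        rcases abs_choice x with h | h <;> simp only [h]
        · linarith [Real.exp_pos (-a * x)]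
        · rw [neg_mul, mul_neg]
          linarith [Real.exp_pos (a * x)]
    _ = 2 * Real.cosh (a * s) ^ d := by
        rw [integral_add (h1 a) (h1 (-a)), integral_exp_simpleWalk, integral_exp_simpleWalk,
          neg_mul, Real.cosh_neg]
        ring
    _ ≤ _ := by
        have h2 : Real.cosh (a * s) ^ d ≤ Real.exp ((a * s) ^ 2 / 2) ^ d :=
          pow_le_pow_left₀ (Real.cosh_pos _).le (Real.cosh_le_exp_half_sq _) d
        rw [← Real.exp_nat_mul] at h2
        have e : (d : ℝ) * ((a * s) ^ 2 / 2) = a ^ 2 * (s ^ 2 * d) / 2 := by ring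
        rw [e] at h2
        linarith

theorem expMoments_gaussianReal (v : ℝ≥0) : ExpMoments (gaussianReal 0 v) := by
  intro a
  refine Integrable.mono' ((integrable_exp_mul_gaussianReal a).add (integrable_exp_mul_gaussianReal (-a)))
    (by fun_prop) (ae_of_all _ fun x => ?_)
  rw [Real.norm_eq_abs, Real.abs_exp]
  simp only [Pi.add_apply]
  rcases abs_choice x with h | h <;> simp only [h]
  · linarith [Real.exp_pos (-a * x)]
  · rw [neg_mul, mul_neg]
    linarith [Real.exp_pos (a * x)]

end WeakConvergence

/-! ### Convergence of weighted means -/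

section WeightedMeans

open Topology

variable {k : ℕ}

/-- `f_1(x + S_1) ⋯ f_n(x + S_n) h(x + S_n)`, where `S` has the increments `G_1, …, G_n`. -/
noncomputable def walkIntegrand : (n : ℕ) → (Fin n → (Fin k → ℝ) → ℂ) → (Fin k → ℝ) →
    (Fin n → Fin k → ℝ) → ℂ
  | 0, _ => fun x _ => (vandermondeProd x : ℂ)
  | n + 1, f => fun x G => f 0 (x + G 0) * walkIntegrand n (Fin.tail f) (x + G 0) (Fin.tail G)

theorem continuous_walkIntegrand {n : ℕ} {f : Fin n → (Fin k → ℝ) → ℂ} (hf : ∀ l, Continuous (f l)) :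
    Continuous fun p : (Fin k → ℝ) × (Fin n → Fin k → ℝ) => walkIntegrand n f p.1 p.2 := by
  induction n with
  | zero => exact (Complex.continuous_ofReal.comp continuous_vandermondeProd).comp continuous_fst
  | succ n ih =>
    have h0 : Continuous fun p : (Fin k → ℝ) × (Fin (n + 1) → Fin k → ℝ) => p.1 + p.2 0 := by fun_prop
    have ht : Continuous fun p : (Fin k → ℝ) × (Fin (n + 1) → Fin k → ℝ) => Fin.tail p.2 := by
      unfold Fin.tail
      fun_prop
    exact ((hf 0).comp h0).mul ((ih fun l => hf l.succ).comp (h0.prodMk ht))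

theorem norm_walkIntegrand_le {n : ℕ} {f : Fin n → (Fin k → ℝ) → ℂ} (hf : ∀ l x, ‖f l x‖ ≤ 1)
    (x : Fin k → ℝ) (G : Fin n → Fin k → ℝ) :
    ‖walkIntegrand n f x G‖
      ≤ Real.exp ((∑ i : Fin k, (Finset.Ioi i).card : ℕ) * 2 * (l1Norm x + ∑ l, l1Norm (G l))) := by
  induction n generalizing x with
  | zero =>
    simp only [walkIntegrand, Finset.univ_eq_empty, Finset.sum_empty, add_zero, Complex.norm_real]
    rw [mul_assoc]
    exact abs_vandermondeProd_le x
  | succ n ih =>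
    rw [walkIntegrand, norm_mul]
    refine (mul_le_of_le_one_left (norm_nonneg _) (hf 0 _)).trans
      ((ih (f := Fin.tail f) (fun l => hf l.succ) _ _).trans ?_)
    rw [Fin.sum_univ_succ]
    refine Real.exp_le_exp.2 (mul_le_mul_of_nonneg_left ?_ (by positivity))
    have := l1Norm_add_le x (G 0)
    have e : ∑ l, l1Norm (Fin.tail G l) = ∑ l : Fin n, l1Norm (G l.succ) := rfl
    rw [e]
    linarith

theorem integrable_exp_sum_l1Norm {n : ℕ} {ν : Fin n → Measure ℝ} [∀ l, IsProbabilityMeasure (ν l)]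
    (hν : ∀ l, ExpMoments (ν l)) (a : ℝ) :
    Integrable (fun G : Fin n → Fin k → ℝ => Real.exp (a * ∑ l, l1Norm (G l)))
      (Measure.pi fun l => Measure.pi fun _ : Fin k => ν l) := by
  simp_rw [Finset.mul_sum, Real.exp_sum]
  exact Integrable.fintype_prod (f := fun _ x => Real.exp (a * l1Norm x)) fun l =>
    (hν l).integrable_exp_l1Norm a

theorem integral_exp_sum_l1Norm {n : ℕ} (ν : Fin n → Measure ℝ) [∀ l, IsProbabilityMeasure (ν l)]
    (a : ℝ) :
    ∫ G : Fin n → Fin k → ℝ, Real.exp (a * ∑ l, l1Norm (G l))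
        ∂(Measure.pi fun l => Measure.pi fun _ : Fin k => ν l)
      = ∏ l, (∫ x, Real.exp (a * |x|) ∂ν l) ^ k := by
  simp_rw [Finset.mul_sum, Real.exp_sum]
  rw [integral_fintype_prod_eq_prod (fun _ x => Real.exp (a * l1Norm x))]
  refine Finset.prod_congr rfl fun l _ => ?_
  simp_rw [exp_mul_l1Norm]
  rw [integral_fintype_prod_eq_prod (fun (_ : Fin k) x => Real.exp (a * |x|))]
  simp

/-- The iterated averages are one integral over all increments. Continuity of the functions serves
only to make the integrand measurable. -/
theorem walkFun_eq_integral {n : ℕ} {ν : Fin n → Measure ℝ} [∀ l, IsProbabilityMeasure (ν l)]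
    (hν : ∀ l, ExpMoments (ν l)) {f : Fin n → (Fin k → ℝ) → ℂ} (hf : ∀ l, Continuous (f l))
    (hf1 : ∀ l x, ‖f l x‖ ≤ 1) (x : Fin k → ℝ) :
    walkFun n ν f x
      = ∫ G, walkIntegrand n f x G ∂(Measure.pi fun l => Measure.pi fun _ : Fin k => ν l) := by
  induction n generalizing x with
  | zero => simp [walkFun, walkIntegrand]
  | succ n ih =>
    have : ∀ l, IsProbabilityMeasure (Fin.tail ν l) := fun l => inferInstanceAs (IsProbabilityMeasure (ν l.succ))
    have hmp := measurePreserving_finCons fun l => Measure.pi fun _ : Fin k => ν l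
    have hi : Integrable (walkIntegrand (n + 1) f x)
        (Measure.pi fun l => Measure.pi fun _ : Fin k => ν l) := by
      set D : ℝ := (∑ i : Fin k, (Finset.Ioi i).card : ℕ) * 2 with hD
      refine Integrable.mono' ((integrable_exp_sum_l1Norm hν D).const_mul (Real.exp (D * l1Norm x)))
        ((continuous_walkIntegrand hf).comp (Continuous.prodMk_right x)).aestronglyMeasurable
        (ae_of_all _ fun G => ?_)
      rw [← Real.exp_add, ← mul_add]
      exact norm_walkIntegrand_le hf1 x G
    have hi' : Integrable (fun p : (Fin k → ℝ) × (Fin n → Fin k → ℝ) =>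
        walkIntegrand (n + 1) f x (Fin.cons p.1 p.2)) _ :=
      (hmp.integrable_comp_emb measurableEmbedding_finCons).2 hi
    rw [← hmp.integral_comp measurableEmbedding_finCons, integral_prod _ hi', walkFun, stepAvg]
    refine integral_congr_ae (ae_of_all _ fun z => ?_)
    simp only [walkIntegrand, Fin.cons_zero]
    rw [integral_const_mul, ih (ν := Fin.tail ν) (fun l => hν l.succ) (f := Fin.tail f) (fun l => hf l.succ) fun l => hf1 l.succ]
    rfl

theorem norm_vandermondeProd_mul_walkIntegrand_le {n : ℕ} {f : Fin (n + 1) → (Fin k → ℝ) → ℂ}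
    (hf : ∀ l x, ‖f l x‖ ≤ 1) (G : Fin (n + 1) → Fin k → ℝ) :
    ‖(vandermondeProd (G 0) : ℂ) * walkIntegrand (n + 1) f 0 G‖
      ≤ Real.exp (2 * ((∑ i : Fin k, (Finset.Ioi i).card : ℕ) * 2) * ∑ l, l1Norm (G l)) := by
  have hc : (0 : ℝ) ≤ (∑ i : Fin k, (Finset.Ioi i).card : ℕ) := Nat.cast_nonneg _
  have h1 := abs_vandermondeProd_le (G 0)
  have h2 := norm_walkIntegrand_le hf 0 G
  have h0 : l1Norm (0 : Fin k → ℝ) = 0 := by simp [l1Norm]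
  have h3 : l1Norm (G 0) ≤ ∑ l, l1Norm (G l) :=
    Finset.single_le_sum (f := fun l => l1Norm (G l)) (fun _ _ => l1Norm_nonneg _) (Finset.mem_univ 0)
  rw [h0, zero_add] at h2
  rw [norm_mul, Complex.norm_real, Real.norm_eq_abs]
  refine (mul_le_mul h1 h2 (norm_nonneg _) (Real.exp_pos _).le).trans ?_
  rw [← Real.exp_add]
  refine Real.exp_le_exp.2 ?_
  nlinarith [mul_le_mul_of_nonneg_left h3 hc]

theorem weightedMean_eq_integral {n : ℕ} {ν : Fin (n + 1) → Measure ℝ}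
    [∀ l, IsProbabilityMeasure (ν l)] (hν : ∀ l, ExpMoments (ν l))
    {f : Fin (n + 1) → (Fin k → ℝ) → ℂ} (hf : ∀ l, Continuous (f l)) (hf1 : ∀ l x, ‖f l x‖ ≤ 1) :
    weightedMean ν f = ∫ G, (vandermondeProd (G 0) : ℂ) * walkIntegrand (n + 1) f 0 G
        ∂(Measure.pi fun l => Measure.pi fun _ : Fin k => ν l) := by
  have hmp := measurePreserving_finCons fun l => Measure.pi fun _ : Fin k => ν l
  have hi : Integrable (fun G => (vandermondeProd (G 0) : ℂ) * walkIntegrand (n + 1) f 0 G)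
      (Measure.pi fun l => Measure.pi fun _ : Fin k => ν l) := by
    set D : ℝ := (∑ i : Fin k, (Finset.Ioi i).card : ℕ) * 2 with hD
    have hc : Continuous fun G : Fin (n + 1) → Fin k → ℝ =>
        (vandermondeProd (G 0) : ℂ) * walkIntegrand (n + 1) f 0 G :=
      ((Complex.continuous_ofReal.comp continuous_vandermondeProd).comp (continuous_apply 0)).mul
        ((continuous_walkIntegrand hf).comp (Continuous.prodMk_right 0))
    refine Integrable.mono' (integrable_exp_sum_l1Norm hν (2 * D)) hc.aestronglyMeasurable
      (ae_of_all _ fun G => ?_)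
    exact norm_vandermondeProd_mul_walkIntegrand_le hf1 G
  have hi' : Integrable (fun p : (Fin k → ℝ) × (Fin n → Fin k → ℝ) =>
      (vandermondeProd ((Fin.cons p.1 p.2 : Fin (n + 1) → Fin k → ℝ) 0) : ℂ)
        * walkIntegrand (n + 1) f 0 (Fin.cons p.1 p.2)) _ :=
    (hmp.integrable_comp_emb measurableEmbedding_finCons).2 hi
  have : ∀ l, IsProbabilityMeasure (Fin.tail ν l) := fun l => inferInstanceAs (IsProbabilityMeasure (ν l.succ))
  rw [← hmp.integral_comp measurableEmbedding_finCons, integral_prod _ hi', weightedMean]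
  refine integral_congr_ae (ae_of_all _ fun z => ?_)
  simp only [walkIntegrand, Fin.cons_zero, zero_add, Fin.tail_cons]
  rw [integral_const_mul, integral_const_mul,
    walkFun_eq_integral (ν := Fin.tail ν) (fun l => hν l.succ) (f := Fin.tail f) (fun l => hf l.succ)
      fun l => hf1 l.succ]
  rfl

/-- Weighted means of continuous functions are continuous with respect to weak convergence of the
step distributions with bounded exponential moments. -/
theorem tendsto_weightedMean {n : ℕ} {ν : ℕ → Fin (n + 1) → ProbabilityMeasure ℝ}
    {ν' : Fin (n + 1) → ProbabilityMeasure ℝ}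
    (h : ∀ l, Tendsto (fun N => ν N l) atTop (𝓝 (ν' l)))
    (hν : ∀ N l, ExpMoments (ν N l)) (hν' : ∀ l, ExpMoments (ν' l))
    (hB : ∀ a : ℝ, ∃ B, ∀ N l, ∫ x, Real.exp (a * |x|) ∂(ν N l : Measure ℝ) ≤ B)
    {f : Fin (n + 1) → (Fin k → ℝ) → ℂ} (hf : ∀ l, Continuous (f l)) (hf1 : ∀ l x, ‖f l x‖ ≤ 1) :
    Tendsto (fun N => weightedMean (fun l => (ν N l : Measure ℝ)) f) atTop
      (𝓝 (weightedMean (fun l => (ν' l : Measure ℝ)) f)) := by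
  have e : ∀ μ : Fin (n + 1) → ProbabilityMeasure ℝ, (∀ l, ExpMoments (μ l)) →
      weightedMean (fun l => (μ l : Measure ℝ)) f
      = ∫ G, (vandermondeProd (G 0) : ℂ) * walkIntegrand (n + 1) f 0 G
        ∂(ProbabilityMeasure.pi fun l => ProbabilityMeasure.pi fun _ : Fin k => μ l :
          Measure (Fin (n + 1) → Fin k → ℝ)) := fun μ hμ => weightedMean_eq_integral hμ hf hf1
  simp_rw [e _ (hν _), e _ hν']
  set D : ℝ := (∑ i : Fin k, (Finset.Ioi i).card : ℕ) * 2 with hD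
  have hc : Continuous fun G : Fin (n + 1) → Fin k → ℝ =>
      (vandermondeProd (G 0) : ℂ) * walkIntegrand (n + 1) f 0 G :=
    ((Complex.continuous_ofReal.comp continuous_vandermondeProd).comp (continuous_apply 0)).mul
      ((continuous_walkIntegrand hf).comp (Continuous.prodMk_right 0))
  have hbound : ∀ G : Fin (n + 1) → Fin k → ℝ,
      ‖(vandermondeProd (G 0) : ℂ) * walkIntegrand (n + 1) f 0 G‖ ^ 2
        ≤ Real.exp (4 * D * ∑ l, l1Norm (G l)) := by
    intro G
    refine (pow_le_pow_left₀ (norm_nonneg _) (norm_vandermondeProd_mul_walkIntegrand_le hf1 G) 2).trans_eq ?_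
    rw [← Real.exp_nat_mul, hD]
    congr 1
    push_cast
    ring
  have hi : ∀ μ : Fin (n + 1) → ProbabilityMeasure ℝ, (∀ l, ExpMoments (μ l)) →
      Integrable (fun G => ‖(vandermondeProd (G 0) : ℂ) * walkIntegrand (n + 1) f 0 G‖ ^ 2)
      (ProbabilityMeasure.pi fun l => ProbabilityMeasure.pi fun _ : Fin k => μ l :
          Measure (Fin (n + 1) → Fin k → ℝ)) := fun μ hμ =>
    Integrable.mono' (integrable_exp_sum_l1Norm hμ (4 * D)) (hc.norm.pow 2).aestronglyMeasurable
      (ae_of_all _ fun G => by rw [Real.norm_eq_abs, abs_of_nonneg (by positivity)]; exact hbound G)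
  have hle : ∀ μ : Fin (n + 1) → ProbabilityMeasure ℝ, (∀ l, ExpMoments (μ l)) →
      ∫ G, ‖(vandermondeProd (G 0) : ℂ) * walkIntegrand (n + 1) f 0 G‖ ^ 2
        ∂(ProbabilityMeasure.pi fun l => ProbabilityMeasure.pi fun _ : Fin k => μ l :
          Measure (Fin (n + 1) → Fin k → ℝ))
      ≤ ∏ l, (∫ x, Real.exp (4 * D * |x|) ∂(μ l : Measure ℝ)) ^ k := fun μ hμ =>
    (integral_mono (hi μ hμ) (integrable_exp_sum_l1Norm hμ (4 * D)) hbound).trans_eq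
      (integral_exp_sum_l1Norm (fun l => (μ l : Measure ℝ)) (4 * D))
  obtain ⟨B, hB⟩ := hB (4 * D)
  -- Weak convergence passes to products; the exponential moments bound the second moments.
  refine tendsto_integral_of_bounded_sq
    (B := max (∏ _l : Fin (n + 1), B ^ k) (∏ l, (∫ x, Real.exp (4 * D * |x|) ∂(ν' l : Measure ℝ)) ^ k))
    ?_ hc (fun N => hi _ (hν N)) (hi _ hν') (fun N => ?_) ?_
  · refine (ProbabilityMeasure.continuous_pi.tendsto _).comp (tendsto_pi_nhds.2 fun l => ?_)
    exact (ProbabilityMeasure.continuous_pi.tendsto _).comp (tendsto_pi_nhds.2 fun _ => h l)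
  · refine (hle _ (hν N)).trans (le_max_of_le_left ?_)
    have h0 : ∀ l, 0 ≤ ∫ x, Real.exp (4 * D * |x|) ∂(ν N l : Measure ℝ) := fun l =>
      integral_nonneg fun _ => (Real.exp_pos _).le
    exact Finset.prod_le_prod (fun l _ => pow_nonneg (h0 l) k) fun l _ => pow_le_pow_left₀ (h0 l) (hB N l) k
  · exact (hle _ hν').trans (le_max_right _ _)

theorem tendsto_weightedMean_simpleWalk {n : ℕ} {d : ℕ → Fin (n + 1) → ℕ} {v : Fin (n + 1) → ℝ≥0}
    (hd : ∀ l, Tendsto (fun N : ℕ => (d N l : ℝ) / N) atTop (𝓝 (v l)))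
    {f : Fin (n + 1) → (Fin k → ℝ) → ℂ} (hf : ∀ l, Continuous (f l)) (hf1 : ∀ l x, ‖f l x‖ ≤ 1) :
    Tendsto (fun N : ℕ => weightedMean (fun l => simpleWalk (1 / √N) (d N l)) f) atTop
      (𝓝 (weightedMean (fun l => gaussianReal 0 (v l)) f)) := by
  refine tendsto_weightedMean (ν := fun N l => ⟨simpleWalk (1 / √(N : ℝ)) (d N l), inferInstance⟩)
    (ν' := fun l => ⟨gaussianReal 0 (v l), inferInstance⟩) (fun l => tendsto_simpleWalk (hd l))
    (fun N l => expMoments_simpleWalk _ _) (fun l => expMoments_gaussianReal _) (fun a => ?_) hf hf1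
  choose M hM using fun l => (hd l).bddAbove_range
  refine ⟨2 * Real.exp (a ^ 2 * (∑ l, |M l|) / 2), fun N l => ?_⟩
  refine (integral_exp_abs_simpleWalk_le _ a _).trans ?_
  have h1 : (1 / √(N : ℝ)) ^ 2 * d N l ≤ ∑ l, |M l| := by
    rw [div_pow, Real.sq_sqrt (Nat.cast_nonneg N), one_pow, one_div_mul_eq_div]
    exact (hM l ⟨N, rfl⟩).trans ((le_abs_self _).trans
      (Finset.single_le_sum (f := fun l => |M l|) (fun _ _ => abs_nonneg _) (Finset.mem_univ l)))
  gcongr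

end WeightedMeans

/-! ### Integrals of determinants -/

section Determinants

variable {k : ℕ}

theorem det_eq_sum_sign_mul_prod_row (M : Matrix (Fin k) (Fin k) ℝ) :
    M.det = ∑ σ : Equiv.Perm (Fin k), ((Equiv.Perm.sign σ : ℤ) : ℝ) * ∏ i, M i (σ i) := by
  rw [← Matrix.det_transpose, Matrix.det_apply']
  rfl

theorem integrable_det_pi (μ : Fin k → Measure ℝ) [∀ i, SigmaFinite (μ i)] {g : Fin k → Fin k → ℝ → ℝ}
    (hg : ∀ i j, Integrable (g i j) (μ i)) :
    Integrable (fun z : Fin k → ℝ => (Matrix.of fun i j => g i j (z i)).det) (Measure.pi μ) := by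
  simp_rw [det_eq_sum_sign_mul_prod_row, Matrix.of_apply]
  exact integrable_finsetSum _ fun σ _ =>
    (Integrable.fintype_prod (f := fun i => g i (σ i)) fun i => hg i (σ i)).const_mul _

theorem integral_det_pi (μ : Fin k → Measure ℝ) [∀ i, SigmaFinite (μ i)] {g : Fin k → Fin k → ℝ → ℝ}
    (hg : ∀ i j, Integrable (g i j) (μ i)) :
    ∫ z, (Matrix.of fun i j => g i j (z i)).det ∂Measure.pi μ
      = (Matrix.of fun i j => ∫ x, g i j x ∂μ i).det := by
  simp_rw [det_eq_sum_sign_mul_prod_row, Matrix.of_apply]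
  rw [integral_finsetSum _ fun σ _ =>
    (Integrable.fintype_prod (f := fun i => g i (σ i)) fun i => hg i (σ i)).const_mul _]
  refine Finset.sum_congr rfl fun σ _ => ?_
  rw [integral_const_mul, integral_fintype_prod_eq_prod (fun i => g i (σ i))]

/-- Total positivity of the exponential kernel. Subtracting from each row its predecessor, the determinant becomes an integral of determinants
of the same kind with one row less, over configurations interlacing with the given one. -/
theorem det_exp_mul_nonneg {x y : Fin k → ℝ} (hx : Monotone x) (hy : Monotone y) :
    0 ≤ (Matrix.of fun i j => Real.exp (x i * y j)).det := by
  induction k with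
  | zero => simp
  | succ k ih =>
    set z : Fin k → ℝ := fun j => y j.succ - y 0 with hz
    have hz0 : ∀ j, 0 ≤ z j := fun j => sub_nonneg.2 (hy (Fin.zero_le _))
    have hzm : Monotone z := fun a b hab => sub_le_sub_right (hy (Fin.succ_le_succ_iff.2 hab)) _
    have hd : ∀ (c a b : ℝ), a ≤ b →
        ∫ u in Set.Ioc a b, c * Real.exp (u * c) = Real.exp (b * c) - Real.exp (a * c) := by
      intro c a b hab
      rw [← intervalIntegral.integral_of_le hab]
      refine intervalIntegral.integral_eq_sub_of_hasDerivAt (f := fun u => Real.exp (u * c))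
        (fun u _ => ?_)
        ((by fun_prop : Continuous fun u => c * Real.exp (u * c)).intervalIntegrable _ _)
      have := ((hasDerivAt_id u).mul_const c).exp
      simpa [mul_comm] using this
    have h1 : (Matrix.of fun i j => Real.exp (x i * y j)).det
        = (∏ i, Real.exp (x i * y 0)) * (Matrix.of fun i j => Real.exp (x i * (y j - y 0))).det := by
      rw [← Matrix.det_mul_column]
      congr 1
      ext i j
      simp only [Matrix.of_apply]
      rw [← Real.exp_add]
      congr 1
      ring
    have h2 : (Matrix.of fun i j => Real.exp (x i * (y j - y 0))).det
        = (Matrix.of fun l j : Fin k => ∫ u in Set.Ioc (x l.castSucc) (x l.succ),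
            z j * Real.exp (u * z j)).det := by
      rw [Matrix.det_eq_of_forall_row_eq_smul_add_pred
        (B := Matrix.of fun i j => Fin.cases (Real.exp (x 0 * (y j - y 0)))
          (fun l : Fin k => Real.exp (x l.succ * (y j - y 0)) - Real.exp (x l.castSucc * (y j - y 0))) i)
        (fun _ => 1) (fun j => by simp) (fun i j => by simp)]
      rw [Matrix.det_succ_column_zero, Fin.sum_univ_succ]
      simp only [Matrix.of_apply, Fin.val_zero, pow_zero, Fin.cases_zero, Fin.cases_succ, sub_self,
        mul_zero, zero_mul, Finset.sum_const_zero, add_zero, Real.exp_zero, one_mul]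
      congr 1
      ext l j
      rw [Matrix.of_apply, hd _ _ _ (hx (Fin.castSucc_lt_succ).le)]
      simp [hz]
    have h3 := integral_det_pi (fun l : Fin k => volume.restrict (Set.Ioc (x l.castSucc) (x l.succ)))
      (g := fun _ j u => z j * Real.exp (u * z j))
      fun l j => ((by fun_prop : Continuous fun u => z j * Real.exp (u * z j)).integrableOn_Icc.mono_set
        Set.Ioc_subset_Icc_self)
    rw [h1, h2, ← h3]
    refine mul_nonneg (Finset.prod_nonneg fun _ _ => (Real.exp_pos _).le) (integral_nonneg_of_ae ?_)
    have hmem : ∀ᵐ u ∂Measure.pi fun l : Fin k => volume.restrict (Set.Ioc (x l.castSucc) (x l.succ)),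
        ∀ l, u l ∈ Set.Ioc (x l.castSucc) (x l.succ) := by
      rw [← Measure.restrict_pi_pi]
      filter_upwards [ae_restrict_mem (MeasurableSet.univ_pi fun _ => measurableSet_Ioc)] with u hu
      exact fun l => hu l trivial
    filter_upwards [hmem] with u hu
    have hum : Monotone u := by
      intro a b hab
      rcases hab.eq_or_lt with rfl | hlt
      · exact le_rfl
      · exact (hu a).2.trans ((hx (Fin.succ_le_castSucc_iff.2 hlt)).trans (hu b).1.le)
    rw [Pi.zero_apply]
    have h4 : (Matrix.of fun l j : Fin k => z j * Real.exp (u l * z j)).det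
        = (∏ j, z j) * (Matrix.of fun l j : Fin k => Real.exp (u l * z j)).det :=
      Matrix.det_mul_row z (Matrix.of fun l j : Fin k => Real.exp (u l * z j))
    rw [h4]
    exact mul_nonneg (Finset.prod_nonneg fun j _ => hz0 j) (ih hum hzm)

/-- The Gaussian kernel is the exponential kernel up to factors depending on one variable only. -/
theorem det_gaussianPDFReal_nonneg (t : ℝ≥0) {x y : Fin k → ℝ} (hx : Monotone x) (hy : Monotone y) :
    0 ≤ (Matrix.of fun i j => gaussianPDFReal 0 t (y i - x j)).det := by
  have h : (Matrix.of fun i j => gaussianPDFReal 0 t (y i - x j)).det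
      = (∏ i, (√(2 * Real.pi * t))⁻¹ * Real.exp (-(y i) ^ 2 / (2 * t)))
        * ((∏ j, Real.exp (-(x j) ^ 2 / (2 * t)))
          * (Matrix.of fun i j => Real.exp (y i / t * x j)).det) := by
    rw [← Matrix.det_mul_row, ← Matrix.det_mul_column]
    congr 1
    ext i j
    simp only [Matrix.of_apply, gaussianPDFReal]
    rw [mul_assoc (√(2 * Real.pi * t))⁻¹, ← Real.exp_add, ← Real.exp_add]
    congr 2
    rcases eq_or_ne (t : ℝ) 0 with h0 | h0
    · simp [h0]
    · field_simp
      ring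
  rw [h]
  refine mul_nonneg (Finset.prod_nonneg fun _ _ => by positivity)
    (mul_nonneg (Finset.prod_nonneg fun _ _ => (Real.exp_pos _).le) (det_exp_mul_nonneg ?_ hx))
  exact fun a b hab => div_le_div_of_nonneg_right (hy hab) t.2

end Determinants

/-! ### Gaussian averages of the Vandermonde product -/

section GaussianVandermonde

open Polynomial

variable {k : ℕ}

theorem ExpMoments.integrable_pow {ν : Measure ℝ} (hν : ExpMoments ν) (n : ℕ) :
    Integrable (fun x => x ^ n) ν := by
  refine Integrable.mono' ((hν 1).const_mul (n.factorial : ℝ)) (by fun_prop) (ae_of_all _ fun x => ?_)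
  rw [norm_pow, Real.norm_eq_abs, one_mul]
  have := Real.pow_div_factorial_le_exp |x| (abs_nonneg x) n
  rwa [div_le_iff₀ (by positivity), mul_comm] at this

theorem ExpMoments.integrable_eval {ν : Measure ℝ} (hν : ExpMoments ν) (p : ℝ[X]) :
    Integrable (fun x => p.eval x) ν := by
  simp_rw [Polynomial.eval_eq_sum_range]
  exact integrable_finsetSum _ fun i _ => (hν.integrable_pow i).const_mul _

/-- Averaging a power over a random step gives a monic polynomial of the same degree. -/
theorem exists_monic_eval_eq_integral_add_pow {ν : Measure ℝ} [IsProbabilityMeasure ν]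
    (hν : ExpMoments ν) (n : ℕ) :
    ∃ p : ℝ[X], p.natDegree = n ∧ p.Monic ∧ ∀ x, p.eval x = ∫ z, (x + z) ^ n ∂ν := by
  set p : ℝ[X] := ∑ m ∈ Finset.range (n + 1), C ((∫ z, z ^ (n - m) ∂ν) * n.choose m) * X ^ m with hp
  have hdeg : p.natDegree ≤ n := natDegree_sum_le_of_forall_le _ _ fun m hm =>
    (natDegree_C_mul_X_pow_le _ _).trans (Nat.lt_succ_iff.1 (Finset.mem_range.1 hm))
  have hcoeff : p.coeff n = 1 := by
    simp only [hp, finsetSum_coeff, coeff_C_mul, coeff_X_pow]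
    simp
  have hmonic : p.Monic := monic_of_natDegree_le_of_coeff_eq_one n hdeg hcoeff
  refine ⟨p, le_antisymm hdeg (le_natDegree_of_ne_zero (by rw [hcoeff]; exact one_ne_zero)), hmonic, fun x => ?_⟩
  simp_rw [add_pow]
  rw [integral_finsetSum _ fun m _ => (((hν.integrable_pow (n - m)).const_mul (x ^ m)).mul_const _), hp,
    eval_finsetSum]
  refine Finset.sum_congr rfl fun m _ => ?_
  rw [integral_mul_const, integral_const_mul]
  simp
  ring

/-- The Vandermonde product is harmonic for walks of independent, identically distributed
particles. -/
theorem stepAvg_vandermondeProd {ν : Measure ℝ} [IsProbabilityMeasure ν] (hν : ExpMoments ν)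
    (x : Fin k → ℝ) :
    stepAvg ν (fun y => (vandermondeProd y : ℂ)) x = vandermondeProd x := by
  choose p hp1 hp2 hp3 using fun j : Fin k => exists_monic_eval_eq_integral_add_pow hν (j : ℕ)
  unfold stepAvg
  rw [integral_complex_ofReal, vandermondeProd_eq_det_eval x p hp1 hp2]
  congr 1
  simp_rw [hp3, vandermondeProd_eq_det]
  refine Eq.trans ?_ (integral_det_pi (fun _ : Fin k => ν) (g := fun i j z => (x i + z) ^ (j : ℕ)) ?_)
  · rfl
  · intro i j
    have := hν.integrable_eval ((C (x i) + X) ^ (j : ℕ))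
    simpa using this

/-- Gaussian integration by parts. -/
theorem integral_mul_eval_gaussianReal (p : ℝ[X]) :
    ∫ x, x * p.eval x ∂gaussianReal 0 1 = ∫ x, p.derivative.eval x ∂gaussianReal 0 1 := by
  have hm : ∀ q : ℝ[X], Integrable (fun x => gaussianPDFReal 0 1 x * q.eval x) := by
    intro q
    have h1 := (expMoments_gaussianReal 1).integrable_eval q
    rw [gaussianReal_of_var_ne_zero 0 one_ne_zero,
      integrable_withDensity_iff_integrable_smul' (measurable_gaussianPDF 0 1)
        (ae_of_all _ fun _ => gaussianPDF_lt_top)] at h1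
    simpa [toReal_gaussianPDF] using h1
  have hφ : ∀ x, HasDerivAt (gaussianPDFReal 0 1) (-x * gaussianPDFReal 0 1 x) x := by
    intro x
    unfold gaussianPDFReal
    have h1 : HasDerivAt (fun x : ℝ => -(x - 0) ^ 2 / (2 * ((1 : ℝ≥0) : ℝ))) (-x) x := by
      have := (((hasDerivAt_id x).sub_const 0).pow 2).neg.div_const (2 * ((1 : ℝ≥0) : ℝ))
      refine this.congr_deriv ?_
      simp
      ring
    refine (h1.exp.const_mul (√(2 * Real.pi * ((1 : ℝ≥0) : ℝ)))⁻¹).congr_deriv ?_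
    ring
  have h0 := integral_eq_zero_of_hasDerivAt_of_integrable
    (f := fun x => gaussianPDFReal 0 1 x * p.eval x)
    (f' := fun x => gaussianPDFReal 0 1 x * (p.derivative - X * p).eval x)
    (fun x => by
      have := (hφ x).mul (p.hasDerivAt x)
      refine this.congr_deriv ?_
      rw [eval_sub, eval_mul, eval_X]
      ring) (hm _) (hm _)
  have h2 : ∫ x, (p.derivative - X * p).eval x ∂gaussianReal 0 1 = 0 := by
    rw [integral_gaussianReal_eq_integral_smul one_ne_zero]
    simpa using h0
  have h3 : ∀ x, (p.derivative - X * p).eval x = p.derivative.eval x - (X * p).eval x := by simp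
  simp_rw [h3] at h2
  rw [integral_sub ((expMoments_gaussianReal 1).integrable_eval _)
    ((expMoments_gaussianReal 1).integrable_eval _), sub_eq_zero] at h2
  rw [h2]
  simp

/-- The Hermite polynomials with real coefficients. -/
noncomputable def hermiteReal (n : ℕ) : ℝ[X] := (hermite n).map (Int.castRingHom ℝ)

theorem hermiteReal_monic (n : ℕ) : (hermiteReal n).Monic := (hermite_monic n).map _

theorem natDegree_hermiteReal (n : ℕ) : (hermiteReal n).natDegree = n := by
  rw [hermiteReal, (hermite_monic n).natDegree_map, natDegree_hermite]

/-- Iterated integration by parts, with the recursion of the Hermite polynomials. -/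
theorem integral_hermite_mul_gaussianReal (n : ℕ) (q : ℝ[X]) :
    ∫ x, (hermiteReal n * q).eval x ∂gaussianReal 0 1
      = ∫ x, (derivative^[n] q).eval x ∂gaussianReal 0 1 := by
  induction n generalizing q with
  | zero => simp [hermiteReal]
  | succ n ih =>
    have h1 : hermiteReal (n + 1) = X * hermiteReal n - derivative (hermiteReal n) := by
      simp [hermiteReal, hermite_succ, derivative_map]
    have h2 : ∀ x, (hermiteReal (n + 1) * q).eval x
        = x * (hermiteReal n * q).eval x - (derivative (hermiteReal n) * q).eval x := by
      intro x
      rw [h1]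
      simp
      ring
    have hi := (expMoments_gaussianReal 1)
    have h3 : Integrable (fun x => x * (hermiteReal n * q).eval x) (gaussianReal 0 1) :=
      (hi.integrable_eval (X * (hermiteReal n * q))).congr (ae_of_all _ fun x => by simp)
    simp_rw [h2]
    rw [integral_sub h3 (hi.integrable_eval _), integral_mul_eval_gaussianReal,
      ← integral_sub (hi.integrable_eval _) (hi.integrable_eval _), Function.iterate_succ_apply, ← ih]
    refine integral_congr_ae (ae_of_all _ fun x => ?_)
    simp

theorem integral_hermite_mul_hermite (m n : ℕ) :
    ∫ x, (hermiteReal m).eval x * (hermiteReal n).eval x ∂gaussianReal 0 1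
      = if m = n then (n.factorial : ℝ) else 0 := by
  have key : ∀ m n : ℕ, n ≤ m → ∫ x, (hermiteReal m).eval x * (hermiteReal n).eval x ∂gaussianReal 0 1
      = if m = n then (n.factorial : ℝ) else 0 := by
    intro m n hnm
    simp_rw [← eval_mul]
    rw [integral_hermite_mul_gaussianReal]
    split_ifs with h
    · subst h
      have h1 := natDegree_hermiteReal m
      have h2 : derivative^[m] (hermiteReal m) = C (m.factorial : ℝ) := by
        have h3 : (derivative^[m] (hermiteReal m)).natDegree = 0 :=
          Nat.le_zero.1 ((natDegree_iterate_derivative _ _).trans (by rw [h1, Nat.sub_self]))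
        rw [eq_C_of_natDegree_eq_zero h3, coeff_iterate_derivative, zero_add, Nat.descFactorial_self]
        have h4 : (hermiteReal m).coeff m = 1 := by
          have := (hermiteReal_monic m).coeff_natDegree
          rwa [h1] at this
        rw [h4]
        simp
      rw [h2]
      simp
    · rw [iterate_derivative_eq_zero (by rw [natDegree_hermiteReal]; omega)]
      simp
  rcases le_total n m with h | h
  · exact key m n h
  · simp_rw [mul_comm ((hermiteReal m).eval _)]
    rw [key n m h]
    by_cases hmn : m = n
    · subst hmn; rfl
    · rw [if_neg hmn, if_neg (Ne.symm hmn)]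

/-- The Vandermonde product is a determinant of Hermite polynomials, which are orthogonal. -/
theorem integral_vandermondeProd_sq_standard :
    ∫ z, (vandermondeProd z : ℂ) * (vandermondeProd z : ℂ) ∂(Measure.pi fun _ : Fin k => gaussianReal 0 1)
      = k.factorial * ∏ j ∈ Finset.range k, (j.factorial : ℂ) := by
  have hh : ∀ z : Fin k → ℝ, vandermondeProd z
      = (Matrix.of fun i j : Fin k => (hermiteReal j).eval (z i)).det := fun z =>
    vandermondeProd_eq_det_eval z (fun j => hermiteReal j) (fun _ => natDegree_hermiteReal _)
      fun _ => hermiteReal_monic _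
  have hdet : ∀ z : Fin k → ℝ, (∏ i : Fin k, (hermiteReal i).eval (z i)) * vandermondeProd z
      = (Matrix.of fun i j : Fin k => (hermiteReal i).eval (z i) * (hermiteReal j).eval (z i)).det := by
    intro z
    rw [hh, ← Matrix.det_mul_column]
    rfl
  have hE := expMoments_gaussianReal 1
  have h2 : ∀ z : Fin k → ℝ, ((∏ i : Fin k, (hermiteReal i).eval (z i) : ℝ) : ℂ) * (vandermondeProd z : ℂ)
      = (((Matrix.of fun i j : Fin k => (hermiteReal i).eval (z i) * (hermiteReal j).eval (z i)).det : ℝ) : ℂ) := by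
    intro z
    rw [← hdet]
    push_cast
    rfl
  have hij : ∀ i j : Fin k, Integrable (fun x => (hermiteReal i).eval x * (hermiteReal j).eval x)
      (gaussianReal 0 1) := fun i j => by simpa using hE.integrable_eval (hermiteReal i * hermiteReal j)
  have h1 := integral_det_mul_antisymmetric (gaussianReal 0 1) (fun i : Fin k => fun x => (hermiteReal i).eval x)
    antisymmetric_vandermondeProd (by simp_rw [h2]; exact (integrable_det_pi _ hij).ofReal)
  simp_rw [← hh] at h1
  rw [h1]
  congr 1
  simp_rw [h2]
  rw [integral_complex_ofReal, integral_det_pi (fun _ : Fin k => gaussianReal 0 1) hij]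
  have h3 : (Matrix.of fun i j : Fin k => ∫ x, (hermiteReal i).eval x * (hermiteReal j).eval x ∂gaussianReal 0 1)
      = Matrix.diagonal fun j : Fin k => ((j : ℕ).factorial : ℝ) := by
    ext i j
    rw [Matrix.of_apply, integral_hermite_mul_hermite, Matrix.diagonal_apply]
    simp only [Fin.ext_iff]
    split_ifs with h
    · rw [h]
    · rfl
  rw [h3, Matrix.det_diagonal, Fin.prod_univ_eq_prod_range (fun j => (j.factorial : ℝ)) k]
  push_cast
  rfl

end GaussianVandermonde

/-! ### Integrals over the chamber -/

section Chamber

variable {k : ℕ}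

theorem measurableSet_strictMono : MeasurableSet {x : Fin k → ℝ | StrictMono x} := by
  have : {x : Fin k → ℝ | StrictMono x} = ⋂ (a : Fin k) (b : Fin k) (_ : a < b), {x | x a < x b} := by
    ext x
    simp [StrictMono]
  rw [this]
  exact MeasurableSet.iInter fun a => MeasurableSet.iInter fun b => MeasurableSet.iInter fun _ =>
    measurableSet_lt (measurable_pi_apply a) (measurable_pi_apply b)

theorem ae_injective : ∀ᵐ x : Fin k → ℝ, Function.Injective x := by
  have h : ∀ a b : Fin k, a ≠ b → ∀ᵐ x : Fin k → ℝ, x a ≠ x b := by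
    intro a b hab
    set L : (Fin k → ℝ) →ₗ[ℝ] ℝ :=
      (LinearMap.proj a : (Fin k → ℝ) →ₗ[ℝ] ℝ) - (LinearMap.proj b : (Fin k → ℝ) →ₗ[ℝ] ℝ) with hL
    have hne : L.ker ≠ ⊤ := by
      intro htop
      have h1 : (Pi.single a 1 : Fin k → ℝ) ∈ L.ker := by rw [htop]; trivial
      rw [LinearMap.mem_ker] at h1
      simp [hL, hab.symm] at h1
    have h0 := Measure.addHaar_submodule (volume : Measure (Fin k → ℝ)) L.ker hne
    refine measure_mono_null (fun x hx => ?_) h0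
    have h2 : x a = x b := not_not.1 hx
    simp [hL, h2]
  have h2 : ∀ᵐ x : Fin k → ℝ, ∀ a b, a ≠ b → x a ≠ x b := by
    rw [ae_all_iff]
    intro a
    rw [ae_all_iff]
    intro b
    by_cases hab : a = b
    · exact ae_of_all _ fun x h => absurd hab h
    · filter_upwards [h a b hab] with x hx _ using hx
  filter_upwards [h2] with x hx a b hab
  by_contra hne
  exact hx a b hne hab

theorem strictMono_comp_sort {x : Fin k → ℝ} (hx : Function.Injective x) :
    StrictMono (x ∘ Tuple.sort x) :=
  (Tuple.monotone_sort x).strictMono_of_injective (hx.comp (Equiv.injective _))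

/-- Almost every point is obtained from a point of the chamber by exactly one permutation of the
coordinates. -/
theorem integral_eq_sum_integral_chamber {g : (Fin k → ℝ) → ℂ} (hg : Integrable g) :
    ∫ y, g y = ∑ σ : Equiv.Perm (Fin k), ∫ y in {y | StrictMono y}, g (y ∘ σ) := by
  have hmp : ∀ σ : Equiv.Perm (Fin k), MeasurePreserving (fun x : Fin k → ℝ => x ∘ σ) :=
    fun σ => measurePreserving_comp_perm volume σ
  set S : Equiv.Perm (Fin k) → Set (Fin k → ℝ) := fun σ => {y | StrictMono (y ∘ σ.symm)} with hS
  have hSm : ∀ σ, MeasurableSet (S σ) := fun σ => (hmp σ.symm).measurable measurableSet_strictMono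
  have hdisj : Pairwise (Function.onFun Disjoint S) := by
    intro σ τ hne
    refine Set.disjoint_left.2 fun y h1 h2 => hne ?_
    have h1' : StrictMono (y ∘ σ.symm) := h1
    have h2' : StrictMono (y ∘ τ.symm) := h2
    have hinj : Function.Injective y := by
      have := h1'.injective.comp σ.injective
      rwa [Function.comp_assoc, Equiv.symm_comp_self, Function.comp_id] at this
    have e : y ∘ σ.symm = y ∘ τ.symm := by
      rw [← sortVec_of_strictMono h1', ← sortVec_of_strictMono h2', sortVec_comp_perm, sortVec_comp_perm]
    have h3 : σ.symm = τ.symm := Equiv.ext fun i => hinj (congrFun e i)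
    exact Equiv.symm_bijective.injective h3
  have huniv : (⋃ σ, S σ : Set (Fin k → ℝ)) =ᵐ[volume] Set.univ := by
    filter_upwards [ae_injective] with y hy
    refine propext ?_
    change y ∈ ⋃ σ, S σ ↔ y ∈ Set.univ
    simp only [Set.mem_iUnion, Set.mem_univ, iff_true]
    exact ⟨(Tuple.sort y).symm, strictMono_comp_sort hy⟩
  rw [← setIntegral_univ, ← setIntegral_congr_set huniv,
    integral_iUnion_fintype hSm hdisj fun σ => hg.integrableOn]
  refine Finset.sum_congr rfl fun σ _ => ?_
  have h1 := (hmp σ).setIntegral_preimage_emb (measurableEmbedding_comp_perm σ) g (S σ)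
  rw [← h1]
  have h2 : (fun x : Fin k → ℝ => x ∘ σ) ⁻¹' S σ = {y | StrictMono y} := by
    ext y
    simp only [hS, Set.mem_preimage, Set.mem_ofPred_eq, Function.comp_assoc, Equiv.self_comp_symm,
      Function.comp_id]
  rw [h2]

theorem integral_eq_factorial_mul_chamber {g : (Fin k → ℝ) → ℂ} (hg : Integrable g)
    (hsymm : ∀ (x : Fin k → ℝ) (σ : Equiv.Perm (Fin k)), g (x ∘ σ) = g x) :
    ∫ y, g y = k.factorial * ∫ y in {y | StrictMono y}, g y := by
  rw [integral_eq_sum_integral_chamber hg]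
  simp_rw [hsymm]
  simp [Finset.card_univ, Fintype.card_perm]

theorem pi_gaussianReal_eq {v : ℝ≥0} (hv : v ≠ 0) :
    (Measure.pi fun _ : Fin k => gaussianReal 0 v)
      = volume.withDensity fun y => ∏ i, gaussianPDF 0 v (y i) := by
  have h : SigmaFinite ((volume : Measure ℝ).withDensity (gaussianPDF 0 v)) := by
    rw [← gaussianReal_of_var_ne_zero 0 hv]
    infer_instance
  rw [gaussianReal_of_var_ne_zero 0 hv]
  exact pi_withDensity (fun _ : Fin k => volume) (f := fun _ => gaussianPDF 0 v)
    fun _ => measurable_gaussianPDF 0 v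

theorem measurable_prod_gaussianPDF (v : ℝ≥0) :
    Measurable fun y : Fin k → ℝ => ∏ i, gaussianPDF 0 v (y i) :=
  Finset.measurable_prod _ fun i _ => (measurable_gaussianPDF 0 v).comp (measurable_pi_apply i)

theorem integrable_pi_gaussianReal_iff {v : ℝ≥0} (hv : v ≠ 0) (g : (Fin k → ℝ) → ℂ) :
    Integrable g (Measure.pi fun _ : Fin k => gaussianReal 0 v)
      ↔ Integrable fun y => ((∏ i, gaussianPDFReal 0 v (y i) : ℝ) : ℂ) * g y := by
  rw [pi_gaussianReal_eq hv, integrable_withDensity_iff_integrable_smul'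
    (measurable_prod_gaussianPDF v) (ae_of_all _ fun y => ENNReal.prod_lt_top fun i _ => gaussianPDF_lt_top)]
  simp_rw [ENNReal.toReal_prod, toReal_gaussianPDF, Complex.real_smul]

theorem integral_pi_gaussianReal {v : ℝ≥0} (hv : v ≠ 0) (g : (Fin k → ℝ) → ℂ) :
    ∫ y, g y ∂(Measure.pi fun _ : Fin k => gaussianReal 0 v)
      = ∫ y, ((∏ i, gaussianPDFReal 0 v (y i) : ℝ) : ℂ) * g y := by
  rw [pi_gaussianReal_eq hv, integral_withDensity_eq_integral_toReal_smul
    (measurable_prod_gaussianPDF v) (ae_of_all _ fun y => ENNReal.prod_lt_top fun i _ => gaussianPDF_lt_top)]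
  simp_rw [ENNReal.toReal_prod, toReal_gaussianPDF, Complex.real_smul]

/-- Transition density of Brownian motion killed on leaving the chamber. -/
noncomputable def gaussianDet (v : ℝ≥0) (x y : Fin k → ℝ) : ℝ :=
  (Matrix.of fun i j => gaussianPDFReal 0 v (y i - x j)).det

theorem measurable_gaussianDet (v : ℝ≥0) :
    Measurable fun p : (Fin k → ℝ) × (Fin k → ℝ) => gaussianDet v p.1 p.2 := by
  unfold gaussianDet
  simp_rw [Matrix.det_apply']
  refine Finset.measurable_sum _ fun σ _ => Measurable.const_mul
    (f := fun p : (Fin k → ℝ) × (Fin k → ℝ) => ∏ i, gaussianPDFReal 0 v (p.2 (σ i) - p.1 i)) ?_ _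
  exact Finset.measurable_prod _ fun i _ => (measurable_gaussianPDFReal 0 v).comp (by fun_prop)

/-- Independent Brownian motions and Brownian motions killed on leaving the chamber have the same
averages of antisymmetric functions. -/
theorem integral_chamber_gaussianDet_mul {v : ℝ≥0} (hv : v ≠ 0) {u : (Fin k → ℝ) → ℂ}
    (hu : Antisymmetric u) (hg : ExpGrowth u) (x : Fin k → ℝ) :
    IntegrableOn (fun y => (gaussianDet v x y : ℂ) * u y) {y | StrictMono y} ∧
    ∫ y in {y | StrictMono y}, (gaussianDet v x y : ℂ) * u y = stepAvg (gaussianReal 0 v) u x := by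
  set q : (Fin k → ℝ) → ℂ := fun y => ((∏ i, gaussianPDFReal 0 v (y i - x i) : ℝ) : ℂ) * u y with hq
  have hmp : MeasurePreserving (fun z : Fin k → ℝ => x + z) := measurePreserving_add_left volume x
  have hemb : MeasurableEmbedding (fun z : Fin k → ℝ => x + z) := measurableEmbedding_addLeft x
  have hqx : ∀ z, q (x + z) = ((∏ i, gaussianPDFReal 0 v (z i) : ℝ) : ℂ) * u (x + z) := by
    intro z
    simp [hq]
  have hqi : Integrable q := by
    rw [← hmp.integrable_comp_emb hemb]
    refine ((integrable_pi_gaussianReal_iff hv _).1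
      (hg.integrable_add (expMoments_gaussianReal v) x)).congr (ae_of_all _ fun z => (hqx z).symm)
  have hqI : stepAvg (gaussianReal 0 v) u x = ∫ y, q y := by
    rw [stepAvg, integral_pi_gaussianReal hv, ← hmp.integral_comp hemb q]
    simp_rw [hqx]
  have hqσ : ∀ (σ : Equiv.Perm (Fin k)) y, q (y ∘ σ)
      = (((Equiv.Perm.sign σ : ℤ) * ∏ i, gaussianPDFReal 0 v (y (σ i) - x i) : ℝ) : ℂ) * u y := by
    intro σ y
    simp only [hq, hu y σ, Function.comp_apply]
    push_cast
    ring
  have hdet : ∀ y, (gaussianDet v x y : ℂ) * u y = ∑ σ : Equiv.Perm (Fin k), q (y ∘ σ) := by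
    intro y
    simp_rw [hqσ]
    rw [← Finset.sum_mul, ← Complex.ofReal_sum, gaussianDet, Matrix.det_apply']
    rfl
  have hint : ∀ σ : Equiv.Perm (Fin k), IntegrableOn (fun y => q (y ∘ σ)) {y | StrictMono y} :=
    fun σ => (((measurePreserving_comp_perm (volume : Measure ℝ) σ).integrable_comp_emb
      (measurableEmbedding_comp_perm σ)).2 hqi).integrableOn
  simp_rw [hdet]
  refine ⟨integrable_finsetSum _ fun σ _ => hint σ, ?_⟩
  rw [integral_finsetSum _ fun σ _ => hint σ, hqI, integral_eq_sum_integral_chamber hqi]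

end Chamber

/-! ### Chains of killed transition densities -/

section Chains

variable {k : ℕ}

/-- Lebesgue measure on the chamber. -/
noncomputable def chamberVol (k : ℕ) : Measure (Fin k → ℝ) := volume.restrict {x | StrictMono x}

instance : SigmaFinite (chamberVol k) := by
  unfold chamberVol
  infer_instance

theorem ae_chamberVol : ∀ᵐ x ∂chamberVol k, StrictMono x := ae_restrict_mem measurableSet_strictMono

theorem setOf_forall_strictMono_eq_pi (m : ℕ) :
    {y : Fin m → Fin k → ℝ | ∀ l, StrictMono (y l)} = Set.univ.pi fun _ => {x | StrictMono x} := by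
  ext y
  simp [Set.mem_pi]

theorem measurableSet_forall_strictMono (m : ℕ) :
    MeasurableSet {y : Fin m → Fin k → ℝ | ∀ l, StrictMono (y l)} := by
  rw [setOf_forall_strictMono_eq_pi]
  exact MeasurableSet.univ_pi fun _ => measurableSet_strictMono

theorem restrict_forall_strictMono (m : ℕ) :
    (volume : Measure (Fin m → Fin k → ℝ)).restrict {y | ∀ l, StrictMono (y l)}
      = Measure.pi fun _ => chamberVol k := by
  rw [setOf_forall_strictMono_eq_pi, volume_pi, Measure.restrict_pi_pi]
  rfl

theorem ae_pi_chamberVol (m : ℕ) :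
    ∀ᵐ y ∂Measure.pi fun _ : Fin m => chamberVol k, ∀ l, StrictMono (y l) := by
  rw [← restrict_forall_strictMono]
  exact ae_restrict_mem (measurableSet_forall_strictMono m)

theorem gaussianDet_nonneg (v : ℝ≥0) {x y : Fin k → ℝ} (hx : StrictMono x) (hy : StrictMono y) :
    0 ≤ gaussianDet v x y := det_gaussianPDFReal_nonneg v hx.monotone hy.monotone

/-- Density of `n` successive positions of killed Brownian motion started at `x`, multiplied by the
Vandermonde product of the last position. -/
noncomputable def detChain : (n : ℕ) → (Fin n → ℝ≥0) → (Fin k → ℝ) → (Fin n → Fin k → ℝ) → ℝ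
  | 0, _ => fun x _ => vandermondeProd x
  | n + 1, v => fun x y => gaussianDet (v 0) x (y 0) * detChain n (Fin.tail v) (y 0) (Fin.tail y)

theorem measurable_detChain {n : ℕ} (v : Fin n → ℝ≥0) :
    Measurable fun p : (Fin k → ℝ) × (Fin n → Fin k → ℝ) => detChain n v p.1 p.2 := by
  induction n with
  | zero => exact measurable_vandermondeProd.comp measurable_fst
  | succ n ih =>
    have h0 : Measurable fun p : (Fin k → ℝ) × (Fin (n + 1) → Fin k → ℝ) => p.2 0 := by fun_prop
    have ht : Measurable fun p : (Fin k → ℝ) × (Fin (n + 1) → Fin k → ℝ) => Fin.tail p.2 := by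
      unfold Fin.tail
      fun_prop
    exact ((measurable_gaussianDet (v 0)).comp (measurable_fst.prodMk h0)).mul
      ((ih (Fin.tail v)).comp (h0.prodMk ht))

theorem measurable_detChain_right {n : ℕ} (v : Fin n → ℝ≥0) (x : Fin k → ℝ) :
    Measurable (detChain n v x) :=
  (measurable_detChain v).comp (measurable_const.prodMk measurable_id)

theorem detChain_nonneg {n : ℕ} (v : Fin n → ℝ≥0) {x : Fin k → ℝ} (hx : StrictMono x)
    {y : Fin n → Fin k → ℝ} (hy : ∀ l, StrictMono (y l)) : 0 ≤ detChain n v x y := by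
  induction n generalizing x with
  | zero => exact (vandermondeProd_pos hx).le
  | succ n ih =>
    exact mul_nonneg (gaussianDet_nonneg _ hx (hy 0)) (ih (Fin.tail v) (hy 0) fun l => hy l.succ)

/-- The Vandermonde product is harmonic for Brownian motion killed on leaving the chamber. -/
theorem lintegral_chamberVol_gaussianDet_mul_vandermondeProd {v : ℝ≥0} (hv : v ≠ 0) {x : Fin k → ℝ}
    (hx : StrictMono x) :
    ∫⁻ y, ENNReal.ofReal (gaussianDet v x y * vandermondeProd y) ∂chamberVol k
      = ENNReal.ofReal (vandermondeProd x) := by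
  obtain ⟨h1, h2⟩ := integral_chamber_gaussianDet_mul hv antisymmetric_vandermondeProd
    expGrowth_vandermondeProd x
  rw [stepAvg_vandermondeProd (expMoments_gaussianReal v)] at h2
  simp_rw [← Complex.ofReal_mul] at h1 h2
  rw [integral_complex_ofReal] at h2
  have h3 : Integrable (fun y => gaussianDet v x y * vandermondeProd y) (chamberVol k) := by
    have := h1.re
    simp only [RCLike.re_eq_complex_re, Complex.ofReal_re] at this
    exact this
  have h4 : 0 ≤ᵐ[chamberVol k] fun y => gaussianDet v x y * vandermondeProd y := by
    filter_upwards [ae_chamberVol] with y hy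
    exact mul_nonneg (gaussianDet_nonneg v hx hy) (vandermondeProd_pos hy).le
  rw [← ofReal_integral_eq_lintegral_ofReal h3 h4, ← Complex.ofReal_injective h2]
  rfl

theorem lintegral_detChain {n : ℕ} {v : Fin n → ℝ≥0} (hv : ∀ l, v l ≠ 0) {x : Fin k → ℝ}
    (hx : StrictMono x) :
    ∫⁻ y, ENNReal.ofReal (detChain n v x y) ∂Measure.pi (fun _ => chamberVol k)
      = ENNReal.ofReal (vandermondeProd x) := by
  induction n generalizing x with
  | zero => simp [detChain]
  | succ n ih =>
    have hmp := measurePreserving_finCons fun _ : Fin (n + 1) => chamberVol k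
    have hm : Measurable fun y => ENNReal.ofReal (detChain (n + 1) v x y) :=
      (measurable_detChain_right v x).ennreal_ofReal
    rw [← hmp.lintegral_comp hm, lintegral_prod (fun p : (Fin k → ℝ) × (Fin n → Fin k → ℝ) =>
        ENNReal.ofReal (detChain (n + 1) v x (Fin.cons p.1 p.2))) (hm.comp measurable_finCons).aemeasurable,
      ← lintegral_chamberVol_gaussianDet_mul_vandermondeProd (hv 0) hx]
    refine lintegral_congr_ae ?_
    filter_upwards [ae_chamberVol] with z hz
    have hd := gaussianDet_nonneg (v 0) hx hz
    simp only [detChain, Fin.cons_zero, Fin.tail_cons]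
    simp_rw [ENNReal.ofReal_mul hd]
    rw [lintegral_const_mul _
      (measurable_detChain_right (Fin.tail v) z).ennreal_ofReal,
      ih (v := Fin.tail v) (fun l => hv l.succ) hz]

theorem integrable_detChain {n : ℕ} {v : Fin n → ℝ≥0} (hv : ∀ l, v l ≠ 0) {x : Fin k → ℝ}
    (hx : StrictMono x) :
    Integrable (detChain n v x) (Measure.pi fun _ => chamberVol k) := by
  refine (lintegral_ofReal_ne_top_iff_integrable
    (measurable_detChain_right v x).aestronglyMeasurable ?_).1 ?_
  · filter_upwards [ae_pi_chamberVol n] with y hy using detChain_nonneg v hx hy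
  · rw [lintegral_detChain hv hx]
    exact ENNReal.ofReal_ne_top

theorem measurable_prod_apply {n : ℕ} {f : Fin n → (Fin k → ℝ) → ℂ} (hf : ∀ l, Measurable (f l)) :
    Measurable fun y : Fin n → Fin k → ℝ => ∏ l, f l (y l) :=
  Finset.measurable_prod _ fun l _ => (hf l).comp (measurable_pi_apply l)

theorem norm_prod_apply_le {n : ℕ} {f : Fin n → (Fin k → ℝ) → ℂ} (hf1 : ∀ l x, ‖f l x‖ ≤ 1)
    (y : Fin n → Fin k → ℝ) : ‖∏ l, f l (y l)‖ ≤ 1 := by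
  rw [norm_prod]
  exact Finset.prod_le_one (fun _ _ => norm_nonneg _) fun l _ => hf1 l _

/-- Chains of killed Brownian transition densities have the same averages as independent Brownian
motions weighted by the Vandermonde product of their endpoint. -/
theorem integral_prod_mul_detChain {n : ℕ} {v : Fin n → ℝ≥0} (hv : ∀ l, v l ≠ 0)
    {f : Fin n → (Fin k → ℝ) → ℂ} (hf : ∀ l, Measurable (f l)) (hf1 : ∀ l x, ‖f l x‖ ≤ 1)
    {x : Fin k → ℝ} (hx : StrictMono x) :
    ∫ y, (∏ l, f l (y l)) * (detChain n v x y : ℂ) ∂Measure.pi (fun _ => chamberVol k)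
      = walkFun n (fun l => gaussianReal 0 (v l)) (fun l x => f l (sortVec x)) x := by
  induction n generalizing x with
  | zero => simp [detChain, walkFun, measureReal_def]
  | succ n ih =>
    have hmp := measurePreserving_finCons fun _ : Fin (n + 1) => chamberVol k
    have hi : Integrable (fun y => (∏ l, f l (y l)) * (detChain (n + 1) v x y : ℂ))
        (Measure.pi fun _ => chamberVol k) :=
      (integrable_detChain hv hx).ofReal.bdd_mul (measurable_prod_apply hf).aestronglyMeasurable
        (ae_of_all _ (norm_prod_apply_le hf1))
    have hi' : Integrable (fun p : (Fin k → ℝ) × (Fin n → Fin k → ℝ) =>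
        (∏ l, f l ((Fin.cons p.1 p.2 : Fin (n + 1) → Fin k → ℝ) l))
          * (detChain (n + 1) v x (Fin.cons p.1 p.2) : ℂ)) _ :=
      (hmp.integrable_comp_emb measurableEmbedding_finCons).2 hi
    have hfs : ∀ l, Measurable fun x => f l (sortVec x) := fun l => (hf l).comp continuous_sortVec.measurable
    have hfg : ∀ l, ExpGrowth fun x : Fin k → ℝ => f l (sortVec x) := fun l =>
      expGrowth_of_norm_le_one (hfs l) fun x => hf1 l _
    have hw := expGrowth_walkFun (ν := fun l : Fin n => gaussianReal 0 (v l.succ))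
      (f := fun (l : Fin n) x => f l.succ (sortVec x))
      (fun l => expMoments_gaussianReal _) fun l => hfg l.succ
    have ha := antisymmetric_walkFun (ν := fun l : Fin n => gaussianReal 0 (v l.succ))
      (f := fun (l : Fin n) (x : Fin k → ℝ) => f l.succ (sortVec x)) fun l x σ => by rw [sortVec_comp_perm]
    have hstep := (integral_chamber_gaussianDet_mul (hv 0)
      (ha.mul_symm (f := fun x => f 0 (sortVec x)) fun x σ => by rw [sortVec_comp_perm])
      ((hfg 0).mul hw) x).2
    rw [← hmp.integral_comp measurableEmbedding_finCons, integral_prod _ hi']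
    refine Eq.trans ?_ hstep
    refine integral_congr_ae ?_
    change ∀ᵐ z ∂chamberVol k, _
    filter_upwards [ae_chamberVol] with z hz
    simp only [Fin.prod_univ_succ, Fin.cons_zero, Fin.cons_succ, detChain, Fin.tail_cons]
    have h1 := ih (v := Fin.tail v) (fun l => hv l.succ) (f := Fin.tail f) (fun l => hf l.succ)
      (fun l => hf1 l.succ) hz
    have h2 : ∀ y : Fin n → Fin k → ℝ, f 0 z * (∏ l : Fin n, f l.succ (y l))
          * ((gaussianDet (v 0) x z * detChain n (Fin.tail v) z y : ℝ) : ℂ)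
        = (gaussianDet (v 0) x z : ℂ) * (f 0 z * ((∏ l : Fin n, Fin.tail f l (y l))
          * (detChain n (Fin.tail v) z y : ℂ))) := by
      intro y
      push_cast
      simp only [Fin.tail]
      ring
    simp_rw [h2]
    rw [integral_const_mul, integral_const_mul, h1, sortVec_of_strictMono hz]
    rfl

/-- The quotients of Vandermonde products in the transition densities telescope. -/
theorem vandermondeProd_mul_prod_dysonTransition {n : ℕ} (v : Fin n → ℝ≥0)
    {y : Fin (n + 1) → Fin k → ℝ} (hy : ∀ l, StrictMono (y l)) :
    vandermondeProd (y 0) * ∏ i : Fin n, dysonTransition (v i) (y i.castSucc) (y i.succ)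
      = detChain n v (y 0) (Fin.tail y) := by
  induction n with
  | zero => simp [detChain]
  | succ n ih =>
    have h1 := ih (Fin.tail v) (y := Fin.tail y) fun l => hy l.succ
    have h2 := (vandermondeProd_pos (hy 0)).ne'
    rw [Fin.prod_univ_succ]
    simp only [detChain]
    have h3 : Fin.tail y 0 = y 1 := rfl
    rw [h3] at h1 ⊢
    rw [← h1]
    have h4 : dysonTransition (v 0) (y (Fin.castSucc 0)) (y (Fin.succ 0))
        = vandermondeProd (y 1) / vandermondeProd (y 0) * gaussianDet (v 0) (y 0) (y 1) := rfl
    rw [h4]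
    have h5 : ∏ i : Fin n, dysonTransition (v i.succ) (y i.succ.castSucc) (y i.succ.succ)
        = ∏ i : Fin n, dysonTransition (Fin.tail v i) (Fin.tail y i.castSucc) (Fin.tail y i.succ) := rfl
    rw [h5]
    field_simp

end Chains

/-! ### The law of Dyson Brownian motion -/

section DysonLaw

variable {k : ℕ}

theorem two_mul_sum_card_Ioi (k : ℕ) : 2 * ∑ i : Fin k, (Finset.Ioi i).card + k = k ^ 2 := by
  simp_rw [Fin.card_Ioi]
  rw [Fin.sum_univ_eq_sum_range (fun i => k - 1 - i) k, Finset.sum_range_reflect (fun i => i) k,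
    mul_comm, Finset.sum_range_id_mul_two]
  cases k with
  | zero => rfl
  | succ k => simp; ring

theorem integral_vandermondeProd_sq (v : ℝ≥0) :
    ∫ z, (vandermondeProd z : ℂ) * (vandermondeProd z : ℂ) ∂(Measure.pi fun _ : Fin k => gaussianReal 0 v)
      = (v : ℂ) ^ (∑ i : Fin k, (Finset.Ioi i).card)
        * (k.factorial * ∏ j ∈ Finset.range k, (j.factorial : ℂ)) := by
  have h1 : gaussianReal 0 v = (gaussianReal 0 1).map fun x => √(v : ℝ) * x := by
    rw [gaussianReal_map_const_mul]
    congr 1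
    · simp
    · ext
      simp
  have hp : IsProbabilityMeasure ((gaussianReal 0 1).map fun x => √(v : ℝ) * x) :=
    Measure.isProbabilityMeasure_map (by fun_prop)
  have h2 : (Measure.pi fun _ : Fin k => gaussianReal 0 v)
      = (Measure.pi fun _ : Fin k => gaussianReal 0 1).map fun z i => √(v : ℝ) * z i := by
    rw [Measure.pi_map_pi (X := fun _ => ℝ) (Y := fun _ => ℝ) (f := fun _ x => √(v : ℝ) * x)
      fun _ => by fun_prop, ← h1]
  have h3 : ∀ z : Fin k → ℝ, vandermondeProd (fun i => √(v : ℝ) * z i)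
      = √(v : ℝ) ^ (∑ i : Fin k, (Finset.Ioi i).card) * vandermondeProd z := fun z => by
    simpa using vandermondeProd_affine (√(v : ℝ)) 0 z
  have hc : Continuous fun z : Fin k → ℝ => (vandermondeProd z : ℂ) :=
    Complex.continuous_ofReal.comp continuous_vandermondeProd
  have h4 : ((√(v : ℝ) : ℝ) : ℂ) * ((√(v : ℝ) : ℝ) : ℂ) = (v : ℂ) := by
    rw [← Complex.ofReal_mul]
    exact congrArg Complex.ofReal (Real.mul_self_sqrt v.2)
  have hmz : Measurable fun (z : Fin k → ℝ) (i : Fin k) => √(v : ℝ) * z i :=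
    measurable_pi_lambda _ fun i => (measurable_pi_apply i).const_mul _
  rw [h2, integral_map (f := fun z => (vandermondeProd z : ℂ) * (vandermondeProd z : ℂ)) hmz.aemeasurable
      (hc.mul hc).aestronglyMeasurable, ← integral_vandermondeProd_sq_standard,
    ← integral_const_mul]
  refine integral_congr_ae (ae_of_all _ fun z => ?_)
  simp only [h3]
  push_cast
  rw [← h4, mul_pow]
  ring

/-- The constant relating the entrance law at time `v` to the Gaussian density of variance `v`. -/
noncomputable def dysonConst (k : ℕ) (v : ℝ≥0) : ℝ :=
  ((v : ℝ) ^ (∑ i : Fin k, (Finset.Ioi i).card) * ∏ j ∈ Finset.range k, (j.factorial : ℝ))⁻¹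

/-- The entrance law has the density `h²` with respect to the Gaussian law, up to normalisation:
the exponent `k² / 2` is half the number of particles plus the degree of `h`. -/
theorem dysonEntrance_eq {v : ℝ≥0} (hv : v ≠ 0) (y : Fin k → ℝ) :
    dysonEntrance v y
      = dysonConst k v * (∏ i, gaussianPDFReal 0 v (y i)) * vandermondeProd y * vandermondeProd y := by
  have hv0 : (0 : ℝ) < v := by exact_mod_cast pos_iff_ne_zero.2 hv
  have h1 : ∏ i, gaussianPDFReal 0 v (y i)
      = (2 * Real.pi) ^ (-((k : ℝ) / 2)) * (v : ℝ) ^ (-((k : ℝ) / 2))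
        * Real.exp (-∑ i, y i ^ 2 / (2 * (v : ℝ))) := by
    simp only [gaussianPDFReal, sub_zero]
    rw [Finset.prod_mul_distrib, ← Real.exp_sum, Finset.prod_const, Finset.card_univ, Fintype.card_fin,
      ← Real.mul_rpow (by positivity) hv0.le, Real.sqrt_eq_rpow, ← Real.rpow_neg (by positivity),
      ← Real.rpow_natCast, ← Real.rpow_mul (by positivity), ← Finset.sum_neg_distrib]
    congr 2
    · ring
    · exact Finset.sum_congr rfl fun i _ => by ring
  have h2 : (v : ℝ) ^ (-((k : ℝ) ^ 2 / 2))
      = ((v : ℝ) ^ (∑ i : Fin k, (Finset.Ioi i).card))⁻¹ * (v : ℝ) ^ (-((k : ℝ) / 2)) := by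
    rw [← Real.rpow_natCast (v : ℝ), ← Real.rpow_neg hv0.le, ← Real.rpow_add hv0]
    congr 1
    have : (2 : ℝ) * (∑ i : Fin k, (Finset.Ioi i).card : ℕ) + k = (k : ℝ) ^ 2 := by
      exact_mod_cast two_mul_sum_card_Ioi k
    linarith
  rw [dysonEntrance, h1, h2, dysonConst, Real.rpow_neg (show 0 ≤ 2 * Real.pi by positivity) ((k : ℝ) / 2), mul_inv, mul_inv]
  ring

/-- The first time and the increments of a sequence of times. -/
def timeSteps {n : ℕ} (t : Fin (n + 1) → ℝ≥0) : Fin (n + 1) → ℝ≥0 :=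
  Fin.cons (t 0) fun l => t l.succ - t l.castSucc

theorem timeSteps_ne_zero {n : ℕ} {t : Fin (n + 1) → ℝ≥0} (ht : StrictMono t) (h0 : 0 < t 0)
    (l : Fin (n + 1)) : timeSteps t l ≠ 0 := by
  induction l using Fin.cases with
  | zero => exact h0.ne'
  | succ l => exact (tsub_pos_of_lt (ht Fin.castSucc_lt_succ)).ne'

theorem dysonDensity_eq {n : ℕ} {t : Fin (n + 1) → ℝ≥0} (h0 : 0 < t 0)
    {y : Fin (n + 1) → Fin k → ℝ} (hy : ∀ l, StrictMono (y l)) :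
    dysonDensity k t y = dysonConst k (t 0) * ((∏ i, gaussianPDFReal 0 (t 0) (y 0 i))
      * (vandermondeProd (y 0) * detChain n (Fin.tail (timeSteps t)) (y 0) (Fin.tail y))) := by
  rw [← vandermondeProd_mul_prod_dysonTransition _ hy, dysonDensity, dysonEntrance_eq h0.ne']
  simp only [timeSteps, Fin.tail_cons]
  ring

theorem dysonConst_pos {v : ℝ≥0} (hv : v ≠ 0) : 0 < dysonConst k v := by
  have hv0 : (0 : ℝ) < v := by exact_mod_cast pos_iff_ne_zero.2 hv
  unfold dysonConst
  have : (0 : ℝ) < ∏ j ∈ Finset.range k, (j.factorial : ℝ) :=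
    Finset.prod_pos fun j _ => by exact_mod_cast j.factorial_pos
  positivity

/-- The right-hand side of `dysonDensity_eq`, a measurable function on the whole space. -/
noncomputable def dysonChain {n : ℕ} (t : Fin (n + 1) → ℝ≥0) (y : Fin (n + 1) → Fin k → ℝ) : ℝ :=
  dysonConst k (t 0) * ((∏ i, gaussianPDFReal 0 (t 0) (y 0 i))
      * (vandermondeProd (y 0) * detChain n (Fin.tail (timeSteps t)) (y 0) (Fin.tail y)))

theorem measurable_dysonChain {n : ℕ} (t : Fin (n + 1) → ℝ≥0) :
    Measurable (dysonChain (k := k) t) := by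
  have h0 : Measurable fun y : Fin (n + 1) → Fin k → ℝ => y 0 := measurable_pi_apply 0
  have ht : Measurable fun y : Fin (n + 1) → Fin k → ℝ => Fin.tail y := by
    unfold Fin.tail
    fun_prop
  have h1 : Measurable fun y : Fin (n + 1) → Fin k → ℝ => ∏ i, gaussianPDFReal 0 (t 0) (y 0 i) :=
    Finset.measurable_prod _ fun i _ => (measurable_gaussianPDFReal 0 (t 0)).comp (by fun_prop)
  exact (h1.mul ((measurable_vandermondeProd.comp h0).mul
    ((measurable_detChain (Fin.tail (timeSteps t))).comp (h0.prodMk ht)))).const_mul _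

theorem dysonLaw_eq {n : ℕ} {t : Fin (n + 1) → ℝ≥0} (h0 : 0 < t 0) :
    dysonLaw k t = (Measure.pi fun _ => chamberVol k).withDensity fun y => ENNReal.ofReal (dysonChain t y) := by
  rw [dysonLaw, restrict_forall_strictMono]
  refine withDensity_congr_ae ?_
  filter_upwards [ae_pi_chamberVol (n + 1)] with y hy
  rw [dysonDensity_eq h0 hy, dysonChain]

theorem prod_gaussianPDFReal_nonneg (v : ℝ≥0) (y : Fin k → ℝ) : 0 ≤ ∏ i, gaussianPDFReal 0 v (y i) :=
  Finset.prod_nonneg fun _ _ => gaussianPDFReal_nonneg _ _ _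

theorem dysonChain_nonneg {n : ℕ} {t : Fin (n + 1) → ℝ≥0} (h0 : 0 < t 0)
    {y : Fin (n + 1) → Fin k → ℝ} (hy : ∀ l, StrictMono (y l)) : 0 ≤ dysonChain t y :=
  mul_nonneg (dysonConst_pos h0.ne').le (mul_nonneg (prod_gaussianPDFReal_nonneg _ _)
    (mul_nonneg (vandermondeProd_pos (hy 0)).le (detChain_nonneg _ (hy 0) fun l => hy l.succ)))

/-- On symmetric integrands, integrals over the chamber against the Gaussian density are Gaussian
expectations. -/
theorem integral_chamberVol_gaussian {v : ℝ≥0} (hv : v ≠ 0) {u : (Fin k → ℝ) → ℂ} (hu : ExpGrowth u)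
    (hsymm : ∀ (x : Fin k → ℝ) (σ : Equiv.Perm (Fin k)), u (x ∘ σ) = u x) :
    Integrable (fun y => ((∏ i, gaussianPDFReal 0 v (y i) : ℝ) : ℂ) * u y) (chamberVol k) ∧
    ∫ y, ((∏ i, gaussianPDFReal 0 v (y i) : ℝ) : ℂ) * u y ∂chamberVol k
      = (k.factorial : ℂ)⁻¹ * ∫ y, u y ∂(Measure.pi fun _ : Fin k => gaussianReal 0 v) := by
  have h1 : Integrable u (Measure.pi fun _ : Fin k => gaussianReal 0 v) := by
    simpa using hu.integrable_add (expMoments_gaussianReal v) 0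
  have h2 := (integrable_pi_gaussianReal_iff hv u).1 h1
  have hf : (k.factorial : ℂ) ≠ 0 := by exact_mod_cast k.factorial_ne_zero
  refine ⟨h2.integrableOn, ?_⟩
  rw [integral_pi_gaussianReal hv, integral_eq_factorial_mul_chamber h2 fun x σ => ?_,
    inv_mul_cancel_left₀ hf]
  · rfl
  · rw [hsymm]
    congr 2
    exact Equiv.prod_comp σ fun i => gaussianPDFReal 0 v (x i)

/-- Harmonicity of `h` integrates out all times but the first, at which `∫ h²` is the normalising
constant. -/
theorem lintegral_dysonChain {n : ℕ} {t : Fin (n + 1) → ℝ≥0} (ht : StrictMono t) (h0 : 0 < t 0) :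
    ∫⁻ y, ENNReal.ofReal (dysonChain t y) ∂Measure.pi (fun _ => chamberVol k) = 1 := by
  have hmp := measurePreserving_finCons fun _ : Fin (n + 1) => chamberVol k
  have hm : Measurable fun y => ENNReal.ofReal (dysonChain (k := k) t y) :=
    (measurable_dysonChain t).ennreal_ofReal
  obtain ⟨h1, h2⟩ := integral_chamberVol_gaussian h0.ne'
    (expGrowth_vandermondeProd.mul (k := k) expGrowth_vandermondeProd) fun x σ => by
      have := antisymmetric_vandermondeProd x σ
      simp only at this
      rw [this]
      have hs : ((Equiv.Perm.sign σ : ℤ) : ℂ) * ((Equiv.Perm.sign σ : ℤ) : ℂ) = 1 := by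
        rw [← Int.cast_mul, ← Units.val_mul, Int.units_mul_self]
        simp
      linear_combination (vandermondeProd x : ℂ) * (vandermondeProd x : ℂ) * hs
  rw [integral_vandermondeProd_sq] at h2
  simp_rw [← Complex.ofReal_mul] at h1 h2
  rw [integral_complex_ofReal] at h2
  have h3 : Integrable (fun y => (∏ i, gaussianPDFReal 0 (t 0) (y i)) * (vandermondeProd y * vandermondeProd y))
      (chamberVol k) := by
    have := h1.re
    simp only [RCLike.re_eq_complex_re, Complex.ofReal_re] at this
    exact this
  have h4 : ∫ y, dysonConst k (t 0) * ((∏ i, gaussianPDFReal 0 (t 0) (y i)) * (vandermondeProd y * vandermondeProd y))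
      ∂chamberVol k = 1 := by
    rw [integral_const_mul]
    apply Complex.ofReal_injective
    rw [Complex.ofReal_mul, h2, dysonConst]
    have hf : (k.factorial : ℂ) ≠ 0 := by exact_mod_cast k.factorial_ne_zero
    have hp : (∏ j ∈ Finset.range k, (j.factorial : ℂ)) ≠ 0 :=
      Finset.prod_ne_zero_iff.2 fun j _ => by exact_mod_cast j.factorial_ne_zero
    have hv : (t 0 : ℂ) ≠ 0 := by exact_mod_cast h0.ne'
    push_cast
    field_simp
  rw [← hmp.lintegral_comp hm, lintegral_prod (fun p : (Fin k → ℝ) × (Fin n → Fin k → ℝ) =>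
      ENNReal.ofReal (dysonChain t (Fin.cons p.1 p.2))) (hm.comp measurable_finCons).aemeasurable]
  have h5 : 0 ≤ᵐ[chamberVol k] fun y => dysonConst k (t 0)
      * ((∏ i, gaussianPDFReal 0 (t 0) (y i)) * (vandermondeProd y * vandermondeProd y)) :=
    ae_of_all _ fun y => mul_nonneg (dysonConst_pos h0.ne').le
      (mul_nonneg (prod_gaussianPDFReal_nonneg _ _) (mul_self_nonneg _))
  rw [← ENNReal.ofReal_one, ← h4, ofReal_integral_eq_lintegral_ofReal (h3.const_mul _) h5]
  refine lintegral_congr_ae ?_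
  filter_upwards [ae_chamberVol] with z hz
  have h6 := dysonConst_pos (k := k) h0.ne'
  have h7 := prod_gaussianPDFReal_nonneg (t 0) z
  have h8 := vandermondeProd_pos hz
  simp only [dysonChain, Fin.cons_zero, Fin.tail_cons]
  simp_rw [ENNReal.ofReal_mul h6.le, ENNReal.ofReal_mul h7, ENNReal.ofReal_mul h8.le]
  have h9 := (measurable_detChain_right (Fin.tail (timeSteps t)) z).ennreal_ofReal
  rw [lintegral_const_mul _ (by fun_prop), lintegral_const_mul _ (by fun_prop), lintegral_const_mul _ h9,
    lintegral_detChain (v := Fin.tail (timeSteps t)) (fun l => timeSteps_ne_zero ht h0 l.succ) hz]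

theorem isProbabilityMeasure_dysonLaw_succ {n : ℕ} {t : Fin (n + 1) → ℝ≥0} (ht : StrictMono t)
    (h0 : 0 < t 0) : IsProbabilityMeasure (dysonLaw k t) :=
  ⟨by rw [dysonLaw_eq h0, withDensity_apply _ MeasurableSet.univ, Measure.restrict_univ,
    lintegral_dysonChain ht h0]⟩

/-- Expectations for Dyson Brownian motion are proportional to weighted means of independent
Brownian motions. -/
theorem integral_prod_dysonLaw {n : ℕ} {t : Fin (n + 1) → ℝ≥0} (ht : StrictMono t) (h0 : 0 < t 0)
    {f : Fin (n + 1) → (Fin k → ℝ) → ℂ} (hf : ∀ l, Measurable (f l)) (hf1 : ∀ l x, ‖f l x‖ ≤ 1) :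
    ∫ y, ∏ l, f l (y l) ∂dysonLaw k t = (dysonConst k (t 0) / k.factorial : ℝ)
      * weightedMean (fun l => gaussianReal 0 (timeSteps t l)) fun l x => f l (sortVec x) := by
  have hmp := measurePreserving_finCons fun _ : Fin (n + 1) => chamberVol k
  have hm := measurable_dysonChain (k := k) t
  have hnn : ∀ᵐ y ∂Measure.pi fun _ : Fin (n + 1) => chamberVol k, 0 ≤ dysonChain t y := by
    filter_upwards [ae_pi_chamberVol (n + 1)] with y hy using dysonChain_nonneg h0 hy
  have hci : Integrable (dysonChain t) (Measure.pi fun _ : Fin (n + 1) => chamberVol k) := by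
    refine (lintegral_ofReal_ne_top_iff_integrable hm.aestronglyMeasurable hnn).1 ?_
    rw [lintegral_dysonChain ht h0]
    exact ENNReal.one_ne_top
  have hi : Integrable (fun y => (∏ l, f l (y l)) * (dysonChain t y : ℂ))
      (Measure.pi fun _ => chamberVol k) :=
    hci.ofReal.bdd_mul (measurable_prod_apply hf).aestronglyMeasurable (ae_of_all _ (norm_prod_apply_le hf1))
  have hi' : Integrable (fun p : (Fin k → ℝ) × (Fin n → Fin k → ℝ) =>
      (∏ l, f l ((Fin.cons p.1 p.2 : Fin (n + 1) → Fin k → ℝ) l))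
        * (dysonChain t (Fin.cons p.1 p.2 : Fin (n + 1) → Fin k → ℝ) : ℂ)) _ :=
    (hmp.integrable_comp_emb measurableEmbedding_finCons).2 hi
  have h1 : ∫ y, ∏ l, f l (y l) ∂dysonLaw k t
      = ∫ y, (∏ l, f l (y l)) * (dysonChain t y : ℂ) ∂Measure.pi fun _ => chamberVol k := by
    rw [dysonLaw_eq h0, integral_withDensity_eq_integral_toReal_smul hm.ennreal_ofReal
      (ae_of_all _ fun _ => ENNReal.ofReal_lt_top)]
    refine integral_congr_ae ?_
    filter_upwards [hnn] with y hy
    rw [ENNReal.toReal_ofReal hy, Complex.real_smul, mul_comm]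
  have hfs : ∀ l, Measurable fun x => f l (sortVec x) := fun l => (hf l).comp continuous_sortVec.measurable
  have hfg : ∀ l, ExpGrowth fun x : Fin k → ℝ => f l (sortVec x) := fun l =>
    expGrowth_of_norm_le_one (hfs l) fun x => hf1 l _
  have hw := expGrowth_walkFun (ν := fun l : Fin n => gaussianReal 0 (timeSteps t l.succ))
    (f := fun (l : Fin n) x => f l.succ (sortVec x))
    (fun l => expMoments_gaussianReal _) fun l => hfg l.succ
  have ha := antisymmetric_walkFun (ν := fun l : Fin n => gaussianReal 0 (timeSteps t l.succ))
    (f := fun (l : Fin n) (x : Fin k → ℝ) => f l.succ (sortVec x)) fun l x σ => by rw [sortVec_comp_perm]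
  have h2 := (integral_chamberVol_gaussian h0.ne' (expGrowth_vandermondeProd.mul ((hfg 0).mul hw))
    fun x σ => by
      have e1 := antisymmetric_vandermondeProd x σ
      simp only at e1
      rw [e1, ha x σ, sortVec_comp_perm]
      have hs : ((Equiv.Perm.sign σ : ℤ) : ℂ) * ((Equiv.Perm.sign σ : ℤ) : ℂ) = 1 := by
        rw [← Int.cast_mul, ← Units.val_mul, Int.units_mul_self]
        simp
      linear_combination ((vandermondeProd x : ℂ) * (f 0 (sortVec x) * walkFun n
        (fun l : Fin n => gaussianReal 0 (timeSteps t l.succ)) (fun l x => f l.succ (sortVec x)) x)) * hs).2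
  have h3 : ((dysonConst k (t 0) / k.factorial : ℝ) : ℂ)
      * weightedMean (fun l => gaussianReal 0 (timeSteps t l)) (fun l x => f l (sortVec x))
      = dysonConst k (t 0) * ∫ y, ((∏ i, gaussianPDFReal 0 (t 0) (y i) : ℝ) : ℂ) * ((vandermondeProd y : ℂ)
        * (f 0 (sortVec y) * walkFun n (fun l : Fin n => gaussianReal 0 (timeSteps t l.succ))
          (fun l x => f l.succ (sortVec x)) y)) ∂chamberVol k := by
    rw [h2]
    push_cast
    rw [div_mul_eq_mul_div, mul_div_assoc, div_eq_inv_mul]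
    rfl
  rw [h1, h3, ← hmp.integral_comp measurableEmbedding_finCons, integral_prod _ hi', ← integral_const_mul]
  refine integral_congr_ae ?_
  filter_upwards [ae_chamberVol] with z hz
  have h4 := integral_prod_mul_detChain (v := Fin.tail (timeSteps t)) (fun l => timeSteps_ne_zero ht h0 l.succ)
    (f := Fin.tail f) (fun l => hf l.succ) (fun l => hf1 l.succ) hz
  simp only [Fin.prod_univ_succ, Fin.cons_zero, Fin.cons_succ, dysonChain, Fin.tail_cons]
  have h5 : ∀ y : Fin n → Fin k → ℝ, f 0 z * (∏ l : Fin n, f l.succ (y l))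
        * ((dysonConst k (t 0) * ((∏ i, gaussianPDFReal 0 (t 0) (z i))
          * (vandermondeProd z * detChain n (Fin.tail (timeSteps t)) z y)) : ℝ) : ℂ)
      = (dysonConst k (t 0) * (((∏ i, gaussianPDFReal 0 (t 0) (z i) : ℝ) : ℂ) * (vandermondeProd z * f 0 z)))
        * ((∏ l : Fin n, Fin.tail f l (y l)) * (detChain n (Fin.tail (timeSteps t)) z y : ℂ)) := by
    intro y
    push_cast
    simp only [Fin.tail]
    ring
  simp_rw [h5]
  rw [integral_const_mul, h4, sortVec_of_strictMono hz, mul_assoc, mul_assoc, mul_assoc]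
  rfl

end DysonLaw

/-! ### Convergence along the time grid -/

section GridConvergence

open Topology

variable {k : ℕ} {Ω : Type*} [MeasurableSpace Ω] {P : Measure Ω} [IsProbabilityMeasure P]
  {β : (j : ℕ) → Fin j → ℕ → Ω → ℤ}

/-- The number of steps made by time `t`, when time is accelerated by `N`. -/
noncomputable def gridTime {m : ℕ} (t : Fin m → ℝ≥0) (N : ℕ) (l : Fin m) : ℕ := ⌊(N : ℝ) * t l⌋₊

/-- The positions of the particles of line `k` at the grid times, centred and rescaled. -/
noncomputable def gridLine {m : ℕ} (β : (j : ℕ) → Fin j → ℕ → Ω → ℤ) (k : ℕ) (t : Fin m → ℝ≥0) (N : ℕ)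
    (ω : Ω) (l : Fin m) : Fin k → ℝ :=
  gridPos (1 / √(N : ℝ)) (gridTime t N l) (coinLine β k (gridTime t N l) ω)

omit [IsProbabilityMeasure P] in
theorem IsFairCoins.measurable_gridLine (hβ : IsFairCoins P β) {m : ℕ} (t : Fin m → ℝ≥0) (N : ℕ) :
    Measurable (gridLine β k t N) :=
  measurable_pi_lambda _ fun l => (measurable_of_countable (gridPos (1 / √(N : ℝ)) (gridTime t N l))).comp
    (hβ.measurable_coinLine k _)

theorem monotone_gridTime {m : ℕ} {t : Fin m → ℝ≥0} (ht : Monotone t) (N : ℕ) :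
    Monotone (gridTime t N) := fun a b hab =>
  Nat.floor_le_floor (mul_le_mul_of_nonneg_left (by exact_mod_cast ht hab) (Nat.cast_nonneg N))

theorem tendsto_gridTime_div {m : ℕ} (t : Fin m → ℝ≥0) (l : Fin m) :
    Tendsto (fun N : ℕ => (gridTime t N l : ℝ) / N) atTop (𝓝 (t l)) := by
  have := (tendsto_nat_floor_mul_div_atTop (R := ℝ) (t l).2).comp tendsto_natCast_atTop_atTop
  refine this.congr fun N => ?_
  simp only [Function.comp_apply, gridTime]
  rw [mul_comm]
  rfl

theorem tendsto_walkSteps_div {n : ℕ} {t : Fin (n + 1) → ℝ≥0} (ht : Monotone t) (l : Fin (n + 1)) :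
    Tendsto (fun N : ℕ => (walkSteps k (gridTime t N) l : ℝ) / N) atTop (𝓝 (timeSteps t l)) := by
  induction l using Fin.cases with
  | zero =>
    have h1 := (tendsto_gridTime_div t 0).add (tendsto_const_div_atTop_nhds_zero_nat ((k - 1 : ℕ) : ℝ))
    rw [add_zero] at h1
    refine h1.congr fun N => ?_
    simp only [walkSteps, Fin.cons_zero]
    push_cast
    rw [add_div]
  | succ l =>
    have h1 := (tendsto_gridTime_div t l.succ).sub (tendsto_gridTime_div t l.castSucc)
    have h2 : ((timeSteps t l.succ : ℝ≥0) : ℝ) = t l.succ - t l.castSucc :=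
      NNReal.coe_sub (ht Fin.castSucc_lt_succ.le)
    rw [h2]
    refine h1.congr fun N => ?_
    simp only [walkSteps, Fin.cons_succ]
    rw [Nat.cast_sub (monotone_gridTime ht N Fin.castSucc_lt_succ.le), sub_div]

/-- Both sides are ratios of weighted means of independent walks, respectively of independent
Brownian motions, normalised by the value at the test functions `1`. -/
theorem tendsto_integral_prod_gridLine (hβ : IsFairCoins P β) (hk : 1 ≤ k) {n : ℕ}
    {t : Fin (n + 1) → ℝ≥0} (ht : StrictMono t) (h0 : 0 < t 0) {f : Fin (n + 1) → (Fin k → ℝ) → ℂ}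
    (hf : ∀ l, Continuous (f l)) (hf1 : ∀ l x, ‖f l x‖ ≤ 1) :
    Tendsto (fun N : ℕ => ∫ ω, ∏ l, f l (gridLine β k t N ω l) ∂P) atTop
      (𝓝 (∫ y, ∏ l, f l (y l) ∂dysonLaw k t)) := by
  have hprob := isProbabilityMeasure_dysonLaw_succ (k := k) ht h0
  set W : (Fin (n + 1) → (Fin k → ℝ) → ℂ) → ℂ := fun f =>
    weightedMean (fun l => gaussianReal 0 (timeSteps t l)) fun l x => f l (sortVec x) with hW
  set WN : ℕ → (Fin (n + 1) → (Fin k → ℝ) → ℂ) → ℂ := fun N f =>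
    weightedMean (fun l => simpleWalk (1 / √(N : ℝ)) (walkSteps k (gridTime t N) l))
      fun l x => f l (sortVec x) with hWN
  have hlim : ∀ f : Fin (n + 1) → (Fin k → ℝ) → ℂ, (∀ l, Continuous (f l)) → (∀ l x, ‖f l x‖ ≤ 1) →
      Tendsto (fun N => WN N f) atTop (𝓝 (W f)) := fun f hf hf1 =>
    tendsto_weightedMean_simpleWalk (fun l => tendsto_walkSteps_div ht.monotone l)
      (fun l => (hf l).comp continuous_sortVec) fun l x => hf1 l _
  have h1c : ∀ l : Fin (n + 1), Continuous ((fun _ _ => 1 : Fin (n + 1) → (Fin k → ℝ) → ℂ) l) :=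
    fun _ => continuous_const
  have h11 : ∀ (l : Fin (n + 1)) x, ‖(fun _ _ => 1 : Fin (n + 1) → (Fin k → ℝ) → ℂ) l x‖ ≤ 1 := by simp
  have hgauss := integral_prod_dysonLaw ht h0 (fun l => (hf l).measurable) hf1
  have hgauss1 := integral_prod_dysonLaw (k := k) ht h0 (fun l => (h1c l).measurable) h11
  simp only [Finset.prod_const_one, integral_const, probReal_univ, one_smul] at hgauss1
  have hW1 : W (fun _ _ => 1) ≠ 0 := right_ne_zero_of_mul_eq_one hgauss1.symm
  have hlimit : ∫ y, ∏ l, f l (y l) ∂dysonLaw k t = W f / W fun _ _ => 1 := by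
    rw [eq_div_iff hW1, hgauss, mul_right_comm]
    change _ * W (fun _ _ => 1) * W f = W f
    rw [← hgauss1, one_mul]
  rw [hlimit]
  refine ((hlim f hf hf1).div (hlim _ h1c h11) hW1).congr' ?_
  filter_upwards [eventually_ge_atTop 1] with N hN
  have hs : 0 < 1 / √(N : ℝ) := by
    have : (0 : ℝ) < N := by exact_mod_cast hN
    positivity
  obtain ⟨c, hc⟩ := exists_integral_prod_line_eq hβ hk hs (gridTime t N) (monotone_gridTime ht.monotone N)
  have e1 := hc f (fun l => (hf l).measurable) hf1
  have e2 := hc _ (fun l => (h1c l).measurable) h11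
  simp only [Finset.prod_const_one, integral_const, probReal_univ, one_smul] at e2
  have hne : WN N (fun _ _ => 1) ≠ 0 := right_ne_zero_of_mul_eq_one e2.symm
  change WN N f / WN N (fun _ _ => 1) = ∫ ω, ∏ l, f l (gridPos (1 / √(N : ℝ)) (gridTime t N l)
    (coinLine β k (gridTime t N l) ω)) ∂P
  rw [div_eq_iff hne, e1, mul_right_comm]
  change _ = _ * WN N (fun _ _ => 1) * WN N f
  rw [← e2, one_mul]

/-- By Lévy's theorem it suffices to consider characters of the product space, and these are products
of bounded continuous functions of the positions at the single times. -/
theorem tendstoInDistribution_gridLine_succ (hβ : IsFairCoins P β) (hk : 1 ≤ k) {n : ℕ}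
    {t : Fin (n + 1) → ℝ≥0} (ht : StrictMono t) (h0 : 0 < t 0) [IsProbabilityMeasure (dysonLaw k t)] :
    TendstoInDistribution (gridLine β k t) atTop id (fun _ => P) (dysonLaw k t) := by
  set φ : (Fin (n + 1) → Fin k → ℝ) → EuclideanSpace ℝ (Fin (n + 1) × Fin k) :=
    fun y => WithLp.toLp 2 fun p => y p.1 p.2 with hφ
  set ψ : EuclideanSpace ℝ (Fin (n + 1) × Fin k) → (Fin (n + 1) → Fin k → ℝ) :=
    fun x l i => x (l, i) with hψ
  have hφc : Continuous φ := by
    refine (PiLp.continuous_toLp 2 _).comp ?_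
    fun_prop
  have hψc : Continuous ψ := by fun_prop
  have hmZ := fun N => hβ.measurable_gridLine (k := k) t N
  have hm : ∀ N, AEMeasurable (fun ω => φ (gridLine β k t N ω)) P := fun N =>
    (hφc.measurable.comp (hmZ N)).aemeasurable
  have hchar : ∀ (ξ : EuclideanSpace ℝ (Fin (n + 1) × Fin k))
      (y : Fin (n + 1) → Fin k → ℝ), Complex.exp ((inner ℝ (φ y) ξ : ℝ) * Complex.I)
      = ∏ l, Complex.exp (((∑ i, y l i * ξ (l, i) : ℝ) : ℂ) * Complex.I) := by
    intro ξ y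
    rw [← Complex.exp_sum, ← Finset.sum_mul, ← Complex.ofReal_sum, PiLp.inner_apply,
      Fintype.sum_prod_type]
    simp only [hφ, RCLike.inner_apply, conj_trivial]
    congr 4
    funext l
    exact Finset.sum_congr rfl fun i _ => mul_comm _ _
  have hexp : ∀ ξ : EuclideanSpace ℝ (Fin (n + 1) × Fin k),
      Continuous fun x : EuclideanSpace ℝ (Fin (n + 1) × Fin k) => Complex.exp ((inner ℝ x ξ : ℝ) * Complex.I) := by
    intro ξ
    fun_prop
  have key : TendstoInDistribution (fun N ω => φ (gridLine β k t N ω)) atTop φ (fun _ => P)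
      (dysonLaw k t) := by
    refine ⟨hm, hφc.measurable.aemeasurable, ProbabilityMeasure.tendsto_of_tendsto_charFun fun ξ => ?_⟩
    simp only [ProbabilityMeasure.coe_mk, charFun_apply]
    have e1 : ∀ N, ∫ x, Complex.exp ((inner ℝ x ξ : ℝ) * Complex.I) ∂P.map (fun ω => φ (gridLine β k t N ω))
        = ∫ ω, ∏ l, Complex.exp (((∑ i, gridLine β k t N ω l i * ξ (l, i) : ℝ) : ℂ) * Complex.I) ∂P := by
      intro N
      rw [integral_map (hm N) (hexp ξ).aestronglyMeasurable]
      simp_rw [hchar]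
    have e2 : ∫ x, Complex.exp ((inner ℝ x ξ : ℝ) * Complex.I) ∂(dysonLaw k t).map φ
        = ∫ y, ∏ l, Complex.exp (((∑ i, y l i * ξ (l, i) : ℝ) : ℂ) * Complex.I) ∂dysonLaw k t := by
      rw [integral_map hφc.measurable.aemeasurable (hexp ξ).aestronglyMeasurable]
      simp_rw [hchar]
    simp_rw [e1]
    rw [e2]
    exact tendsto_integral_prod_gridLine hβ hk ht h0
      (f := fun l x => Complex.exp (((∑ i, x i * ξ (l, i) : ℝ) : ℂ) * Complex.I))
      (fun l => by fun_prop) fun l x => (Complex.norm_exp_ofReal_mul_I _).le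
  exact key.continuous_comp hψc

end GridConvergence

/-! ### Real times -/

section RealTimes

open Topology

variable {k : ℕ} {Ω : Type*} [MeasurableSpace Ω] {P : Measure Ω} [IsProbabilityMeasure P]
  {β : (j : ℕ) → Fin j → ℕ → Ω → ℤ}

/-- Changing the random variables by `O(1 / √N)` does not affect their limit in distribution. -/
theorem tendstoInDistribution_of_norm_sub_le {E : Type*} [SeminormedAddCommGroup E]
    [SecondCountableTopology E] [MeasurableSpace E] [BorelSpace E] {Ω' : Type*} [MeasurableSpace Ω']
    {P' : Measure Ω'} [IsProbabilityMeasure P'] {X Y : ℕ → Ω → E} {Z : Ω' → E}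
    (hX : TendstoInDistribution X atTop Z (fun _ => P) P') (hY : ∀ N, AEMeasurable (Y N) P) (C : ℝ)
    (h : ∀ N, 1 ≤ N → ∀ᵐ ω ∂P, ‖Y N ω - X N ω‖ ≤ C / √(N : ℝ)) :
    TendstoInDistribution Y atTop Z (fun _ => P) P' := by
  refine tendstoInDistribution_of_tendstoInMeasure_sub Y Z hX ?_ hY
  refine tendstoInMeasure_of_tendsto_ae (fun N =>
    ((hY N).sub (hX.forall_aemeasurable N)).aestronglyMeasurable) ?_
  have h0 : Tendsto (fun N : ℕ => C / √(N : ℝ)) atTop (𝓝 0) :=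
    (Real.tendsto_sqrt_atTop.comp tendsto_natCast_atTop_atTop).const_div_atTop C
  have h' : ∀ᵐ ω ∂P, ∀ N, 1 ≤ N → ‖Y N ω - X N ω‖ ≤ C / √(N : ℝ) := by
    rw [ae_all_iff]
    intro N
    by_cases hN : 1 ≤ N
    · filter_upwards [h N hN] with ω hω _ using hω
    · exact ae_of_all _ fun ω h => absurd h hN
  filter_upwards [h'] with ω hω
  refine squeeze_zero_norm' ?_ h0
  filter_upwards [eventually_ge_atTop 1] with N hN using hω N hN

/-- The rescaled process as a random variable. -/
noncomputable def rescaledCoinLine (β : (j : ℕ) → Fin j → ℕ → Ω → ℤ) (k N : ℕ) (t : ℝ≥0) (ω : Ω) :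
    Fin k → ℝ := rescaledLine (fun j i s => β j i s ω) k N t

omit [MeasurableSpace Ω] in
theorem rescaledCoinLine_apply (β : (j : ℕ) → Fin j → ℕ → Ω → ℤ) (k N : ℕ) (t : ℝ≥0) (ω : Ω) (i : Fin k) :
    rescaledCoinLine β k N t ω i
      = (linInterp (fun n => (coinLine β k n ω i : ℝ)) ((N : ℝ) * t) - (N : ℝ) * t / 2) / (√(N : ℝ) / 2) :=
  rfl

omit [IsProbabilityMeasure P] in
theorem IsFairCoins.measurable_rescaledCoinLine (hβ : IsFairCoins P β) (N : ℕ) (t : ℝ≥0) :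
    Measurable (rescaledCoinLine β k N t) := by
  refine measurable_pi_lambda _ fun i => ?_
  have h : ∀ n, Measurable fun ω => (coinLine β k n ω i : ℝ) := fun n =>
    (measurable_of_countable fun x : ℤ => (x : ℝ)).comp
      ((measurable_pi_apply i).comp (hβ.measurable_coinLine k n))
  simp only [rescaledCoinLine_apply, linInterp]
  exact ((((h _).add (((h _).sub (h _)).const_mul _)).sub_const _).div_const _)

/-- The error consists of the interpolation between two grid times and of the shift by `k + 1` that
centres the initial configuration in `gridPos`. -/
theorem ae_norm_rescaledCoinLine_sub_le (hβ : IsFairCoins P β) (N : ℕ) (hN : 1 ≤ N) (t : ℝ≥0) :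
    ∀ᵐ ω ∂P, ‖rescaledCoinLine β k N t ω
      - gridPos (1 / √(N : ℝ)) ⌊(N : ℝ) * t⌋₊ (coinLine β k ⌊(N : ℝ) * t⌋₊ ω)‖ ≤ (k + 4 : ℝ) / √(N : ℝ) := by
  have hs : 0 < √(N : ℝ) := Real.sqrt_pos.2 (by exact_mod_cast hN)
  filter_upwards [hβ.ae_isStep k ⌊(N : ℝ) * t⌋₊] with ω hω
  refine (pi_norm_le_iff_of_nonneg (by positivity)).2 fun i => ?_
  set r : ℕ := ⌊(N : ℝ) * t⌋₊ with hr
  have hNt : 0 ≤ (N : ℝ) * t := by positivity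
  have h1 : (r : ℝ) ≤ (N : ℝ) * t := Nat.floor_le hNt
  have h2 : (N : ℝ) * t < r + 1 := Nat.lt_floor_add_one _
  set θ : ℝ := (N : ℝ) * t - r with hθ
  set δ : ℝ := (coinLine β k (r + 1) ω i : ℝ) - coinLine β k r ω i with hδ
  have hδ1 : 0 ≤ δ ∧ δ ≤ 1 := by
    rcases hω.1 i with h | h
    · rw [hδ, h]; simp
    · rw [hδ, h]; push_cast; simp
  have e : (rescaledCoinLine β k N t ω - gridPos (1 / √(N : ℝ)) r (coinLine β k r ω)) i
      = (2 * (θ * δ) - θ + (k + 1)) / √(N : ℝ) := by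
    rw [Pi.sub_apply, rescaledCoinLine_apply]
    simp only [linInterp, gridPos]
    rw [← hr, ← hδ, ← hθ]
    field_simp
    rw [hθ]
    ring
  have hθδ : 0 ≤ θ * δ ∧ θ * δ ≤ 1 := by
    have hθ0 : 0 ≤ θ := by linarith
    have hθ1 : θ ≤ 1 := by linarith
    exact ⟨mul_nonneg hθ0 hδ1.1, mul_le_one₀ hθ1 hδ1.1 hδ1.2⟩
  rw [e, Real.norm_eq_abs, abs_div, abs_of_pos hs]
  refine div_le_div_of_nonneg_right ?_ hs.le
  have hk0 : (0 : ℝ) ≤ k := Nat.cast_nonneg k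
  rw [abs_le]
  constructor <;> linarith [hθδ.1, hθδ.2]

theorem isProbabilityMeasure_dysonLaw {m : ℕ} {t : Fin m → ℝ≥0} (ht : StrictMono t) (h0 : ∀ l, 0 < t l) :
    IsProbabilityMeasure (dysonLaw k t) := by
  cases m with
  | zero =>
    refine ⟨?_⟩
    have h1 : {y : Fin 0 → Fin k → ℝ | ∀ l, StrictMono (y l)} = Set.univ :=
      Set.eq_univ_of_forall fun y l => l.elim0
    rw [dysonLaw, h1, Measure.restrict_univ, withDensity_apply _ MeasurableSet.univ]
    simp [dysonDensity, volume_pi]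
  | succ n => exact isProbabilityMeasure_dysonLaw_succ ht (h0 0)

theorem tendstoInDistribution_of_subsingleton {E : Type*} [TopologicalSpace E] [MeasurableSpace E]
    [OpensMeasurableSpace E] [Subsingleton E] {Ω' : Type*} [MeasurableSpace Ω'] {P' : Measure Ω'}
    [IsProbabilityMeasure P'] (X : ℕ → Ω → E) (Z : Ω' → E) :
    TendstoInDistribution X atTop Z (fun _ => P) P' := by
  have hX : ∀ N, AEMeasurable (X N) P := fun N => (measurable_of_subsingleton_codomain _).aemeasurable
  have hZ : AEMeasurable Z P' := (measurable_of_subsingleton_codomain _).aemeasurable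
  have h : ∀ μ ν : ProbabilityMeasure E, μ = ν := by
    intro μ ν
    refine Subtype.ext (Measure.ext fun s _ => ?_)
    rcases Subsingleton.set_cases (p := fun s => s = ∅ ∨ s = Set.univ) (Or.inl rfl) (Or.inr rfl) s with rfl | rfl
    · simp
    · exact (measure_univ (μ := (μ : Measure E))).trans (measure_univ (μ := (ν : Measure E))).symm
  refine ⟨hX, hZ, ?_⟩
  rw [show (fun N => (⟨P.map (X N), Measure.isProbabilityMeasure_map (hX N)⟩ : ProbabilityMeasure E))
    = fun _ => ⟨P'.map Z, Measure.isProbabilityMeasure_map hZ⟩ from funext fun N => h _ _]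
  exact tendsto_const_nhds

theorem tendstoInDistribution_rescaledCoinLine (hβ : IsFairCoins P β) (hk : 1 ≤ k) {m : ℕ}
    {t : Fin m → ℝ≥0} (ht : StrictMono t) (h0 : ∀ l, 0 < t l) [IsProbabilityMeasure (dysonLaw k t)] :
    TendstoInDistribution (fun (N : ℕ) ω l => rescaledCoinLine β k N (t l) ω) atTop id (fun _ => P)
      (dysonLaw k t) := by
  cases m with
  | zero => exact tendstoInDistribution_of_subsingleton _ _
  | succ n =>
    refine tendstoInDistribution_of_norm_sub_le (tendstoInDistribution_gridLine_succ hβ hk ht (h0 0))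
      (fun N => (measurable_pi_lambda _ fun l => hβ.measurable_rescaledCoinLine N (t l)).aemeasurable)
      (k + 4) fun N hN => ?_
    have h1 : ∀ᵐ ω ∂P, ∀ l, ‖rescaledCoinLine β k N (t l) ω - gridLine β k t N ω l‖ ≤ (k + 4 : ℝ) / √(N : ℝ) :=
      ae_all_iff.2 fun l => ae_norm_rescaledCoinLine_sub_le hβ N hN (t l)
    filter_upwards [h1] with ω hω
    exact (pi_norm_le_iff_of_nonneg (by positivity)).2 hω

/-- Arbitrary times are reduced to the increasing enumeration of the positive ones among them. -/
theorem tendstoInDistribution_rescaledCoinLine_dysonBM (hβ : IsFairCoins P β) (hk : 1 ≤ k)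
    {Ω' : Type*} [MeasurableSpace Ω'] {P' : Measure Ω'} [IsProbabilityMeasure P']
    {Y : ℝ≥0 → Ω' → Fin k → ℝ} (hY : IsDysonBM k Y P') {m : ℕ} (t : Fin m → ℝ≥0) :
    TendstoInDistribution (fun (N : ℕ) ω l => rescaledCoinLine β k N (t l) ω) atTop
      (fun ω l => Y (t l) ω) (fun _ => P) P' := by
  set S : Finset ℝ≥0 := (Finset.univ.image t).filter (0 < ·) with hS
  set s : Fin S.card ↪o ℝ≥0 := S.orderEmbOfFin rfl with hs
  have hs0 : ∀ a, 0 < s a := fun a => (Finset.mem_filter.1 (S.orderEmbOfFin_mem rfl a)).2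
  have hts : ∀ l, t l ≠ 0 → ∃ a, s a = t l := by
    intro l hl
    have : t l ∈ S := Finset.mem_filter.2
      ⟨Finset.mem_image_of_mem _ (Finset.mem_univ l), pos_iff_ne_zero.2 hl⟩
    have hr : Set.range s = S := S.range_orderEmbOfFin rfl
    have : t l ∈ Set.range s := by rw [hr]; exact this
    exact this
  have hprob : IsProbabilityMeasure (dysonLaw k s) := isProbabilityMeasure_dysonLaw s.strictMono hs0
  have hlaw := hY.hasLaw S.card s s.strictMono hs0
  have h1 := tendstoInDistribution_rescaledCoinLine hβ hk s.strictMono hs0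
  have h2 : TendstoInDistribution (fun (N : ℕ) ω a => rescaledCoinLine β k N (s a) ω) atTop
      (fun ω a => Y (s a) ω) (fun _ => P) P' := by
    refine ⟨h1.forall_aemeasurable, hlaw.aemeasurable, ?_⟩
    have h3 := h1.tendsto
    have e : (⟨(dysonLaw k s).map id, Measure.isProbabilityMeasure_map h1.aemeasurable_limit⟩ :
        ProbabilityMeasure (Fin S.card → Fin k → ℝ))
        = ⟨P'.map fun ω a => Y (s a) ω, Measure.isProbabilityMeasure_map hlaw.aemeasurable⟩ :=
      Subtype.ext (by simp only [Measure.map_id]; exact hlaw.map_eq.symm)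
    rw [e] at h3
    exact h3
  choose a ha using hts
  set g : (Fin S.card → Fin k → ℝ) → (Fin m → Fin k → ℝ) :=
    fun y l => if h : t l = 0 then 0 else y (a l h) with hg
  have hgc : Continuous g := by
    refine continuous_pi fun l => ?_
    by_cases h : t l = 0
    · simp only [hg, h, dite_true]
      exact continuous_const
    · simp only [hg, h, dite_false]
      exact continuous_apply _
  have h3 := h2.continuous_comp hgc
  have h4 : g ∘ (fun ω a => Y (s a) ω) =ᵐ[P'] fun ω l => Y (t l) ω := by
    filter_upwards [hY.start] with ω hω
    funext l
    by_cases h : t l = 0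
    · simp only [Function.comp_apply, hg, h, dite_true, hω]
    · simp only [Function.comp_apply, hg, h, dite_false, ha]
  refine tendstoInDistribution_of_norm_sub_le (h3.congr (fun N => EventuallyEq.rfl) h4)
    (fun N => (measurable_pi_lambda _ fun l => hβ.measurable_rescaledCoinLine N (t l)).aemeasurable)
    (2 * k) fun N hN => ae_of_all _ fun ω => ?_
  have hsq : 0 < √(N : ℝ) := Real.sqrt_pos.2 (by exact_mod_cast hN)
  refine (pi_norm_le_iff_of_nonneg (by positivity)).2 fun l => ?_
  rw [Pi.sub_apply]
  by_cases h : t l = 0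
  · simp only [Function.comp_apply, hg, h, dite_true, sub_zero]
    refine (pi_norm_le_iff_of_nonneg (by positivity)).2 fun i => ?_
    have hi : ((i : ℕ) : ℝ) + 1 ≤ k := by exact_mod_cast i.2
    have e : rescaledCoinLine β k N 0 ω i = 2 * (((i : ℕ) : ℝ) + 1) / √(N : ℝ) := by
      rw [rescaledCoinLine_apply]
      simp only [linInterp, NNReal.coe_zero, mul_zero, Nat.floor_zero, coinLine_zero]
      push_cast
      field_simp
      ring
    rw [e, Real.norm_eq_abs, abs_of_nonneg (by positivity)]
    exact div_le_div_of_nonneg_right (by linarith) hsq.le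
  · simp only [Function.comp_apply, hg, h, dite_false, ha, sub_self, norm_zero]
    positivity

end RealTimes

theorem mainTheorem3 {Ω : Type*} [MeasurableSpace Ω] (P : Measure Ω) [IsProbabilityMeasure P]
    (β : (j : ℕ) → Fin j → ℕ → Ω → ℤ)
    (hmeas : ∀ j i t, Measurable (β j i t))
    (hindep : iIndepFun (fun p : (Σ j : ℕ, Fin j × ℕ) => β p.1 p.2.1 p.2.2) P)
    (hzero : ∀ j i t, P {ω | β j i t ω = 0} = 1 / 2)
    (hone : ∀ j i t, P {ω | β j i t ω = 1} = 1 / 2)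
    (k : ℕ) (hk : 1 ≤ k) :
    (∀ (m : ℕ) (t : Fin m → ℝ≥0), StrictMono t → (∀ l, 0 < t l) →
      ∃ _ : IsProbabilityMeasure (dysonLaw k t),
        TendstoInDistribution
          (fun (N : ℕ) ω l => rescaledLine (fun j i s => β j i s ω) k N (t l))
          atTop id (fun _ => P) (dysonLaw k t)) ∧
    (∀ {Ω' : Type*} [MeasurableSpace Ω'] (P' : Measure Ω') [IsProbabilityMeasure P']
      (Y : ℝ≥0 → Ω' → Fin k → ℝ), IsDysonBM k Y P' →
      ∀ (m : ℕ) (t : Fin m → ℝ≥0),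
        TendstoInDistribution
          (fun (N : ℕ) ω l => rescaledLine (fun j i s => β j i s ω) k N (t l))
          atTop (fun ω l => Y (t l) ω) (fun _ => P) P') := by
  have hβ : IsFairCoins P β := ⟨hmeas, hindep, hzero, hone⟩
  refine ⟨fun m t ht h0 => ?_, fun P' _ Y hY m t => tendstoInDistribution_rescaledCoinLine_dysonBM hβ hk hY t⟩
  have hprob := isProbabilityMeasure_dysonLaw (k := k) ht h0
  exact ⟨hprob, tendstoInDistribution_rescaledCoinLine hβ hk ht h0⟩
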